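/- Let $G_{\mathbb R}\subset GL(n,\mathbb R)$ be a subgroup that is the zero locus of a set of polynomial functions on $M_n(\mathbb R)$ and is invariant under transpose, and let $p:G\to G_o$ be a finite covering homomorphism of Lie groups onto an open subgroup $G_o$ of $G_{\mathbb R}$. Let $K=p^{-1}(O(n))$, let $B(X,Y)=\operatorname{tr}(XY)$ on $Lie(G)=Lie(G_{\mathbb R})\subset M_n(\mathbb R)$, let $C$ and $C_K$ be the Casimir elements of $G$ and $K$ corresponding to $B$, and let $\|g\|$ be the Hilbert–Schmidt norm of $\begin{pmatrix}p(g)&0\\0&p(g^{-1})^T\end{pmatrix}$. A Hilbert representation $(\pi,H)$ of $G$ is a strongly continuous homomorphism $\pi$ from $G$ to the bounded invertible operators on a complex Hilbert space $H$; $H^\infty$ is the space of $v\in H$ for which $g\mapsto\pi(g)v$ is $C^\infty$, with the topology given by the seminorms $v\mapsto\|xv\|$, $x\in U(\mathfrak g)$. (1) If $(\pi,H)$ is a Hilbert representation of $G$ such that $C$ acts on $H^\infty$ as a scalar $c\in\mathbb C$, then the topology of $H^\infty$ is given by the seminorms $p_l(v)=\|(I+C_K)^l v\|$, $l=0,1,2,\dots$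 (2) Let $(\pi,H)$ be a Hilbert representation of $G$ whose inner product $(\cdot,\cdot)$ is $K$-invariant, let $V=(H^\infty)_K$ be the space of $K$-finite vectors in $H^\infty$, and let $v_1,\dots,v_N$ be an orthonormal basis of a subspace $W\subset V$ that is invariant under $K$ and under the center $Z(\mathfrak g)$ of $U(\mathfrak g)$ and satisfies $V=U(\mathfrak g)W$. Put $\widehat\pi(g)=\pi(g^{-1})^*$. Let $dg$ be a Haar measure on $G$ and let $A,d,d_o$ be real numbers such that $\|\widehat\pi(g)\|\le A\|g\|^d$ for all $g\in G$ and $\int_G\|g\|^{-d_o}dg<\infty$. Let $H_1$ be the Hilbert space completion of $H$ with respect to $$\langle v,w\rangle=\sum_{i=1}^N\int_G (v_i,\widehat\pi(g)w)\,(\widehat\pi(g)v,v_i)\,\|g\|^{-2d-d_o}\,dg ,$$ with norm $\|\cdot\|_1$. Then $\widehat\pi$ extends to a Hilbert representation $(\pi_1,H_1)$ of $G$, and the topology of $H_1^\infty$ is given by the seminorms $p_l(v)=\|(I+C_K)^l v\|_1$, $l=0,1,2,\dots$ -/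

import Mathlib

open scoped Manifold ContDiff Topology Matrix
open VectorField Bundle MeasureTheory

namespace RealReductive

/-! ### Differentiation along vector fields on a Lie group -/

section FieldDerivative

theorem clm_zero_add {E₁ E₂ E₃ : Type*} [AddCommGroup E₁] [Module ℝ E₁] [TopologicalSpace E₁]
    [AddCommGroup E₂] [Module ℝ E₂] [TopologicalSpace E₂]
    [AddCommGroup E₃] [Module ℝ E₃] [TopologicalSpace E₃]
    (L : E₁ →L[ℝ] E₃) (L' : E₂ →L[ℝ] E₃) (x : E₂) : L' x = L 0 + L' x := by simp

variable {m : ℕ} {G : Type*} [TopologicalSpace G] [ChartedSpace (EuclideanSpace ℝ (Fin m)) G]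
  {F : Type*} [NormedAddCommGroup F] [NormedSpace ℝ F]

/-- The derivative of a function along a vector field. -/
noncomputable def fieldDeriv (V : Π g : G, TangentSpace (𝓡 m) g) (f : G → F) (g : G) : F :=
  mfderiv (𝓡 m) 𝓘(ℝ, F) f g (V g)

theorem mfderiv_clm_comp {F' : Type*} [NormedAddCommGroup F'] [NormedSpace ℝ F'] (T : F →L[ℝ] F') {f : G → F} {g : G}
    (hf : MDifferentiableAt (𝓡 m) 𝓘(ℝ, F) f g) (Y : TangentSpace (𝓡 m) g) :
    (mfderiv (𝓡 m) 𝓘(ℝ, F') (fun x => T (f x)) g Y : F') =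
      T (mfderiv (𝓡 m) 𝓘(ℝ, F) f g Y : F) := by
  have h := (T.hasMFDerivAt (x := f g)).comp g hf.hasMFDerivAt
  have h2 := h.mfderiv
  change mfderiv (𝓡 m) 𝓘(ℝ, F') (T ∘ f) g Y = _
  rw [h2]; rfl

variable [Group G] [LieGroup (𝓡 m) ∞ G]

/-- A smooth Lie group carries Mathlib's Lie bracket on its tangent space at the identity. -/
instance lieGroupMinSmoothness : LieGroup (𝓡 m) (minSmoothness ℝ 3) G := by
  rw [minSmoothness_of_isRCLikeNormedField]; infer_instance

/-- Left invariant vector fields are smooth. -/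
theorem contMDiff_invField (X : GroupLieAlgebra (𝓡 m) G) :
    ContMDiff (𝓡 m) (𝓡 m).tangent ∞
      (fun g : G => (⟨g, mulInvariantVectorField X g⟩ : TangentBundle (𝓡 m) G)) := by
  let fg : G → TangentBundle (𝓡 m) G := fun g ↦ TotalSpace.mk' _ g 0
  have sfg : ContMDiff (𝓡 m) (𝓡 m).tangent ∞ fg := contMDiff_zeroSection _ _
  let fv : G → TangentBundle (𝓡 m) G := fun _ ↦ TotalSpace.mk' _ 1 X
  have sfv : ContMDiff (𝓡 m) (𝓡 m).tangent ∞ fv := contMDiff_const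
  let F₁ : G → (TangentBundle (𝓡 m) G × TangentBundle (𝓡 m) G) := fun g ↦ (fg g, fv g)
  have S₁ := sfg.prodMk sfv
  let F₂ : (TangentBundle (𝓡 m) G × TangentBundle (𝓡 m) G) →
      TangentBundle ((𝓡 m).prod (𝓡 m)) (G × G) :=
    (equivTangentBundleProd (𝓡 m) G (𝓡 m) G).symm
  have S₂ : ContMDiff _ _ ∞ F₂ := contMDiff_equivTangentBundleProd_symm
  let F₃ : TangentBundle ((𝓡 m).prod (𝓡 m)) (G × G) → TangentBundle (𝓡 m) G :=
    tangentMap _ _ (fun (p : G × G) ↦ p.1 * p.2)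
  have S₃ : ContMDiff _ _ ∞ F₃ :=
    ContMDiff.contMDiff_tangentMap (contMDiff_mul (𝓡 m) ∞) (m := ∞) (by simp)
  convert! (S₃.comp S₂).comp S₁ with g
  · simp [F₂, F₃, fg, fv]
  · simp only [Function.comp_apply, tangentMap, F₃, F₂, fg, fv]
    rw [mfderiv_prod_eq_add_apply ((contMDiff_mul (𝓡 m) ∞).mdifferentiableAt (by simp))]
    exact clm_zero_add
      (E₁ := TangentSpace (𝓡 m) g) (E₂ := TangentSpace (𝓡 m) (1 : G)) (E₃ := TangentSpace (𝓡 m) (g * 1))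
      (mfderiv (𝓡 m) (𝓡 m) (fun z : G => z * 1) g)
      (mfderiv (𝓡 m) (𝓡 m) (fun z : G => g * z) 1) X

theorem contMDiff_deriv_invField {f : G → F} (hf : ContMDiff (𝓡 m) 𝓘(ℝ, F) ∞ f)
    (X : GroupLieAlgebra (𝓡 m) G) :
    ContMDiff (𝓡 m) 𝓘(ℝ, F) ∞
      (fieldDeriv (mulInvariantVectorField X) f) := by
  have h1 := (hf.contMDiff_tangentMap (m := ∞) (by simp)).comp (contMDiff_invField X)
  exact (contMDiff_snd_tangentBundle_modelSpace F 𝓘(ℝ, F)).comp h1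

theorem mfderiv_leftInv {f : G → F} (hf : ContMDiff (𝓡 m) 𝓘(ℝ, F) ∞ f) (g : G)
    (X : GroupLieAlgebra (𝓡 m) G) :
    (mfderiv (𝓡 m) 𝓘(ℝ, F) (fun h => f (g * h)) 1 X : F) =
      fieldDeriv (mulInvariantVectorField X) f g := by
  have h1 : MDifferentiableAt (𝓡 m) 𝓘(ℝ, F) f (g * 1) := hf.mdifferentiableAt (by simp)
  have h2 : MDifferentiableAt (𝓡 m) (𝓡 m) (g * · : G → G) 1 :=
    (contMDiff_mul_left (I := 𝓡 m) (n := ∞)).mdifferentiableAt (by simp)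
  have := mfderiv_comp_apply 1 h1 h2 X
  change mfderiv (𝓡 m) 𝓘(ℝ, F) (f ∘ (g * ·)) 1 X = _
  rw [this, mul_one]; rfl


theorem fieldDeriv_bracket {f : G → F} (hf : ContMDiff (𝓡 m) 𝓘(ℝ, F) ∞ f)
    (V W : Π g : G, TangentSpace (𝓡 m) g) (x : G)
    (hV : MDifferentiableAt (𝓡 m) (𝓡 m).tangent (fun g => (⟨g, V g⟩ : TangentBundle (𝓡 m) G)) x)
    (hW : MDifferentiableAt (𝓡 m) (𝓡 m).tangent (fun g => (⟨g, W g⟩ : TangentBundle (𝓡 m) G)) x)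
    (hWf : MDifferentiable (𝓡 m) 𝓘(ℝ, F) (fieldDeriv W f))
    (hVf : MDifferentiable (𝓡 m) 𝓘(ℝ, F) (fieldDeriv V f)) :
    fieldDeriv (mlieBracket (𝓡 m) V W) f x =
      fieldDeriv V (fieldDeriv W f) x - fieldDeriv W (fieldDeriv V f) x := by
  have : IsManifold (𝓡 m) ∞ G := inferInstance
  set φ := extChartAt (𝓡 m) x with hφ
  have hyt : φ x ∈ φ.target := mem_extChartAt_target x
  let P (Y : Π g : G, TangentSpace (𝓡 m) g) :
      EuclideanSpace ℝ (Fin m) → EuclideanSpace ℝ (Fin m) :=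
    mpullbackWithin 𝓘(ℝ, EuclideanSpace ℝ (Fin m)) (𝓡 m) φ.symm Y (Set.range (𝓡 m))
  have hrange : Set.range (𝓡 m) = Set.univ := (𝓡 m).range_eq_univ
  have hPd : ∀ Y : Π g : G, TangentSpace (𝓡 m) g,
      MDifferentiableAt (𝓡 m) (𝓡 m).tangent (fun g => (⟨g, Y g⟩ : TangentBundle (𝓡 m) G)) x →
      DifferentiableAt ℝ (P Y) (φ x) := by
    intro Y hY
    have h := (MDifferentiableAt.mdifferentiableWithinAt (s := Set.univ)
      hY).differentiableWithinAt_mpullbackWithin_vectorField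
    exact h.differentiableAt (by simp)
  have key : ∀ h : G → F, ∀ z ∈ φ.target, MDifferentiableAt (𝓡 m) 𝓘(ℝ, F) h (φ.symm z) →
      ∀ Y : Π g : G, TangentSpace (𝓡 m) g,
      fderiv ℝ (h ∘ φ.symm) z (P Y z) = fieldDeriv Y h (φ.symm z) := by
    intro h z hz hh Y
    have h1 : MDifferentiableAt 𝓘(ℝ, EuclideanSpace ℝ (Fin m)) (𝓡 m) φ.symm z := by
      have := mdifferentiableWithinAt_extChartAt_symm (I := 𝓡 m) hz
      rwa [hrange, mdifferentiableWithinAt_univ] at this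
    have h2 : (mfderivWithin 𝓘(ℝ, EuclideanSpace ℝ (Fin m)) (𝓡 m) φ.symm
        (Set.range (𝓡 m)) z).IsInvertible := isInvertible_mfderivWithin_extChartAt_symm hz
    have h3 := mfderiv_comp_apply z hh h1 (P Y z)
    rw [mfderiv_eq_fderiv] at h3
    refine h3.trans ?_
    have h4 : (mfderiv 𝓘(ℝ, EuclideanSpace ℝ (Fin m)) (𝓡 m) φ.symm z) (P Y z) = Y (φ.symm z) := by
      have h5 := h2.self_apply_inverse (Y (φ.symm z))
      change (mfderivWithin 𝓘(ℝ, EuclideanSpace ℝ (Fin m)) (𝓡 m) φ.symm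
        (Set.range (𝓡 m)) z) (P Y z) = Y (φ.symm z) at h5
      rwa [hrange, mfderivWithin_univ] at h5
    rw [h4]; rfl
  have hsx : φ.symm (φ x) = x := extChartAt_to_inv x
  have hbr : P (mlieBracket (𝓡 m) V W) (φ x) = lieBracket ℝ (P V) (P W) (φ x) := by
    have h1 : mlieBracket (𝓡 m) V W x = lieBracket ℝ (P V) (P W) (φ x) := by
      have h2 := mlieBracketWithin_apply (I := 𝓡 m) (V := V) (W := W) (s := Set.univ) (x₀ := x)
      rw [mfderiv_extChartAt_self] at h2
      refine h2.trans ?_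
      refine (DFunLike.congr_fun (ContinuousLinearMap.inverse_id (R := ℝ)
        (M := TangentSpace (𝓡 m) x)) _).trans ?_
      change lieBracketWithin ℝ (P V) (P W) (φ.symm ⁻¹' Set.univ ∩ Set.range (𝓡 m)) (φ x) = _
      rw [Set.preimage_univ, Set.univ_inter, hrange, lieBracketWithin_univ]
    rw [← h1]
    have h3 := mfderivWithin_extChartAt_symm_inverse_apply (I := 𝓡 m) (x := x)
      (mlieBracket (𝓡 m) V W x)
    change (mfderivWithin 𝓘(ℝ, EuclideanSpace ℝ (Fin m)) (𝓡 m) φ.symm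
        (Set.range (𝓡 m)) (φ x)).inverse (mlieBracket (𝓡 m) V W (φ.symm (φ x))) = _
    rw [hsx]
    exact h3
  have hnhds : φ.target ∈ 𝓝 (φ x) := extChartAt_target_mem_nhds x
  have hfm : ∀ z, MDifferentiableAt (𝓡 m) 𝓘(ℝ, F) f z := fun z => hf.mdifferentiableAt (by simp)
  have hF : ContDiffAt ℝ ∞ (f ∘ φ.symm) (φ x) := by
    rw [← contMDiffAt_iff_contDiffAt]
    refine (hf _).comp _ ?_
    exact (contMDiffOn_extChartAt_symm x).contMDiffAt hnhds
  have hmain := fderiv_apply_lieBracket (hF) (by rw [minSmoothness_of_isRCLikeNormedField]; exact ENat.LEInfty.out) (hPd W hW) (hPd V hV)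
  have hE : ∀ Y : Π g : G, TangentSpace (𝓡 m) g,
      (fun z => fderiv ℝ (f ∘ φ.symm) z (P Y z)) =ᶠ[𝓝 (φ x)] (fieldDeriv Y f) ∘ φ.symm := by
    intro Y
    filter_upwards [hnhds] with z hz
    exact key f z hz (hfm _) Y
  rw [(hE W).fderiv_eq, (hE V).fderiv_eq, ← hbr, key f _ hyt (hfm _), key _ _ hyt (hWf _),
    key _ _ hyt (hVf _), hsx] at hmain
  exact hmain

end FieldDerivative

/-! ### Real reductive groups -/

section Group

variable (m : ℕ) {n : ℕ} {G : Type*} [Group G] [TopologicalSpace G]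
  [ChartedSpace (EuclideanSpace ℝ (Fin m)) G]

/-- The differential at the identity of a homomorphism `p : G → GL(n, ℝ)`, computed entry by entry,
as a linear map from `Lie(G)` to `M_n(ℝ)`. -/
noncomputable def differential (p : G →* GL (Fin n) ℝ) :
    GroupLieAlgebra (𝓡 m) G →ₗ[ℝ] Matrix (Fin n) (Fin n) ℝ where
  toFun X := Matrix.of fun i j =>
    (mfderiv (𝓡 m) 𝓘(ℝ, ℝ) (fun g => (p g : Matrix (Fin n) (Fin n) ℝ) i j) 1 X : ℝ)
  map_add' X Y := by
    ext i j
    exact ContinuousLinearMap.map_add (mfderiv (𝓡 m) 𝓘(ℝ, ℝ)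
      (fun g => (p g : Matrix (Fin n) (Fin n) ℝ) i j) 1) X Y
  map_smul' c X := by
    ext i j
    exact ContinuousLinearMap.map_smul (mfderiv (𝓡 m) 𝓘(ℝ, ℝ)
      (fun g => (p g : Matrix (Fin n) (Fin n) ℝ) i j) 1) c X

/-- `GR` is the locus of zeros in `GL(n, ℝ)` of a set of polynomial functions on `M_n(ℝ)` and is
invariant under matrix transpose. -/
def IsSelfAdjointAlgebraic (GR : Subgroup (GL (Fin n) ℝ)) : Prop :=
  (∃ S : Set (MvPolynomial (Fin n × Fin n) ℝ), ∀ g : GL (Fin n) ℝ, g ∈ GR ↔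
    ∀ f ∈ S, MvPolynomial.eval
      (fun ij => (g : Matrix (Fin n) (Fin n) ℝ) ij.1 ij.2) f = 0) ∧
  ∀ g ∈ GR, ∃ h ∈ GR, (h : Matrix (Fin n) (Fin n) ℝ) = (g : Matrix (Fin n) (Fin n) ℝ)ᵀ

/-- The Lie algebra of a closed subgroup of `GL(n, ℝ)`, as a set of matrices. -/
def matrixLieAlgebra (GR : Subgroup (GL (Fin n) ℝ)) : Set (Matrix (Fin n) (Fin n) ℝ) :=
  {X | ∀ t : ℝ, ∃ g ∈ GR, (g : Matrix (Fin n) (Fin n) ℝ) = NormedSpace.exp (t • X)}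

/-- The Lie group `G`, together with `p : G → GL(n, ℝ)`, is a real reductive group: `p` is a finite
covering homomorphism of Lie groups from `G` onto an open subgroup of a transpose invariant real
algebraic group `GR`. The last clause says that `p` is a local diffeomorphism onto its image in the
closed subgroup `GR`, so that `Lie(G) = Lie(GR)`. -/
structure IsRealReductive (p : G →* GL (Fin n) ℝ) : Prop where
  isCoveringMap : IsCoveringMap p.rangeRestrict
  finite_ker : Finite p.ker
  contMDiff : ∀ i j, ContMDiff (𝓡 m) 𝓘(ℝ, ℝ) ∞
    fun g => (p g : Matrix (Fin n) (Fin n) ℝ) i j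
  exists_algebraic : ∃ GR : Subgroup (GL (Fin n) ℝ), IsSelfAdjointAlgebraic GR ∧
    (∃ O : Set (GL (Fin n) ℝ), IsOpen O ∧ (p.range : Set (GL (Fin n) ℝ)) = O ∩ GR) ∧
    Set.BijOn (differential m p) Set.univ (matrixLieAlgebra GR)

/-- The maximal compact subgroup `K = p⁻¹(O(n))`. -/
def maximalCompact {G : Type*} [Group G] (p : G →* GL (Fin n) ℝ) : Subgroup G where
  carrier := {g | (p g : Matrix (Fin n) (Fin n) ℝ) ∈ Matrix.orthogonalGroup (Fin n) ℝ}
  one_mem' := by simp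
  mul_mem' {a b} ha hb := by
    simpa using mul_mem ha hb
  inv_mem' {a} ha := by
    simp only [Set.mem_ofPred_eq] at ha ⊢
    have h : ((p a)⁻¹ : GL (Fin n) ℝ) = star (p a : Matrix (Fin n) (Fin n) ℝ) :=
      Units.inv_eq_of_mul_eq_one_right ((Matrix.mem_orthogonalGroup_iff _ _).1 ha)
    rw [map_inv, h]
    exact Unitary.star_mem ha

/-- The norm `‖g‖`: the Hilbert-Schmidt norm of the block diagonal matrix with blocks `p(g)` and
the transpose of `p(g⁻¹)`. -/
noncomputable def groupNorm {G : Type*} [Group G] (p : G →* GL (Fin n) ℝ) (g : G) : ℝ :=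
  let r : Matrix (Fin n ⊕ Fin n) (Fin n ⊕ Fin n) ℝ :=
    Matrix.fromBlocks (p g : Matrix (Fin n) (Fin n) ℝ) 0 0 (p g⁻¹ : Matrix (Fin n) (Fin n) ℝ)ᵀ
  Real.sqrt (r * rᵀ).trace

instance finiteDimensionalLieAlgebra : FiniteDimensional ℝ (GroupLieAlgebra (𝓡 m) G) :=
  inferInstanceAs (FiniteDimensional ℝ (EuclideanSpace ℝ (Fin m)))

/-- The form `B(X, Y) = tr(XY)` on `Lie(G)`. -/
noncomputable def traceForm (p : G →* GL (Fin n) ℝ) (X Y : GroupLieAlgebra (𝓡 m) G) : ℝ :=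
  (differential m p X * differential m p Y).trace

/-- `Lie(K)`: as `K = p⁻¹(O(n))`, the elements of `Lie(G)` with skew-symmetric image. -/
noncomputable def compactLie (p : G →* GL (Fin n) ℝ) :
    Submodule ℝ (GroupLieAlgebra (𝓡 m) G) where
  carrier := {X | (differential m p X)ᵀ = -differential m p X}
  zero_mem' := by simp
  add_mem' {X Y} hX hY := by
    simp only [Set.mem_ofPred_eq] at hX hY ⊢
    rw [map_add, Matrix.transpose_add, hX, hY, neg_add]
  smul_mem' c X hX := by
    simp only [Set.mem_ofPred_eq] at hX ⊢
    rw [map_smul, Matrix.transpose_smul, hX, smul_neg]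

variable (G) in
/-- The universal enveloping algebra of the real Lie algebra of `G`. -/
abbrev Env [LieGroup (𝓡 m) ∞ G] : Type _ :=
  UniversalEnvelopingAlgebra ℝ (GroupLieAlgebra (𝓡 m) G)

/-- The Casimir element attached to the restriction of `B` to a subspace `S` of `Lie(G)`, namely
`∑ B^{ij} X_i X_j` where `X_i` is a basis of `S` and `B^{ij}` is the inverse of the matrix
`B(X_i, X_j)`. It does not depend on the basis if `B` is nondegenerate on `S`. -/
noncomputable def casimirOf [LieGroup (𝓡 m) ∞ G] (p : G →* GL (Fin n) ℝ)
    (S : Submodule ℝ (GroupLieAlgebra (𝓡 m) G)) : Env m G :=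
  let X := Module.finBasis ℝ S
  let gram : Matrix (Fin (Module.finrank ℝ S)) (Fin (Module.finrank ℝ S)) ℝ :=
    Matrix.of fun i j => traceForm m p (X i) (X j)
  ∑ i, ∑ j, gram⁻¹ i j •
    (UniversalEnvelopingAlgebra.ι ℝ (X i : GroupLieAlgebra (𝓡 m) G) *
      UniversalEnvelopingAlgebra.ι ℝ (X j : GroupLieAlgebra (𝓡 m) G))

/-- The Casimir element `C` of `G`. -/
noncomputable def casimir [LieGroup (𝓡 m) ∞ G] (p : G →* GL (Fin n) ℝ) : Env m G :=
  casimirOf m p ⊤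

/-- The Casimir element `C_K` of `K`. -/
noncomputable def casimirK [LieGroup (𝓡 m) ∞ G] (p : G →* GL (Fin n) ℝ) : Env m G :=
  casimirOf m p (compactLie m p)

end Group

/-! ### Hilbert representations and their smooth vectors -/

/-- A Hilbert representation of `G` on `H`: a strongly continuous homomorphism from `G` to the
bounded (automatically invertible) operators on `H`. -/
structure HilbertRep (G : Type*) [Group G] [TopologicalSpace G] (H : Type*)
    [NormedAddCommGroup H] [InnerProductSpace ℂ H] where
  toHom : G →* (H →L[ℂ] H)
  continuous_orbit : ∀ v : H, Continuous fun g => toHom g v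

namespace HilbertRep

section Smooth

variable (m : ℕ) {n : ℕ} {G : Type*} [Group G] [TopologicalSpace G]
  [ChartedSpace (EuclideanSpace ℝ (Fin m)) G]
  {H : Type*} [NormedAddCommGroup H] [InnerProductSpace ℂ H]
  (ρ : HilbertRep G H)

/-- The space `H^∞` of smooth vectors: those `v` for which `g ↦ ρ(g)v` is of class `C^∞`. -/
def smoothVectors : Submodule ℂ H where
  carrier := {v | ContMDiff (𝓡 m) 𝓘(ℝ, H) ∞ fun g => ρ.toHom g v}
  zero_mem' := by simpa using contMDiff_const
  add_mem' {v w} hv hw := by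
    have h := ContMDiff.add hv hw
    simp only [Set.mem_ofPred_eq, map_add]
    exact h
  smul_mem' c v hv := by
    have h := ((c • ContinuousLinearMap.id ℂ H).restrictScalars ℝ).contMDiff (n := ∞).comp hv
    simpa [Function.comp_def] using h

variable {m} in
theorem mdifferentiable_orbit (v : ρ.smoothVectors m) :
    MDifferentiable (𝓡 m) 𝓘(ℝ, H) fun g => ρ.toHom g v :=
  ContMDiff.mdifferentiable v.2 (by simp)

variable {m} in
/-- The derivative at the identity of the orbit map of a smooth vector. -/
noncomputable def derivAt (X : GroupLieAlgebra (𝓡 m) G) (v : ρ.smoothVectors m) : H :=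
  mfderiv (𝓡 m) 𝓘(ℝ, H) (fun g => ρ.toHom g v) 1 X

variable [LieGroup (𝓡 m) ∞ G]

variable {m} in
theorem toHom_derivAt (X : GroupLieAlgebra (𝓡 m) G) (v : ρ.smoothVectors m) (g : G) :
    ρ.toHom g (ρ.derivAt X v) =
      fieldDeriv (mulInvariantVectorField X) (fun g => ρ.toHom g v) g := by
  rw [← mfderiv_leftInv v.2 g X]
  have h := mfderiv_clm_comp ((ρ.toHom g).restrictScalars ℝ) (ρ.mdifferentiable_orbit v 1) X
  have e : (fun x => ρ.toHom (g * x) (v : H)) = fun x => ρ.toHom g (ρ.toHom x v) := by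
    funext x
    rw [map_mul]
    rfl
  exact ((congrArg (fun f : G → H => (mfderiv (𝓡 m) 𝓘(ℝ, H) f 1 X : H)) e).trans h).symm

variable {m} in
theorem derivAt_mem (X : GroupLieAlgebra (𝓡 m) G) (v : ρ.smoothVectors m) :
    ρ.derivAt X v ∈ ρ.smoothVectors m := by
  change ContMDiff _ _ _ fun g => ρ.toHom g (ρ.derivAt X v)
  simp only [toHom_derivAt]
  exact contMDiff_deriv_invField v.2 X

variable {m} in
/-- The operator `dρ(X)` on smooth vectors, `dρ(X)v = d/dt ρ(exp tX)v` at `t = 0`. -/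
noncomputable def deriv (X : GroupLieAlgebra (𝓡 m) G) :
    Module.End ℂ (ρ.smoothVectors m) where
  toFun v := ⟨ρ.derivAt X v, ρ.derivAt_mem X v⟩
  map_add' v w := by
    apply Subtype.ext
    have h := ((ρ.mdifferentiable_orbit v 1).hasMFDerivAt.add
      (ρ.mdifferentiable_orbit w 1).hasMFDerivAt).mfderiv
    have e : (fun x => ρ.toHom x ((v : H) + w)) = fun x => ρ.toHom x v + ρ.toHom x w :=
      funext fun x => map_add _ _ _
    exact (congrArg (fun f : G → H => (mfderiv (𝓡 m) 𝓘(ℝ, H) f 1 X : H)) e).trans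
      (DFunLike.congr_fun h X)
  map_smul' c v := by
    apply Subtype.ext
    have h := mfderiv_clm_comp ((c • ContinuousLinearMap.id ℂ H).restrictScalars ℝ)
      (ρ.mdifferentiable_orbit v 1) X
    have e : (fun x => ρ.toHom x (c • (v : H))) = fun x => c • ρ.toHom x v :=
      funext fun x => map_smul _ _ _
    exact (congrArg (fun f : G → H => (mfderiv (𝓡 m) 𝓘(ℝ, H) f 1 X : H)) e).trans h

attribute [local instance] LieRing.ofAssociativeRing

/-- The representation `dρ` of `Lie(G)` on smooth vectors. -/
noncomputable def derivedRep :
    GroupLieAlgebra (𝓡 m) G →ₗ⁅ℝ⁆ Module.End ℂ (ρ.smoothVectors m) where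
  toFun := ρ.deriv
  map_add' X Y := by
    ext v
    exact ContinuousLinearMap.map_add
      (mfderiv (𝓡 m) 𝓘(ℝ, H) (fun g => ρ.toHom g (v : H)) 1) X Y
  map_smul' c X := by
    ext v
    exact ContinuousLinearMap.map_smul
      (mfderiv (𝓡 m) 𝓘(ℝ, H) (fun g => ρ.toHom g (v : H)) 1) c X
  map_lie' {X Y} := by
    ext v
    have hX : ∀ (Z : GroupLieAlgebra (𝓡 m) G) (u : ρ.smoothVectors m),
        (fun g => ρ.toHom g (ρ.derivAt Z u)) =
          fieldDeriv (mulInvariantVectorField Z) (fun g => ρ.toHom g u) :=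
      fun Z u => funext (ρ.toHom_derivAt Z u)
    have hZ : ∀ (Z Z' : GroupLieAlgebra (𝓡 m) G),
        ((ρ.deriv Z (ρ.deriv Z' v) : ρ.smoothVectors m) : H) =
          fieldDeriv (mulInvariantVectorField Z)
            (fieldDeriv (mulInvariantVectorField Z') (fun g => ρ.toHom g v)) 1 := by
      intro Z Z'
      rw [← hX Z' v]
      have h := ρ.toHom_derivAt Z (ρ.deriv Z' v) 1
      rw [map_one] at h
      exact h
    have hm : ∀ Z : GroupLieAlgebra (𝓡 m) G, MDifferentiable (𝓡 m) 𝓘(ℝ, H)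
        (fieldDeriv (mulInvariantVectorField Z) (fun g => ρ.toHom g v)) :=
      fun Z => (contMDiff_deriv_invField v.2 Z).mdifferentiable (by simp)
    have hf : ∀ Z : GroupLieAlgebra (𝓡 m) G, MDifferentiableAt (𝓡 m) (𝓡 m).tangent
        (fun g : G => (⟨g, mulInvariantVectorField Z g⟩ : TangentBundle (𝓡 m) G)) 1 :=
      fun Z => (contMDiff_invField Z).mdifferentiableAt (by simp)
    have hb := fieldDeriv_bracket v.2 (mulInvariantVectorField X) (mulInvariantVectorField Y) 1
      (hf X) (hf Y) (hm Y) (hm X)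
    rw [← hZ X Y, ← hZ Y X] at hb
    exact hb

/-- The action of the universal enveloping algebra on smooth vectors. -/
noncomputable def envAction : Env m G →ₐ[ℝ] Module.End ℂ (ρ.smoothVectors m) :=
  UniversalEnvelopingAlgebra.lift ℝ (ρ.derivedRep m)

/-- The seminorm `v ↦ ‖x v‖` on `H^∞`, for `x` in the universal enveloping algebra. -/
noncomputable def envSeminorm (x : Env m G) : Seminorm ℂ (ρ.smoothVectors m) :=
  (normSeminorm ℂ H).comp ((ρ.smoothVectors m).subtype ∘ₗ ρ.envAction m x)

/-- The topology of `H^∞`: the one given by all the seminorms `v ↦ ‖x v‖`. -/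
@[reducible] noncomputable def smoothTopology : TopologicalSpace (ρ.smoothVectors m) :=
  SeminormFamily.moduleFilterBasis (fun x : Env m G => ρ.envSeminorm m x) |>.topology

/-- The seminorms `p_l(v) = ‖(I + C_K)^l v‖`, `l = 0, 1, 2, …`, on `H^∞`. -/
noncomputable def casimirSeminorm (p : G →* GL (Fin n) ℝ) :
    SeminormFamily ℂ (ρ.smoothVectors m) ℕ :=
  fun l => ρ.envSeminorm m ((1 + casimirK m p) ^ l)

end Smooth

section ConjugateDual

variable {n : ℕ} {G : Type*} [Group G] [TopologicalSpace G]
  {H : Type*} [NormedAddCommGroup H] [InnerProductSpace ℂ H]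
  (ρ : HilbertRep G H)

/-- The operators `ρ(g⁻¹)^*` of the conjugate dual representation. -/
noncomputable def conjDual [CompleteSpace H] (g : G) : H →L[ℂ] H :=
  ContinuousLinearMap.adjoint (ρ.toHom g⁻¹)

/-- The vector `v` is `K`-finite: its `K`-translates span a finite dimensional space. -/
def IsKFinite (p : G →* GL (Fin n) ℝ) (v : H) : Prop :=
  FiniteDimensional ℂ
    (Submodule.span ℂ ((fun k => ρ.toHom k v) '' (maximalCompact p : Set G)))

/-- The sesquilinear form
`∑_i ∫_G (w_i, ρ(g⁻¹)^* x) (ρ(g⁻¹)^* y, w_i) ‖g‖^(-a) dg`, where `( , )` is the inner product of `H`,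
linear in the first variable. It is conjugate linear in `x` and linear in `y`. -/
noncomputable def matrixCoeffForm [CompleteSpace H] [MeasurableSpace G] (p : G →* GL (Fin n) ℝ)
    (μ : Measure G) {N : ℕ} (w : Fin N → H) (a : ℝ) (x y : H) : ℂ :=
  ∑ i, ∫ g, inner ℂ (ρ.conjDual g x) (w i) * inner ℂ (w i) (ρ.conjDual g y) *
    ((groupNorm p g ^ (-a) : ℝ) : ℂ) ∂μ

end ConjugateDual

end HilbertRep

end RealReductive

/-! Both parts rest on one fact: if the Casimir element C is bounded on the smooth vectors for the
norm of the space, then the powers of I + C_K define the topology (`withSeminorms_casimirSeminorm`).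
In part (1) C is a scalar.

By the Cartan decomposition, B is minus the Hilbert–Schmidt form on Lie(K) and equal to it on the
symmetric complement. Hence C - 2C_K = Δ is the sum of the squares of a basis b_i of Lie(G)
(`exists_casimir_sub_eq_sum_sq`), an elliptic operator. An energy estimate takes the place of
elliptic regularity. As the representation need not be unitary, the inner product is averaged over g
against a smooth bump function. The averaged form dominates a multiple of ‖v‖², and integration by
parts moves b_i across it, the error being an average against a derivative of the bump. This gives
‖b_i v‖² ≤ D(‖v‖‖Δv‖ + ‖v‖²), hence ‖b_i v‖ ≤ ε‖Δv‖ + C‖v‖ for every ε > 0 (`exists_norm_deriv_le`).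

To go up in order, apply this to yv with y in U(g) of order k. The commutator of Δ and y has order k
+ 1 only, so with ε small it is absorbed on the left, and every x in U(g) is bounded by powers of Δ
(`exists_le_sum_laplacian_pow`). Finally Δ = C + 2 - 2(1 + C_K) with C central and bounded, so
powers of Δ are bounded by powers of 1 + C_K (`exists_pow_le_sum_pow`).

For part (2), let s be the square root of the weight. The map sending x to the functions
s(g)(ρ(g⁻¹)v_i, x) identifies H_1 isometrically with a subspace of L²(G, ℂ^N). There the dual
representation is right translation up to the factor s(g)/s(gh), which is bounded in g because the
group norm is submultiplicative; this yields bounded operators, and dominated convergence yields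
strong continuity. On smooth vectors of H_1 the coefficients satisfy the Casimir equation weakly:
tested against φ, C moves to φ and then, by parts, to the smooth orbits ρ(g⁻¹)v_i. As C preserves W,
it acts on the vector of coefficients as a constant matrix, so it is bounded on H_1^∞
(`exists_norm_casimir_le`), and the criterion above applies. -/

namespace RealReductive

/-! ### Dual families for a bilinear form -/

section DualFamilies

variable {L : Type*} [AddCommGroup L] [Module ℝ L]

/-- Two finite families in a subspace `S` that are dual to each other for the form `B`. -/
structure IsDualPair (B : LinearMap.BilinForm ℝ L) (S : Submodule ℝ L) {ι : Type*} [Fintype ι]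
    (b b' : ι → L) : Prop where
  mem : ∀ i, b i ∈ S
  mem' : ∀ i, b' i ∈ S
  expand : ∀ z ∈ S, z = ∑ i, B z (b i) • b' i
  expand' : ∀ z ∈ S, z = ∑ i, B z (b' i) • b i

/-- Expanding one family in the other and regrouping shows that the canonical tensor ∑ b_i ⊗ b'_i
depends only on B and S. Linear independence plays no role, only the two expansions. -/
theorem IsDualPair.sum_eq {B : LinearMap.BilinForm ℝ L} (hB : ∀ x y, B x y = B y x)
    {S : Submodule ℝ L} {ι κ : Type*} [Fintype ι] [Fintype κ] {b b' : ι → L} {x y : κ → L}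
    (hb : IsDualPair B S b b') (hx : IsDualPair B S x y) {A : Type*} [AddCommGroup A] [Module ℝ A]
    (β : L →ₗ[ℝ] L →ₗ[ℝ] A) : ∑ k, β (x k) (y k) = ∑ i, β (b i) (b' i) := by
  calc ∑ k, β (x k) (y k) = ∑ k, β (x k) (∑ i, B (y k) (b i) • b' i) :=
        Finset.sum_congr rfl fun k _ => congrArg (β (x k)) (hb.expand _ (hx.mem' k))
    _ = ∑ k, ∑ i, B (y k) (b i) • β (x k) (b' i) := by simp
    _ = ∑ i, ∑ k, B (y k) (b i) • β (x k) (b' i) := Finset.sum_comm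
    _ = ∑ i, β (∑ k, B (b i) (y k) • x k) (b' i) := by
        refine Finset.sum_congr rfl fun i _ => ?_
        simp [hB (b i)]
    _ = ∑ i, β (b i) (b' i) :=
        Finset.sum_congr rfl fun i _ => by rw [← hx.expand' _ (hb.mem i)]

/-- A vector in the radical of B on S has all its expansion coefficients zero, so B is nondegenerate
on S as soon as one dual pair exists. -/
theorem IsDualPair.gram_det_ne_zero {B : LinearMap.BilinForm ℝ L}
    {S : Submodule ℝ L} {ι κ : Type*} [Fintype ι] [Fintype κ] [DecidableEq κ] {b b' : ι → L}
    (hb : IsDualPair B S b b') (X : Module.Basis κ ℝ S) :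
    (Matrix.of fun i j => B (X i) (X j)).det ≠ 0 := by
  intro h
  obtain ⟨c, hc, hM⟩ := Matrix.exists_vecMul_eq_zero_iff.2 h
  apply hc
  have hz : ∀ j, B (∑ k, c k • (X k : L)) (X j) = 0 := by
    intro j
    have := congrFun hM j
    simpa [Matrix.vecMul, dotProduct] using this
  have hmem : (∑ k, c k • (X k : L)) ∈ S := Submodule.sum_mem _ fun k _ => S.smul_mem _ (X k).2
  have hz' : ∀ w : S, B (∑ k, c k • (X k : L)) w = 0 := by
    intro w
    have e : (w : L) = ∑ k, X.repr w k • (X k : L) := by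
      simpa only [Submodule.coe_sum, Submodule.coe_smul] using
        (congrArg Subtype.val (X.sum_repr w)).symm
    rw [e, map_sum]
    exact Finset.sum_eq_zero fun k _ => by rw [map_smul, hz, smul_zero]
  have h0 : (∑ k, c k • (X k : L)) = 0 := by
    rw [hb.expand _ hmem]
    exact Finset.sum_eq_zero fun i _ => by rw [hz' ⟨b i, hb.mem i⟩, zero_smul]
  have h1 : ∑ k, c k • X k = 0 := Subtype.ext (by simpa using h0)
  funext k
  exact Fintype.linearIndependent_iff.1 X.linearIndependent c h1 k

theorem isDualPair_basis {B : LinearMap.BilinForm ℝ L} (hB : ∀ x y, B x y = B y x)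
    {S : Submodule ℝ L} {κ : Type*} [Fintype κ] [DecidableEq κ]
    (X : Module.Basis κ ℝ S) (hX : (Matrix.of fun i j => B (X i) (X j)).det ≠ 0) :
    IsDualPair B S (fun i => (X i : L))
      (fun i => ∑ j, (Matrix.of fun i j => B (X i) (X j))⁻¹ i j • (X j : L)) := by
  set M : Matrix κ κ ℝ := Matrix.of fun i j => B (X i) (X j) with hM
  have hMs : Mᵀ = M := by ext i j; simp [hM, hB]
  have hMi : M * M⁻¹ = 1 := Matrix.mul_nonsing_inv _ (isUnit_iff_ne_zero.2 hX)
  have hMis : (M⁻¹)ᵀ = M⁻¹ := by rw [Matrix.transpose_nonsing_inv, hMs]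
  have hBM : ∀ i j, B (X i) (X j) = M i j := fun i j => rfl
  have e : ∀ z ∈ S, ∃ c : κ → ℝ, z = ∑ k, c k • (X k : L) := by
    intro z hz
    refine ⟨X.repr ⟨z, hz⟩, ?_⟩
    simpa only [Submodule.coe_sum, Submodule.coe_smul] using
      (congrArg Subtype.val (X.sum_repr ⟨z, hz⟩)).symm
  refine ⟨fun i => (X i).2, fun i => Submodule.sum_mem _ fun k _ => S.smul_mem _ (X k).2, ?_, ?_⟩
  · intro z hz
    obtain ⟨c, rfl⟩ := e z hz
    have h1 : ∀ i, B (∑ k, c k • (X k : L)) (X i) = (c ᵥ* M) i := by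
      intro i; simp [Matrix.vecMul, dotProduct, hBM]
    simp only [h1]
    have h2 : ∑ i, (c ᵥ* M) i • ∑ j, M⁻¹ i j • (X j : L) = ∑ j, ((c ᵥ* M) ᵥ* M⁻¹) j • (X j : L) := by
      simp only [Finset.smul_sum, smul_smul]
      rw [Finset.sum_comm]
      refine Finset.sum_congr rfl fun j _ => ?_
      rw [← Finset.sum_smul]
      rfl
    rw [h2, Matrix.vecMul_vecMul, hMi, Matrix.vecMul_one]
  · intro z hz
    obtain ⟨c, rfl⟩ := e z hz
    refine Finset.sum_congr rfl fun i _ => ?_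
    congr 1
    have h1 : B (∑ k, c k • (X k : L)) (∑ j, M⁻¹ i j • (X j : L)) =
        (c ᵥ* (M * M⁻¹ᵀ)) i := by
      simp only [map_sum, map_smul, LinearMap.sum_apply, LinearMap.smul_apply, hBM, smul_eq_mul,
        Matrix.vecMul, dotProduct, Matrix.mul_apply, Matrix.transpose_apply]
      simp only [Finset.mul_sum]
      rw [Finset.sum_comm]
      refine Finset.sum_congr rfl fun j _ => Finset.sum_congr rfl fun k _ => by ring
    rw [h1, hMis, hMi, Matrix.vecMul_one]

theorem IsDualPair.symm {B : LinearMap.BilinForm ℝ L} {S : Submodule ℝ L} {ι : Type*} [Fintype ι]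
    {b b' : ι → L} (hb : IsDualPair B S b b') : IsDualPair B S b' b :=
  ⟨hb.mem', hb.mem, hb.expand', hb.expand⟩

/-- The image of a dual pair of the whole space under an isometry is a dual pair. -/
theorem IsDualPair.map {B : LinearMap.BilinForm ℝ L} {ι : Type*} [Fintype ι]
    {b b' : ι → L} (hb : IsDualPair B ⊤ b b') (φ : L ≃ₗ[ℝ] L) (hφ : ∀ x y, B (φ x) (φ y) = B x y) :
    IsDualPair B ⊤ (φ ∘ b) (φ ∘ b') := by
  have key : ∀ {c c' : ι → L}, IsDualPair B ⊤ c c' →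
      ∀ z, z = ∑ i, B z (φ (c i)) • φ (c' i) := by
    intro c c' hc z
    have h1 := congrArg φ (hc.expand (φ.symm z) trivial)
    rw [φ.apply_symm_apply, map_sum] at h1
    refine h1.trans (Finset.sum_congr rfl fun i _ => ?_)
    rw [map_smul, ← hφ (φ.symm z), φ.apply_symm_apply]
  exact ⟨fun _ => trivial, fun _ => trivial, fun z _ => key hb z, fun z _ => key hb.symm z⟩

end DualFamilies

/-! ### Generators and center of the enveloping algebra -/

section Enveloping

variable {L : Type*} [LieRing L] [LieAlgebra ℝ L]

attribute [local instance] LieRing.ofAssociativeRing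

/-- By the universal property, the algebra maps into the subalgebra generated by L; composed with
the inclusion this fixes the generators, so it is the identity. -/
theorem env_adjoin_range :
    Algebra.adjoin ℝ (Set.range (UniversalEnvelopingAlgebra.ι ℝ (L := L))) = ⊤ := by
  set S := Algebra.adjoin ℝ (Set.range (UniversalEnvelopingAlgebra.ι ℝ (L := L)))
  let f : L →ₗ⁅ℝ⁆ S :=
    { toFun := fun x => ⟨UniversalEnvelopingAlgebra.ι ℝ x, Algebra.subset_adjoin ⟨x, rfl⟩⟩
      map_add' := fun x y => Subtype.ext (map_add _ _ _)
      map_smul' := fun c x => Subtype.ext (map_smul _ _ _)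
      map_lie' := fun {x y} => Subtype.ext (LieHom.map_lie _ _ _) }
  have h : S.val.comp (UniversalEnvelopingAlgebra.lift ℝ f) = AlgHom.id ℝ _ := by
    apply UniversalEnvelopingAlgebra.hom_ext
    ext x
    simp [f]
  rw [eq_top_iff]
  intro x _
  have := DFunLike.congr_fun h x
  simp only [AlgHom.coe_comp, Function.comp_apply, AlgHom.coe_id, id_eq] at this
  rw [← this]
  exact Subtype.prop _

theorem mem_center_env {z : UniversalEnvelopingAlgebra ℝ L}
    (hz : ∀ x : L, z * UniversalEnvelopingAlgebra.ι ℝ x = UniversalEnvelopingAlgebra.ι ℝ x * z) :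
    z ∈ Subalgebra.center ℝ (UniversalEnvelopingAlgebra ℝ L) := by
  rw [Subalgebra.mem_center_iff]
  intro b
  have hb : b ∈ Algebra.adjoin ℝ (Set.range (UniversalEnvelopingAlgebra.ι ℝ (L := L))) := by
    rw [env_adjoin_range]; trivial
  induction hb using Algebra.adjoin_induction with
  | mem x hx => obtain ⟨x, rfl⟩ := hx; exact (hz x).symm
  | algebraMap r => exact Algebra.commutes r z
  | add x y _ _ hx hy => rw [add_mul, mul_add, hx, hy]
  | mul x y _ _ hx hy => rw [mul_assoc, hy, ← mul_assoc, hx, mul_assoc]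

/-- Invariance of B makes ad z skew, so the matrices of ad z in the two dual families are negative
transposes of each other and their contributions to the commutator cancel. -/
theorem IsDualPair.commute_ι {B : LinearMap.BilinForm ℝ L} (hB : ∀ x y, B x y = B y x)
    (hinv : ∀ x y z : L, B ⁅x, y⁆ z = -B y ⁅x, z⁆)
    {κ : Type*} [Fintype κ] {b b' : κ → L} (hb : IsDualPair B ⊤ b b') (z : L) :
    (∑ i, UniversalEnvelopingAlgebra.ι ℝ (b i) * UniversalEnvelopingAlgebra.ι ℝ (b' i)) *
        UniversalEnvelopingAlgebra.ι ℝ z =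
      UniversalEnvelopingAlgebra.ι ℝ z *
        ∑ i, UniversalEnvelopingAlgebra.ι ℝ (b i) * UniversalEnvelopingAlgebra.ι ℝ (b' i) := by
  set e := UniversalEnvelopingAlgebra.ι ℝ (L := L)
  have hbr : ∀ x y : L, e ⁅x, y⁆ = e x * e y - e y * e x := fun x y => by
    rw [LieHom.map_lie, LieRing.of_associative_ring_bracket]
  have h1 : ∀ i, e ⁅z, b i⁆ = ∑ k, B ⁅z, b i⁆ (b' k) • e (b k) := fun i => by
    conv_lhs => rw [hb.expand' ⁅z, b i⁆ trivial]
    simp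
  have h2 : ∀ i, e ⁅z, b' i⁆ = ∑ k, B ⁅z, b' i⁆ (b k) • e (b' k) := fun i => by
    conv_lhs => rw [hb.expand ⁅z, b' i⁆ trivial]
    simp
  have h3 : ∑ i, (e ⁅z, b i⁆ * e (b' i) + e (b i) * e ⁅z, b' i⁆) = 0 := by
    simp only [h1, h2, Finset.sum_add_distrib, Finset.sum_mul, Finset.mul_sum, smul_mul_assoc,
      mul_smul_comm]
    rw [Finset.sum_comm, ← Finset.sum_add_distrib]
    refine Finset.sum_eq_zero fun i _ => ?_
    rw [← Finset.sum_add_distrib]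
    refine Finset.sum_eq_zero fun k _ => ?_
    rw [← add_smul, hinv, hB (b k), neg_add_cancel, zero_smul]
  symm
  rw [← sub_eq_zero, ← h3, Finset.mul_sum, Finset.sum_mul, ← Finset.sum_sub_distrib]
  refine Finset.sum_congr rfl fun i _ => ?_
  rw [hbr, hbr]
  noncomm_ring

end Enveloping

/-! ### The Casimir element in an arbitrary dual pair -/

section Casimir

attribute [local instance] LieRing.ofAssociativeRing

variable (m : ℕ) {n : ℕ} {G : Type*} [Group G] [TopologicalSpace G]
  [ChartedSpace (EuclideanSpace ℝ (Fin m)) G]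

/-- The trace form as a bilinear form. -/
noncomputable def traceBilin (p : G →* GL (Fin n) ℝ) :
    LinearMap.BilinForm ℝ (GroupLieAlgebra (𝓡 m) G) :=
  LinearMap.mk₂ ℝ (traceForm m p)
    (fun x y z => by simp [traceForm, add_mul]) (fun c x y => by simp [traceForm])
    (fun x y z => by simp [traceForm, mul_add]) (fun c x y => by simp [traceForm])

theorem traceBilin_apply (p : G →* GL (Fin n) ℝ) (X Y : GroupLieAlgebra (𝓡 m) G) :
    traceBilin m p X Y = (differential m p X * differential m p Y).trace := rfl

theorem traceBilin_comm (p : G →* GL (Fin n) ℝ) (X Y : GroupLieAlgebra (𝓡 m) G) :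
    traceBilin m p X Y = traceBilin m p Y X := by
  rw [traceBilin_apply, traceBilin_apply, Matrix.trace_mul_comm]

variable [LieGroup (𝓡 m) ∞ G]

/-- The definition uses an arbitrary basis and a matrix inverse that is meaningful only for an
invertible Gram matrix. The given dual pair supplies invertibility, and the canonical tensor is
independent of the pair. -/
theorem casimirOf_eq_sum (p : G →* GL (Fin n) ℝ)
    {S : Submodule ℝ (GroupLieAlgebra (𝓡 m) G)} {κ : Type*} [Fintype κ]
    {b b' : κ → GroupLieAlgebra (𝓡 m) G} (hb : IsDualPair (traceBilin m p) S b b') :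
    casimirOf m p S = ∑ i, UniversalEnvelopingAlgebra.ι ℝ (b i) *
      UniversalEnvelopingAlgebra.ι ℝ (b' i) := by
  have h := isDualPair_basis (traceBilin_comm m p) (Module.finBasis ℝ S)
    (hb.gram_det_ne_zero (Module.finBasis ℝ S))
  have h2 := hb.sum_eq (traceBilin_comm m p) h
    ((LinearMap.mul ℝ (Env m G)).compl₁₂
      (UniversalEnvelopingAlgebra.ι ℝ : GroupLieAlgebra (𝓡 m) G →ₗ⁅ℝ⁆ Env m G).toLinearMap
      (UniversalEnvelopingAlgebra.ι ℝ : GroupLieAlgebra (𝓡 m) G →ₗ⁅ℝ⁆ Env m G).toLinearMap)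
  simp only [LinearMap.compl₁₂_apply, LinearMap.mul_apply', LieHom.coe_toLinearMap, map_sum,
    map_smul] at h2
  exact h2

end Casimir

end RealReductive

namespace RealReductive

/-! ### Cartan decomposition and adjoint action through the matrix representation -/

section Differential

variable {m n : ℕ} {G : Type*} [Group G] [TopologicalSpace G]
  [ChartedSpace (EuclideanSpace ℝ (Fin m)) G]

/-- A homomorphism to `GL(n, ℝ)` as a map to the normed space of arrays. -/
def matMap (p : G →* GL (Fin n) ℝ) (g : G) : Fin n → Fin n → ℝ :=
  fun i j => (p g : Matrix (Fin n) (Fin n) ℝ) i j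

theorem contMDiff_matMap {p : G →* GL (Fin n) ℝ} (hp : IsRealReductive m p) :
    ContMDiff (𝓡 m) 𝓘(ℝ, Fin n → Fin n → ℝ) ∞ (matMap p) :=
  contMDiff_pi_space.2 fun i => contMDiff_pi_space.2 fun j => hp.contMDiff i j

theorem mfderiv_matMap {p : G →* GL (Fin n) ℝ} (hp : IsRealReductive m p)
    (X : GroupLieAlgebra (𝓡 m) G) :
    (mfderiv (𝓡 m) 𝓘(ℝ, Fin n → Fin n → ℝ) (matMap p) 1 X : Fin n → Fin n → ℝ) =
      differential m p X := by
  funext i j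
  have h := mfderiv_clm_comp
    ((ContinuousLinearMap.proj (R := ℝ) (φ := fun _ : Fin n => ℝ) j).comp
      (ContinuousLinearMap.proj (R := ℝ) (φ := fun _ : Fin n => Fin n → ℝ) i))
    ((contMDiff_matMap hp).mdifferentiableAt (x := 1) (by simp)) X
  exact h.symm

/-- Multiplication by a matrix on the left and by another one on the right. -/
noncomputable def mulMulCLM (A B : Matrix (Fin n) (Fin n) ℝ) :
    (Fin n → Fin n → ℝ) →L[ℝ] (Fin n → Fin n → ℝ) :=
  LinearMap.toContinuousLinearMap
    { toFun := fun M => A * (Matrix.of M) * B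
      map_add' := fun M N => by
        change A * (Matrix.of M + Matrix.of N) * B = _
        rw [mul_add, add_mul]; rfl
      map_smul' := fun c M => by
        change A * (c • Matrix.of M) * B = _
        rw [mul_smul_comm, smul_mul_assoc]; rfl }

theorem mulMulCLM_apply (A B : Matrix (Fin n) (Fin n) ℝ) (M : Fin n → Fin n → ℝ) :
    mulMulCLM A B M = A * (Matrix.of M) * B := rfl

theorem mfderiv_mul_matMap_mul {p : G →* GL (Fin n) ℝ} (hp : IsRealReductive m p)
    (A B : Matrix (Fin n) (Fin n) ℝ) (X : GroupLieAlgebra (𝓡 m) G) :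
    (mfderiv (𝓡 m) 𝓘(ℝ, Fin n → Fin n → ℝ) (fun g => mulMulCLM A B (matMap p g)) 1 X :
      Fin n → Fin n → ℝ) = A * differential m p X * B := by
  rw [mfderiv_clm_comp _ ((contMDiff_matMap hp).mdifferentiableAt (x := 1) (by simp)),
    mfderiv_matMap hp]
  rfl

theorem trace_mul_transpose {ι : Type*} [Fintype ι] (A B : Matrix ι ι ℝ) :
    (A * Bᵀ).trace = ∑ i, ∑ j, A i j * B i j := by
  simp [Matrix.trace, Matrix.mul_apply]

theorem differential_injective {p : G →* GL (Fin n) ℝ} (hp : IsRealReductive m p) :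
    Function.Injective (differential m p) := by
  obtain ⟨GR, -, -, h⟩ := hp.exists_algebraic
  exact Set.injOn_univ.1 h.injOn

/-- Transposition preserves the algebraic group and commutes with the exponential, so it preserves
its Lie algebra, which is the image of the differential. -/
theorem exists_transpose {p : G →* GL (Fin n) ℝ} (hp : IsRealReductive m p)
    (X : GroupLieAlgebra (𝓡 m) G) :
    ∃ Y, differential m p Y = (differential m p X)ᵀ := by
  obtain ⟨GR, hGR, -, h⟩ := hp.exists_algebraic
  have h1 : (differential m p X)ᵀ ∈ matrixLieAlgebra GR := by
    intro t
    obtain ⟨g, hg, hgt⟩ := h.mapsTo (Set.mem_univ X) t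
    obtain ⟨g', hg', e⟩ := hGR.2 g hg
    refine ⟨g', hg', ?_⟩
    rw [e, hgt, ← Matrix.exp_transpose, Matrix.transpose_smul]
  obtain ⟨Y, -, hY⟩ := h.surjOn h1
  exact ⟨Y, hY⟩

/-- The injective differential places S in the Euclidean space of matrix entries, where the standard
inner product is the Hilbert–Schmidt form tr(XYᵀ); the family is an orthonormal basis there, pulled
back. -/
theorem exists_orthonormal_family {p : G →* GL (Fin n) ℝ} (hp : IsRealReductive m p)
    (S : Submodule ℝ (GroupLieAlgebra (𝓡 m) G)) :
    ∃ (r : ℕ) (a : Fin r → GroupLieAlgebra (𝓡 m) G), (∀ i, a i ∈ S) ∧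
      ∀ z ∈ S, z = ∑ i, (differential m p z * (differential m p (a i))ᵀ).trace • a i := by
  let D : GroupLieAlgebra (𝓡 m) G →ₗ[ℝ] EuclideanSpace ℝ (Fin n × Fin n) :=
    { toFun := fun X => WithLp.toLp 2 fun ij => differential m p X ij.1 ij.2
      map_add' := fun X Y => by ext; simp
      map_smul' := fun c X => by ext; simp }
  have hDi : Function.Injective D := by
    intro X Y h
    apply differential_injective hp
    ext i j
    exact congrArg (fun v : EuclideanSpace ℝ (Fin n × Fin n) => v (i, j)) h
  have hin : ∀ X Y, inner ℝ (D Y) (D X) =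
      (differential m p X * (differential m p Y)ᵀ).trace := by
    intro X Y
    rw [trace_mul_transpose, PiLp.inner_apply, Fintype.sum_prod_type]
    rfl
  let e := stdOrthonormalBasis ℝ (S.map D)
  have h1 : ∀ i, ∃ x ∈ S, D x = e i := fun i => (Submodule.mem_map.1 (e i).2)
  choose a haS ha using h1
  refine ⟨_, a, haS, fun z hz => hDi ?_⟩
  have h2 := congrArg Subtype.val (e.sum_repr' ⟨D z, Submodule.mem_map_of_mem hz⟩)
  rw [map_sum]
  simp only [Submodule.coe_sum, Submodule.coe_smul, Submodule.coe_inner] at h2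
  rw [← h2]
  refine Finset.sum_congr rfl fun i _ => ?_
  rw [map_smul, ha, ← hin, ha]

/-- A basis of `Lie(G)` adapted to the Cartan decomposition and orthonormal up to signs. -/
theorem exists_cartan_dualPair {p : G →* GL (Fin n) ℝ} (hp : IsRealReductive m p) :
    ∃ (r s : ℕ) (a : Fin r → GroupLieAlgebra (𝓡 m) G) (c : Fin s → GroupLieAlgebra (𝓡 m) G),
      IsDualPair (traceBilin m p) (compactLie m p) a (-a) ∧
      IsDualPair (traceBilin m p) ⊤ (Sum.elim a c) (Sum.elim (-a) c) := by
  -- The symmetric part of the Cartan decomposition. On it B agrees with the Hilbert–Schmidt form,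
  -- while on `compactLie` it is the negative of that form; this is the source of the signs in the
  -- dual family.
  let P : Submodule ℝ (GroupLieAlgebra (𝓡 m) G) :=
    { carrier := {X | (differential m p X)ᵀ = differential m p X}
      zero_mem' := by simp
      add_mem' := fun {X Y} hX hY => by
        simp only [Set.mem_ofPred_eq] at hX hY ⊢
        rw [map_add, Matrix.transpose_add, hX, hY]
      smul_mem' := fun c X hX => by
        simp only [Set.mem_ofPred_eq] at hX ⊢
        rw [map_smul, Matrix.transpose_smul, hX] }
  obtain ⟨r, a, haS, ha⟩ := exists_orthonormal_family hp (compactLie m p)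
  obtain ⟨s, c, hcS, hc⟩ := exists_orthonormal_family hp P
  have haT : ∀ i, (differential m p (a i))ᵀ = -differential m p (a i) := haS
  have hcT : ∀ i, (differential m p (c i))ᵀ = differential m p (c i) := hcS
  -- The trace of a skew matrix times a symmetric one equals its own negative, by transposing.
  have hort : ∀ x y, (differential m p x)ᵀ = -differential m p x →
      (differential m p y)ᵀ = differential m p y → traceBilin m p x y = 0 := by
    intro x y hx hy
    have h1 : (differential m p x * differential m p y).trace =
        -(differential m p x * differential m p y).trace := by
      conv_lhs => rw [← Matrix.trace_transpose, Matrix.transpose_mul, hx, hy, Matrix.mul_neg,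
        Matrix.trace_neg, Matrix.trace_mul_comm]
    rw [traceBilin_apply]
    linarith
  have ha1 : ∀ z ∈ compactLie m p, z = -∑ i, traceBilin m p z (a i) • a i := by
    intro z hz
    conv_lhs => rw [ha z hz]
    rw [← Finset.sum_neg_distrib]
    refine Finset.sum_congr rfl fun i _ => ?_
    rw [haT, Matrix.mul_neg, Matrix.trace_neg, neg_smul, traceBilin_apply]
  have hc1 : ∀ z ∈ P, z = ∑ i, traceBilin m p z (c i) • c i := by
    intro z hz
    conv_lhs => rw [hc z hz]
    refine Finset.sum_congr rfl fun i _ => ?_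
    rw [hcT, traceBilin_apply]
  have hdec : ∀ z, ∃ x ∈ compactLie m p, ∃ y ∈ P, z = x + y := by
    intro z
    obtain ⟨w, hw⟩ := exists_transpose hp z
    refine ⟨(1 / 2 : ℝ) • (z - w), ?_, (1 / 2 : ℝ) • (z + w), ?_, ?_⟩
    · refine Submodule.smul_mem _ _ ?_
      change (differential m p (z - w))ᵀ = -differential m p (z - w)
      rw [map_sub, hw, Matrix.transpose_sub, Matrix.transpose_transpose, neg_sub]
    · refine Submodule.smul_mem _ _ ?_
      change (differential m p (z + w))ᵀ = differential m p (z + w)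
      rw [map_add, hw, Matrix.transpose_add, Matrix.transpose_transpose, add_comm]
    · module
  have hall : ∀ z, z = (-∑ i, traceBilin m p z (a i) • a i) +
      ∑ i, traceBilin m p z (c i) • c i := by
    intro z
    obtain ⟨x, hx, y, hy, rfl⟩ := hdec z
    have e1 : ∀ i, traceBilin m p (x + y) (a i) = traceBilin m p x (a i) := fun i => by
      rw [map_add, LinearMap.add_apply, traceBilin_comm m p y, hort _ _ (haT i) hy, add_zero]
    have e2 : ∀ i, traceBilin m p (x + y) (c i) = traceBilin m p y (c i) := fun i => by
      rw [map_add, LinearMap.add_apply, hort _ _ hx (hcT i), zero_add]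
    simp only [e1, e2]
    rw [← ha1 x hx, ← hc1 y hy]
  refine ⟨r, s, a, c, ⟨haS, fun i => Submodule.neg_mem _ (haS i), ?_, ?_⟩,
    ⟨fun _ => trivial, fun _ => trivial, ?_, ?_⟩⟩
  · intro z hz
    simpa using ha1 z hz
  · intro z hz
    simpa using ha1 z hz
  · intro z _
    simpa using hall z
  · intro z _
    simpa using hall z

variable [LieGroup (𝓡 m) ∞ G]

theorem fieldDeriv_matMap {p : G →* GL (Fin n) ℝ} (hp : IsRealReductive m p)
    (X : GroupLieAlgebra (𝓡 m) G) (g : G) :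
    fieldDeriv (mulInvariantVectorField X) (matMap p) g =
      mulMulCLM 1 (differential m p X) (matMap p g) := by
  have e : (fun h => matMap p (g * h)) =
      fun h => mulMulCLM (p g : Matrix (Fin n) (Fin n) ℝ) 1 (matMap p h) := by
    funext h
    rw [mulMulCLM_apply, mul_one]
    change (p (g * h) : Matrix (Fin n) (Fin n) ℝ) = (p g : Matrix (Fin n) (Fin n) ℝ) * p h
    rw [map_mul, Units.val_mul]
  have h1 := congrArg (fun f : G → Fin n → Fin n → ℝ =>
    (mfderiv (𝓡 m) 𝓘(ℝ, Fin n → Fin n → ℝ) f 1 X : Fin n → Fin n → ℝ)) e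
  refine (mfderiv_leftInv (contMDiff_matMap hp) g X).symm.trans (h1.trans ?_)
  refine (mfderiv_mul_matMap_mul hp _ _ X).trans ?_
  change (p g : Matrix (Fin n) (Fin n) ℝ) * differential m p X * 1 =
    1 * (p g : Matrix (Fin n) (Fin n) ℝ) * differential m p X
  rw [mul_one, one_mul]

/-- Along a left invariant field the matrix map satisfies Xp = p · dp(X). Applying two fields and
the bracket formula for vector fields at the identity gives the matrix commutator. -/
theorem differential_lie {p : G →* GL (Fin n) ℝ} (hp : IsRealReductive m p)
    (X Y : GroupLieAlgebra (𝓡 m) G) :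
    differential m p ⁅X, Y⁆ =
      differential m p X * differential m p Y - differential m p Y * differential m p X := by
  have hs := contMDiff_matMap hp
  have hm : ∀ Z : GroupLieAlgebra (𝓡 m) G, MDifferentiable (𝓡 m) 𝓘(ℝ, Fin n → Fin n → ℝ)
      (fieldDeriv (mulInvariantVectorField Z) (matMap p)) :=
    fun Z => (contMDiff_deriv_invField hs Z).mdifferentiable (by simp)
  have hf : ∀ Z : GroupLieAlgebra (𝓡 m) G, MDifferentiableAt (𝓡 m) (𝓡 m).tangent
      (fun g : G => (⟨g, mulInvariantVectorField Z g⟩ : TangentBundle (𝓡 m) G)) 1 :=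
    fun Z => (contMDiff_invField Z).mdifferentiableAt (by simp)
  have hb := fieldDeriv_bracket hs (mulInvariantVectorField X) (mulInvariantVectorField Y) 1
    (hf X) (hf Y) (hm Y) (hm X)
  have h2 : ∀ Z Z' : GroupLieAlgebra (𝓡 m) G, fieldDeriv (mulInvariantVectorField Z)
      (fieldDeriv (mulInvariantVectorField Z') (matMap p)) 1 =
        differential m p Z * differential m p Z' := by
    intro Z Z'
    have e : fieldDeriv (mulInvariantVectorField Z') (matMap p) =
        fun g => mulMulCLM 1 (differential m p Z') (matMap p g) :=
      funext fun g => fieldDeriv_matMap hp Z' g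
    have h1 := congrArg (fun f : G → Fin n → Fin n → ℝ =>
      (mfderiv (𝓡 m) 𝓘(ℝ, Fin n → Fin n → ℝ) f 1 Z : Fin n → Fin n → ℝ))
      (funext fun g => congrArg (fieldDeriv (mulInvariantVectorField Z') (matMap p)) (one_mul g))
    refine (mfderiv_leftInv (contMDiff_deriv_invField hs Z') 1 Z).symm.trans (h1.trans ?_)
    refine (congrArg (fun f : G → Fin n → Fin n → ℝ =>
      (mfderiv (𝓡 m) 𝓘(ℝ, Fin n → Fin n → ℝ) f 1 Z : Fin n → Fin n → ℝ)) e).trans ?_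
    exact (mfderiv_mul_matMap_mul hp 1 _ Z).trans (by rw [one_mul])
  rw [h2, h2] at hb
  exact (mfderiv_matMap hp ⁅X, Y⁆).symm.trans hb

theorem traceBilin_lie {p : G →* GL (Fin n) ℝ} (hp : IsRealReductive m p)
    (X Y Z : GroupLieAlgebra (𝓡 m) G) :
    traceBilin m p ⁅X, Y⁆ Z = -traceBilin m p Y ⁅X, Z⁆ := by
  rw [traceBilin_apply, traceBilin_apply, differential_lie hp, differential_lie hp, sub_mul,
    mul_sub, Matrix.trace_sub, Matrix.trace_sub, mul_assoc, mul_assoc, Matrix.trace_mul_comm,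
    mul_assoc]
  ring

/-- The Casimir element is central. -/
theorem casimir_mem_center {p : G →* GL (Fin n) ℝ} (hp : IsRealReductive m p) :
    casimir m p ∈ Subalgebra.center ℝ (Env m G) := by
  obtain ⟨r, s, a, c, -, hac⟩ := exists_cartan_dualPair hp
  rw [casimir, casimirOf_eq_sum m p hac]
  exact mem_center_env fun z =>
    hac.commute_ι (traceBilin_comm m p) (traceBilin_lie hp) z

/-- `C - 2 C_K` is the sum of the squares of a basis of `Lie(G)`. -/
theorem exists_casimir_sub_eq_sum_sq {p : G →* GL (Fin n) ℝ} (hp : IsRealReductive m p) :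
    ∃ (r : ℕ) (b : Fin r → GroupLieAlgebra (𝓡 m) G), Submodule.span ℝ (Set.range b) = ⊤ ∧
      casimir m p - 2 • casimirK m p =
        ∑ i, UniversalEnvelopingAlgebra.ι ℝ (b i) * UniversalEnvelopingAlgebra.ι ℝ (b i) := by
  obtain ⟨r, s, a, c, ha, hac⟩ := exists_cartan_dualPair hp
  let e := finSumFinEquiv (m := r) (n := s)
  refine ⟨r + s, Sum.elim a c ∘ e.symm, ?_, ?_⟩
  · rw [e.symm.surjective.range_comp, eq_top_iff]
    intro z _
    rw [hac.expand' z trivial]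
    exact Submodule.sum_mem _ fun i _ => Submodule.smul_mem _ _ (Submodule.subset_span ⟨i, rfl⟩)
  · rw [casimir, casimirK, casimirOf_eq_sum m p hac, casimirOf_eq_sum m p ha]
    have h := e.symm.sum_comp fun i => UniversalEnvelopingAlgebra.ι ℝ (Sum.elim a c i) *
      UniversalEnvelopingAlgebra.ι ℝ (Sum.elim a c i)
    simp only [Function.comp_apply]
    rw [h, Fintype.sum_sum_type, Fintype.sum_sum_type]
    simp only [Sum.elim_inl, Sum.elim_inr, Pi.neg_apply, map_neg, mul_neg,
      Finset.sum_neg_distrib]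
    abel

/-- The adjoint action of `g` on `Lie(G)`. -/
noncomputable def adjoint (g : G) : GroupLieAlgebra (𝓡 m) G →ₗ[ℝ] GroupLieAlgebra (𝓡 m) G where
  toFun X := (mfderiv (𝓡 m) (𝓡 m) (fun h : G => g * h * g⁻¹) 1 X : EuclideanSpace ℝ (Fin m))
  map_add' X Y := ContinuousLinearMap.map_add
    (mfderiv (𝓡 m) (𝓡 m) (fun h : G => g * h * g⁻¹) 1) X Y
  map_smul' c X := ContinuousLinearMap.map_smul
    (mfderiv (𝓡 m) (𝓡 m) (fun h : G => g * h * g⁻¹) 1) c X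

theorem mfderiv_adjoint {F : Type*} [NormedAddCommGroup F] [NormedSpace ℝ F] {f : G → F}
    (hf : ContMDiff (𝓡 m) 𝓘(ℝ, F) ∞ f) (g : G) (X : GroupLieAlgebra (𝓡 m) G) :
    (mfderiv (𝓡 m) 𝓘(ℝ, F) f 1 (adjoint g X) : F) =
      mfderiv (𝓡 m) 𝓘(ℝ, F) (fun h => f (g * h * g⁻¹)) 1 X := by
  have h1 : MDifferentiableAt (𝓡 m) 𝓘(ℝ, F) f (g * 1 * g⁻¹) := hf.mdifferentiableAt (by simp)
  have hc : ContMDiff (𝓡 m) (𝓡 m) ∞ (fun h : G => g * h * g⁻¹) :=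
    (contMDiff_mul_right (I := 𝓡 m) (n := ∞) (a := g⁻¹)).comp
      (contMDiff_mul_left (I := 𝓡 m) (n := ∞) (a := g))
  have h2 : MDifferentiableAt (𝓡 m) (𝓡 m) (fun h : G => g * h * g⁻¹) 1 :=
    hc.mdifferentiableAt (by simp)
  have h3 := mfderiv_comp_apply 1 h1 h2 X
  -- The chain rule produces a derivative at g * 1 * g⁻¹. Since all tangent spaces are the model
  -- space, it can be moved to the identity along the equality of base points.
  have key : ∀ y : G, y = 1 → ∀ Z : EuclideanSpace ℝ (Fin m),
      (mfderiv (𝓡 m) 𝓘(ℝ, F) f y Z : F) = mfderiv (𝓡 m) 𝓘(ℝ, F) f 1 Z := by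
    rintro y rfl Z; rfl
  exact ((h3.trans (key _ (by simp) _))).symm

theorem differential_adjoint {p : G →* GL (Fin n) ℝ} (hp : IsRealReductive m p) (g : G)
    (X : GroupLieAlgebra (𝓡 m) G) :
    differential m p (adjoint g X) = (p g : Matrix (Fin n) (Fin n) ℝ) * differential m p X *
      (p g⁻¹ : Matrix (Fin n) (Fin n) ℝ) := by
  rw [← mfderiv_mul_matMap_mul hp, ← mfderiv_matMap hp, mfderiv_adjoint (contMDiff_matMap hp)]
  congr 2
  funext h
  rw [mulMulCLM_apply]
  change (p (g * h * g⁻¹) : Matrix (Fin n) (Fin n) ℝ) =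
    (p g : Matrix (Fin n) (Fin n) ℝ) * p h * p g⁻¹
  rw [map_mul, map_mul, Units.val_mul, Units.val_mul]

theorem traceBilin_adjoint {p : G →* GL (Fin n) ℝ} (hp : IsRealReductive m p) (g : G)
    (X Y : GroupLieAlgebra (𝓡 m) G) :
    traceBilin m p (adjoint g X) (adjoint g Y) = traceBilin m p X Y := by
  have h : (p g⁻¹ : Matrix (Fin n) (Fin n) ℝ) * p g = 1 := by
    rw [← Units.val_mul, ← map_mul, inv_mul_cancel, map_one, Units.val_one]
  rw [traceBilin_apply, traceBilin_apply, differential_adjoint hp, differential_adjoint hp]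
  calc _ = ((p g : Matrix (Fin n) (Fin n) ℝ) * (differential m p X *
        ((p g⁻¹ : Matrix (Fin n) (Fin n) ℝ) * p g) * differential m p Y) * p g⁻¹).trace := by
        simp only [mul_assoc]
    _ = _ := by
        rw [h, mul_one, Matrix.trace_mul_comm, ← mul_assoc, h, one_mul]

theorem adjoint_injective {p : G →* GL (Fin n) ℝ} (hp : IsRealReductive m p) (g : G) :
    Function.Injective (adjoint (m := m) g) := by
  have h : (p g⁻¹ : Matrix (Fin n) (Fin n) ℝ) * p g = 1 := by
    rw [← Units.val_mul, ← map_mul, inv_mul_cancel, map_one, Units.val_one]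
  have key : ∀ X, differential m p X = (p g⁻¹ : Matrix (Fin n) (Fin n) ℝ) *
      differential m p (adjoint g X) * p g := by
    intro X
    rw [differential_adjoint hp, mul_assoc, mul_assoc _ _ (p g : Matrix (Fin n) (Fin n) ℝ), h,
      mul_one, ← mul_assoc, h, one_mul]
  intro X Y hXY
  apply differential_injective hp
  rw [key X, key Y, hXY]

theorem IsDualPair.adjoint {p : G →* GL (Fin n) ℝ} (hp : IsRealReductive m p) {κ : Type*}
    [Fintype κ] {b b' : κ → GroupLieAlgebra (𝓡 m) G}
    (hb : IsDualPair (traceBilin m p) ⊤ b b') (g : G) :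
    IsDualPair (traceBilin m p) ⊤ (RealReductive.adjoint g ∘ b) (RealReductive.adjoint g ∘ b') :=
  hb.map (LinearEquiv.ofInjectiveEndo (RealReductive.adjoint g) (adjoint_injective hp g))
    (traceBilin_adjoint hp g)

end Differential

end RealReductive

namespace RealReductive

/-! ### Calculus along left invariant fields -/

section LeftDeriv

variable {m : ℕ} {G : Type*} [TopologicalSpace G] [ChartedSpace (EuclideanSpace ℝ (Fin m)) G]
  {F : Type*} [NormedAddCommGroup F] [NormedSpace ℝ F] [Group G]

/-- The derivative at the identity of a function on `G`. -/
noncomputable def derivOne (X : GroupLieAlgebra (𝓡 m) G) (f : G → F) : F :=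
  mfderiv (𝓡 m) 𝓘(ℝ, F) f 1 X

/-- The derivative of a function along a left invariant vector field. -/
noncomputable def leftDeriv (X : GroupLieAlgebra (𝓡 m) G) (f : G → F) : G → F :=
  fieldDeriv (mulInvariantVectorField X) f

/-- `γ` is a curve through the identity that is tangent to the left invariant field of `X` for
times of absolute value less than `δ`. -/
structure IsFlowCurve (X : GroupLieAlgebra (𝓡 m) G) (γ : ℝ → G) (δ : ℝ) : Prop where
  pos : 0 < δ
  zero : γ 0 = 1
  hasMFDerivAt : ∀ t ∈ Metric.ball (0 : ℝ) δ, HasMFDerivAt 𝓘(ℝ, ℝ) (𝓡 m) γ t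
    ((1 : ℝ →L[ℝ] ℝ).smulRight (mulInvariantVectorField X (γ t)))

variable [LieGroup (𝓡 m) ∞ G]

/-- A local integral curve of the left invariant field stands in for t ↦ exp(tX); only small times
are ever used. -/
theorem exists_isFlowCurve (X : GroupLieAlgebra (𝓡 m) G) : ∃ γ δ, IsFlowCurve X γ δ := by
  have h1 : IsManifold (𝓡 m) 1 G := IsManifold.of_le (n := ∞) (by simp)
  obtain ⟨γ, h0, h⟩ := exists_isMIntegralCurveAt_of_contMDiffAt_boundaryless (I := 𝓡 m) (0 : ℝ)
    (v := (mulInvariantVectorField X : Π g : G, TangentSpace (𝓡 m) g)) (x₀ := (1 : G))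
    (((contMDiff_invField X).contMDiffAt).of_le (by simp))
  obtain ⟨δ, hδ, h2⟩ := Metric.eventually_nhds_iff_ball.1 h
  exact ⟨γ, δ, hδ, h0, h2⟩

theorem leftDeriv_apply {f : G → F} (hf : ContMDiff (𝓡 m) 𝓘(ℝ, F) ∞ f)
    (X : GroupLieAlgebra (𝓡 m) G) (g : G) :
    leftDeriv X f g = derivOne X fun h => f (g * h) := (mfderiv_leftInv hf g X).symm

theorem contMDiff_mul_left_comp {f : G → F} (hf : ContMDiff (𝓡 m) 𝓘(ℝ, F) ∞ f) (g : G) :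
    ContMDiff (𝓡 m) 𝓘(ℝ, F) ∞ fun h => f (g * h) :=
  hf.comp (contMDiff_mul_left (I := 𝓡 m) (n := ∞) (a := g))

theorem contMDiff_mul_right_comp {f : G → F} (hf : ContMDiff (𝓡 m) 𝓘(ℝ, F) ∞ f) (g : G) :
    ContMDiff (𝓡 m) 𝓘(ℝ, F) ∞ fun h => f (h * g) :=
  hf.comp (contMDiff_mul_right (I := 𝓡 m) (n := ∞) (a := g))

theorem leftDeriv_mul_left {f : G → F} (hf : ContMDiff (𝓡 m) 𝓘(ℝ, F) ∞ f)
    (X : GroupLieAlgebra (𝓡 m) G) (g h : G) :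
    leftDeriv X (fun k => f (g * k)) h = leftDeriv X f (g * h) := by
  rw [leftDeriv_apply (contMDiff_mul_left_comp hf g), leftDeriv_apply hf]
  simp only [mul_assoc]

theorem contMDiff_leftDeriv {f : G → F} (hf : ContMDiff (𝓡 m) 𝓘(ℝ, F) ∞ f)
    (X : GroupLieAlgebra (𝓡 m) G) : ContMDiff (𝓡 m) 𝓘(ℝ, F) ∞ (leftDeriv X f) :=
  contMDiff_deriv_invField hf X

/-- By left invariance, translating the curve by g on the left gives an integral curve through g.
Thus right translation by γ(t) differentiates functions along the field. -/
theorem IsFlowCurve.hasDerivAt {X : GroupLieAlgebra (𝓡 m) G} {γ : ℝ → G} {δ : ℝ}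
    (h : IsFlowCurve X γ δ) {f : G → F} (hf : ContMDiff (𝓡 m) 𝓘(ℝ, F) ∞ f) (g : G) {t : ℝ}
    (ht : t ∈ Metric.ball (0 : ℝ) δ) :
    HasDerivAt (fun s => f (g * γ s)) (leftDeriv X f (g * γ t)) t := by
  have key : ∀ {k : G → F}, ContMDiff (𝓡 m) 𝓘(ℝ, F) ∞ k →
      HasDerivAt (fun s => k (γ s)) (leftDeriv X k (γ t)) t := by
    intro k hk
    have h1 := (hk.mdifferentiableAt (x := γ t) (by simp)).hasMFDerivAt.comp t (h.hasMFDerivAt t ht)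
    let T : ℝ →L[ℝ] F := (mfderiv (𝓡 m) 𝓘(ℝ, F) k (γ t)).comp
      ((1 : ℝ →L[ℝ] ℝ).smulRight (mulInvariantVectorField X (γ t)))
    have h2 : HasFDerivAt (fun s => k (γ s)) T t := hasMFDerivAt_iff_hasFDerivAt.1 h1
    have h3 : T 1 = leftDeriv X k (γ t) := by
      change (mfderiv (𝓡 m) 𝓘(ℝ, F) k (γ t)) ((1 : ℝ) • (mulInvariantVectorField X (γ t))) = _
      rw [one_smul]
      rfl
    rw [← h3]
    exact h2.hasDerivAt
  rw [← leftDeriv_mul_left hf]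
  exact key (contMDiff_mul_left_comp hf g)

theorem IsFlowCurve.hasDerivAt_zero {X : GroupLieAlgebra (𝓡 m) G} {γ : ℝ → G} {δ : ℝ}
    (h : IsFlowCurve X γ δ) {f : G → F} (hf : ContMDiff (𝓡 m) 𝓘(ℝ, F) ∞ f) (g : G) :
    HasDerivAt (fun s => f (g * γ s)) (leftDeriv X f g) 0 := by
  simpa [h.zero] using h.hasDerivAt hf g (Metric.mem_ball_self h.pos)

omit [LieGroup (𝓡 m) ∞ G] in
theorem IsFlowCurve.continuousAt {X : GroupLieAlgebra (𝓡 m) G} {γ : ℝ → G} {δ : ℝ}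
    (h : IsFlowCurve X γ δ) {t : ℝ} (ht : t ∈ Metric.ball (0 : ℝ) δ) : ContinuousAt γ t :=
  (h.hasMFDerivAt t ht).continuousAt

theorem leftDeriv_eq_of_hasDerivAt {X : GroupLieAlgebra (𝓡 m) G} {γ : ℝ → G} {δ : ℝ}
    (h : IsFlowCurve X γ δ) {f : G → F} (hf : ContMDiff (𝓡 m) 𝓘(ℝ, F) ∞ f) {g : G} {f' : F}
    (hd : HasDerivAt (fun s => f (g * γ s)) f' 0) : leftDeriv X f g = f' :=
  (h.hasDerivAt_zero hf g).unique hd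

omit [LieGroup (𝓡 m) ∞ G] in
theorem leftDeriv_clm_comp {F' : Type*} [NormedAddCommGroup F'] [NormedSpace ℝ F'] (T : F →L[ℝ] F')
    {f : G → F} (hf : ContMDiff (𝓡 m) 𝓘(ℝ, F) ∞ f) (X : GroupLieAlgebra (𝓡 m) G) :
    leftDeriv X (fun g => T (f g)) = fun g => T (leftDeriv X f g) := by
  funext g
  exact mfderiv_clm_comp T (hf.mdifferentiableAt (by simp)) _

theorem leftDeriv_mul {f k : G → ℂ} (hf : ContMDiff (𝓡 m) 𝓘(ℝ, ℂ) ∞ f)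
    (hk : ContMDiff (𝓡 m) 𝓘(ℝ, ℂ) ∞ k) (X : GroupLieAlgebra (𝓡 m) G) (g : G) :
    leftDeriv X (fun x => f x * k x) g = leftDeriv X f g * k g + f g * leftDeriv X k g := by
  obtain ⟨γ, δ, h⟩ := exists_isFlowCurve X
  have hs : ContMDiff (𝓡 m) 𝓘(ℝ, ℂ) ∞ fun x => f x * k x := by
    have h1 : ContDiff ℝ ∞ fun x : ℂ × ℂ => x.1 * x.2 := contDiff_fst.mul contDiff_snd
    exact h1.contMDiff.comp (hf.prodMk_space hk)
  refine leftDeriv_eq_of_hasDerivAt h hs ?_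
  have h1 := (h.hasDerivAt_zero hf g).mul (h.hasDerivAt_zero hk g)
  rw [h.zero, mul_one] at h1
  exact h1

theorem leftDeriv_inner {H : Type*} [NormedAddCommGroup H] [InnerProductSpace ℂ H]
    {f k : G → H} (hf : ContMDiff (𝓡 m) 𝓘(ℝ, H) ∞ f)
    (hk : ContMDiff (𝓡 m) 𝓘(ℝ, H) ∞ k) (X : GroupLieAlgebra (𝓡 m) G) (g : G) :
    leftDeriv X (fun x => inner ℂ (f x) (k x)) g =
      inner ℂ (f g) (leftDeriv X k g) + inner ℂ (leftDeriv X f g) (k g) := by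
  obtain ⟨γ, δ, h⟩ := exists_isFlowCurve X
  have hs : ContMDiff (𝓡 m) 𝓘(ℝ, ℂ) ∞ fun x => inner ℂ (f x) (k x) := by
    have h1 : ContDiff ℝ ∞ fun x : H × H => inner ℂ x.1 x.2 := contDiff_inner
    exact h1.contMDiff.comp (hf.prodMk_space hk)
  refine leftDeriv_eq_of_hasDerivAt h hs ?_
  simpa [h.zero] using (h.hasDerivAt_zero hf g).inner ℂ (h.hasDerivAt_zero hk g)

theorem leftDeriv_eq_zero {f : G → F} (hf : ContMDiff (𝓡 m) 𝓘(ℝ, F) ∞ f)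
    [IsTopologicalGroup G] (X : GroupLieAlgebra (𝓡 m) G) {g : G} (hg : g ∉ tsupport f) :
    leftDeriv X f g = 0 := by
  obtain ⟨γ, δ, h⟩ := exists_isFlowCurve X
  refine leftDeriv_eq_of_hasDerivAt h hf ?_
  have h1 : f =ᶠ[𝓝 g] 0 := notMem_tsupport_iff_eventuallyEq.1 hg
  have h2 : Filter.Tendsto (fun s => g * γ s) (𝓝 0) (𝓝 g) := by
    have h3 := (h.continuousAt (Metric.mem_ball_self h.pos)).const_mul g
    have h4 : Filter.Tendsto (fun s => g * γ s) (𝓝 0) (𝓝 (g * γ 0)) := h3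
    rwa [h.zero, mul_one] at h4
  have h5 : (fun s => f (g * γ s)) =ᶠ[𝓝 0] fun _ => (0 : F) := h2.eventually h1
  exact (hasDerivAt_const (0 : ℝ) (0 : F)).congr_of_eventuallyEq h5

theorem hasCompactSupport_leftDeriv {f : G → F} (hf : ContMDiff (𝓡 m) 𝓘(ℝ, F) ∞ f)
    [IsTopologicalGroup G] (hc : HasCompactSupport f) (X : GroupLieAlgebra (𝓡 m) G) :
    HasCompactSupport (leftDeriv X f) := by
  refine hc.mono' fun g hg => ?_
  by_contra h
  exact hg (leftDeriv_eq_zero hf X h)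

/-- The function f(ab⁻¹) is constant on the diagonal, so its two partial derivatives at the identity
cancel. -/
theorem derivOne_comp_inv {f : G → F} (hf : ContMDiff (𝓡 m) 𝓘(ℝ, F) ∞ f)
    (X : GroupLieAlgebra (𝓡 m) G) : derivOne X (fun g => f g⁻¹) = -derivOne X f := by
  have hΨ : ContMDiff ((𝓡 m).prod (𝓡 m)) 𝓘(ℝ, F) ∞ (fun q : G × G => f (q.1 * q.2⁻¹)) :=
    hf.comp (contMDiff_fst.mul ((contMDiff_inv (𝓡 m) ∞).comp contMDiff_snd))
  have hd : ContMDiff (𝓡 m) ((𝓡 m).prod (𝓡 m)) ∞ (fun g : G => (g, g)) :=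
    contMDiff_id.prodMk contMDiff_id
  have h1 := mfderiv_comp_apply (I := 𝓡 m) (I' := (𝓡 m).prod (𝓡 m)) (I'' := 𝓘(ℝ, F)) (1 : G)
    (g := fun q : G × G => f (q.1 * q.2⁻¹)) (f := fun g : G => (g, g))
    (hΨ.mdifferentiableAt (x := ((1 : G), (1 : G))) (by simp))
    (hd.mdifferentiableAt (x := (1 : G)) (by simp)) X
  have h2 : (fun q : G × G => f (q.1 * q.2⁻¹)) ∘ (fun g : G => (g, g)) = fun _ => f 1 := by
    funext g; simp
  have h3 : mfderiv (𝓡 m) ((𝓡 m).prod (𝓡 m)) (fun g : G => (g, g)) 1 X = (X, X) := by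
    have := mfderiv_prodMk (I := 𝓡 m) (I' := 𝓡 m) (I'' := 𝓡 m) (x := (1 : G))
      (f := fun g : G => g) (g := fun g : G => g) mdifferentiableAt_id mdifferentiableAt_id
    rw [this]
    have h4 : mfderiv (𝓡 m) (𝓡 m) (fun g : G => g) 1 = ContinuousLinearMap.id ℝ _ := mfderiv_id
    rw [h4]; rfl
  have h5 := mfderiv_prod_eq_add_apply (I := 𝓡 m) (I' := 𝓡 m) (I'' := 𝓘(ℝ, F))
    (f := fun q : G × G => f (q.1 * q.2⁻¹)) (p := ((1 : G), (1 : G)))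
    (v := (X, X))
    (hΨ.mdifferentiableAt (x := ((1 : G), (1 : G))) (by simp))
  have h6 : (mfderiv (𝓡 m) 𝓘(ℝ, F) (fun _ : G => f 1) 1 X : F) = 0 := by
    rw [mfderiv_const]; rfl
  have h7 := congrArg (derivOne X) h2
  have h8 : derivOne X (fun _ : G => f 1) = 0 := h6
  have e1 : (fun z : G => f (z * (1 : G)⁻¹)) = f := by funext z; simp
  have e2 : (fun z : G => f (1 * z⁻¹)) = fun z => f z⁻¹ := by funext z; simp
  have h9 : derivOne X ((fun q : G × G => f (q.1 * q.2⁻¹)) ∘ (fun g : G => (g, g))) =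
      derivOne X (fun z : G => f (z * (1 : G)⁻¹)) + derivOne X (fun z : G => f (1 * z⁻¹)) := by
    refine h1.trans ?_
    rw [h3]
    exact h5
  rw [h7, h8, e1, e2] at h9
  exact (neg_eq_of_add_eq_zero_right h9.symm).symm

/-- The inverse of a chart at the identity, centered at the origin. -/
noncomputable def chartParam (e : EuclideanSpace ℝ (Fin m)) : G :=
  (extChartAt (𝓡 m) (1 : G)).symm (extChartAt (𝓡 m) (1 : G) 1 + e)

theorem contMDiffAt_chartParam :
    ContMDiffAt 𝓘(ℝ, EuclideanSpace ℝ (Fin m)) (𝓡 m) ∞ (chartParam (m := m) (G := G)) 0 := by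
  have : IsManifold (𝓡 m) ∞ G := inferInstance
  have h1 : ContMDiffAt 𝓘(ℝ, EuclideanSpace ℝ (Fin m)) (𝓡 m) ∞ (extChartAt (𝓡 m) (1 : G)).symm
      (extChartAt (𝓡 m) (1 : G) 1 + 0) := by
    rw [add_zero]
    exact (contMDiffOn_extChartAt_symm (1 : G)).contMDiffAt (extChartAt_target_mem_nhds 1)
  have h2 : ContMDiffAt 𝓘(ℝ, EuclideanSpace ℝ (Fin m)) 𝓘(ℝ, EuclideanSpace ℝ (Fin m)) ∞
      (fun e => extChartAt (𝓡 m) (1 : G) 1 + e) 0 :=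
    (contDiff_const.add contDiff_id).contMDiff.contMDiffAt
  exact h1.comp (0 : EuclideanSpace ℝ (Fin m)) h2

theorem derivOne_eq_fderiv {f : G → F} (hf : MDifferentiableAt (𝓡 m) 𝓘(ℝ, F) f 1)
    (X : GroupLieAlgebra (𝓡 m) G) :
    derivOne X f = fderiv ℝ (fun e => f (chartParam (m := m) e)) 0 X := by
  have : IsManifold (𝓡 m) ∞ G := inferInstance
  set c := extChartAt (𝓡 m) (1 : G)
  have h1 : derivOne X f = fderivWithin ℝ (fun e => f (c.symm e)) (Set.range (𝓡 m)) (c 1) X :=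
    DFunLike.congr_fun hf.mfderiv X
  rw [h1, (𝓡 m).range_eq_univ, fderivWithin_univ]
  have h2 := fderiv_comp_add_left (𝕜 := ℝ) (f := fun e => f (c.symm e)) (x := 0) (c 1)
  rw [add_zero] at h2
  rw [← h2]
  rfl

/-- Read in a chart at the identity, both sides are mixed second derivatives of (a, b) ↦ f(ab),
which are symmetric. Differentiability of the left-variable derivative is assumed, since in the
application it is read off from an explicit formula. -/
theorem derivOne_comm {f : G → F} (hf : ContMDiff (𝓡 m) 𝓘(ℝ, F) ∞ f)
    (X Y : GroupLieAlgebra (𝓡 m) G)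
    (hR : MDifferentiableAt (𝓡 m) 𝓘(ℝ, F) (fun b => derivOne X fun a => f (a * b)) 1) :
    derivOne X (fun a => derivOne Y fun b => f (a * b)) =
      derivOne Y fun b => derivOne X fun a => f (a * b) := by
  let E := EuclideanSpace ℝ (Fin m)
  let ψ : E × E → F := fun q => f (chartParam (m := m) q.1 * chartParam (m := m) q.2)
  have hψ : ContDiffAt ℝ ∞ ψ (0, 0) := by
    rw [← contMDiffAt_iff_contDiffAt]
    have h1 : ContMDiffAt 𝓘(ℝ, E × E) (𝓡 m) ∞ (fun q : E × E => (chartParam (m := m) q.1 : G)) (0, 0) :=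
      ContMDiffAt.comp (f := fun q : E × E => q.1) (g := (chartParam (m := m) : E → G)) (0, 0)
        (contMDiffAt_chartParam (m := m) (G := G)) contDiff_fst.contMDiff.contMDiffAt
    have h2 : ContMDiffAt 𝓘(ℝ, E × E) (𝓡 m) ∞ (fun q : E × E => (chartParam (m := m) q.2 : G)) (0, 0) :=
      ContMDiffAt.comp (f := fun q : E × E => q.2) (g := (chartParam (m := m) : E → G)) (0, 0)
        (contMDiffAt_chartParam (m := m) (G := G)) contDiff_snd.contMDiff.contMDiffAt
    exact (hf _).comp (0, 0) (h1.mul h2)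
  have hψd : ∀ᶠ q in 𝓝 ((0 : E), (0 : E)), DifferentiableAt ℝ ψ q := by
    have h1 : ContDiffAt ℝ 1 ψ (0, 0) := hψ.of_le (by exact_mod_cast le_top)
    filter_upwards [h1.eventually (by norm_num)] with q hq using hq.differentiableAt (by simp)
  have hψ2 : DifferentiableAt ℝ (fderiv ℝ ψ) (0, 0) :=
    (hψ.fderiv_right (m := 1) (by rw [one_add_one_eq_two]; exact ENat.LEInfty.out)).differentiableAt (by simp)
  have hsymm : IsSymmSndFDerivAt ℝ ψ (0, 0) :=
    hψ.isSymmSndFDerivAt (by rw [minSmoothness_of_isRCLikeNormedField]; exact ENat.LEInfty.out)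
  have hL : MDifferentiableAt (𝓡 m) 𝓘(ℝ, F) (fun a => derivOne Y fun b => f (a * b)) 1 := by
    have e : (fun a => derivOne Y fun b => f (a * b)) = leftDeriv Y f :=
      funext fun a => (leftDeriv_apply hf Y a).symm
    rw [e]
    exact (contMDiff_leftDeriv hf Y).mdifferentiableAt (by simp)
  rw [derivOne_eq_fderiv hL, derivOne_eq_fderiv hR]
  have hl : (fun e : E => derivOne Y fun b => f (chartParam (m := m) e * b)) =ᶠ[𝓝 0]
      fun e => fderiv ℝ ψ (e, 0) (0, Y) := by
    have h0 : Filter.Tendsto (fun e : E => (e, (0 : E))) (𝓝 0) (𝓝 (0, 0)) :=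
      (Continuous.prodMk_left (0 : E)).tendsto 0
    filter_upwards [h0.eventually hψd] with e he
    rw [derivOne_eq_fderiv ((contMDiff_mul_left_comp hf _).mdifferentiableAt (by simp))]
    have h1 := HasFDerivAt.comp (g := ψ) (f := fun e' : E => (e, e')) (0 : E) he.hasFDerivAt (hasFDerivAt_prodMk_right e (0 : E))
    have h2 : fderiv ℝ (fun e' : E => f (chartParam (m := m) e * chartParam (m := m) e')) 0 = _ := h1.fderiv
    rw [h2]
    rfl
  have hr : (fun e : E => derivOne X fun a => f (a * chartParam (m := m) e)) =ᶠ[𝓝 0]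
      fun e => fderiv ℝ ψ (0, e) (X, 0) := by
    have h0 : Filter.Tendsto (fun e : E => ((0 : E), e)) (𝓝 0) (𝓝 (0, 0)) :=
      (Continuous.prodMk_right (0 : E)).tendsto 0
    filter_upwards [h0.eventually hψd] with e he
    rw [derivOne_eq_fderiv ((contMDiff_mul_right_comp hf _).mdifferentiableAt (by simp))]
    have h1 := HasFDerivAt.comp (g := ψ) (f := fun e' : E => (e', e)) (0 : E) he.hasFDerivAt (hasFDerivAt_prodMk_left (0 : E) e)
    have h2 : fderiv ℝ (fun e' : E => f (chartParam (m := m) e' * chartParam (m := m) e)) 0 = _ := h1.fderiv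
    rw [h2]
    rfl
  rw [hl.fderiv_eq, hr.fderiv_eq]
  have hl2 := ((HasFDerivAt.comp (g := fderiv ℝ ψ) (f := fun e : E => (e, (0 : E))) (0 : E) hψ2.hasFDerivAt
    (hasFDerivAt_prodMk_left (0 : E) (0 : E))).clm_apply
    (hasFDerivAt_const ((0 : E), (Y : E)) (0 : E))).fderiv
  have hr2 := ((HasFDerivAt.comp (g := fderiv ℝ ψ) (f := fun e : E => ((0 : E), e)) (0 : E) hψ2.hasFDerivAt
    (hasFDerivAt_prodMk_right (0 : E) (0 : E))).clm_apply
    (hasFDerivAt_const ((X : E), (0 : E)) (0 : E))).fderiv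
  refine (DFunLike.congr_fun hl2 X).trans (Eq.trans ?_ (DFunLike.congr_fun hr2 Y).symm)
  change fderiv ℝ ψ (0, 0) 0 + fderiv ℝ (fderiv ℝ ψ) (0, 0) (X, 0) (0, Y) =
    fderiv ℝ ψ (0, 0) 0 + fderiv ℝ (fderiv ℝ ψ) (0, 0) (0, Y) (X, 0)
  rw [hsymm (X, 0) (0, Y)]

end LeftDeriv

end RealReductive

namespace RealReductive

/-! ### The Casimir element on orbits of smooth vectors -/

namespace HilbertRep

variable {m n : ℕ} {G : Type*} [Group G] [TopologicalSpace G]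
  [ChartedSpace (EuclideanSpace ℝ (Fin m)) G] [LieGroup (𝓡 m) ∞ G]
  {H : Type*} [NormedAddCommGroup H] [InnerProductSpace ℂ H]
  (ρ : HilbertRep G H)

theorem toHom_mem_smoothVectors (g : G) (v : ρ.smoothVectors m) :
    ρ.toHom g v ∈ ρ.smoothVectors m := by
  change ContMDiff _ _ _ fun h => ρ.toHom h (ρ.toHom g v)
  have h := contMDiff_mul_right_comp (m := m) (f := fun h => ρ.toHom h v) v.2 g
  simp only [map_mul] at h
  exact h

/-- The action of `G` on smooth vectors. -/
noncomputable def smoothAct (g : G) (v : ρ.smoothVectors m) : ρ.smoothVectors m :=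
  ⟨ρ.toHom g v, ρ.toHom_mem_smoothVectors g v⟩

theorem leftDeriv_orbit (X : GroupLieAlgebra (𝓡 m) G) (v : ρ.smoothVectors m) :
    leftDeriv X (fun g => ρ.toHom g (v : H)) = fun g => ρ.toHom g (ρ.deriv X v : H) :=
  funext fun g => (ρ.toHom_derivAt X v g).symm

/-- The curve ρ(ghg⁻¹)ρ(g)v equals ρ(g)ρ(h)v, and the bounded operator ρ(g) commutes with
differentiation in h. -/
theorem toHom_deriv (g : G) (X : GroupLieAlgebra (𝓡 m) G) (v : ρ.smoothVectors m) :
    ρ.smoothAct g (ρ.deriv X v) = ρ.deriv (adjoint g X) (ρ.smoothAct g v) := by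
  apply Subtype.ext
  have h1 := mfderiv_adjoint (ρ.smoothAct g v).2 g X
  refine Eq.trans ?_ h1.symm
  have e : (fun h => ρ.toHom (g * h * g⁻¹) (ρ.smoothAct g v : H)) =
      fun h => ρ.toHom g (ρ.toHom h (v : H)) := by
    funext h
    have h2 : ρ.toHom g⁻¹ (ρ.toHom g (v : H)) = v := by
      rw [← mul_apply_eq_comp, ← map_mul, inv_mul_cancel, map_one]; rfl
    rw [map_mul, map_mul]
    change ρ.toHom g (ρ.toHom h (ρ.toHom g⁻¹ (ρ.toHom g (v : H)))) = _
    rw [h2]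
  refine Eq.trans ?_ (congrArg (derivOne X) e).symm
  exact (mfderiv_clm_comp ((ρ.toHom g).restrictScalars ℝ) (ρ.mdifferentiable_orbit v 1) X).symm

theorem envAction_ι (X : GroupLieAlgebra (𝓡 m) G) :
    ρ.envAction m (UniversalEnvelopingAlgebra.ι ℝ X) = ρ.deriv X :=
  UniversalEnvelopingAlgebra.lift_ι_apply ℝ _ X

theorem envAction_casimir {p : G →* GL (Fin n) ℝ} {κ : Type*} [Fintype κ]
    {b b' : κ → GroupLieAlgebra (𝓡 m) G} (hb : IsDualPair (traceBilin m p) ⊤ b b')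
    (v : ρ.smoothVectors m) :
    ρ.envAction m (casimir m p) v = ∑ i, ρ.deriv (b i) (ρ.deriv (b' i) v) := by
  rw [casimir, casimirOf_eq_sum m p hb, map_sum, LinearMap.sum_apply]
  refine Finset.sum_congr rfl fun i _ => ?_
  rw [map_mul, envAction_ι, envAction_ι]
  rfl

/-- The Casimir element commutes with the action of `G`. -/
theorem envAction_casimir_smoothAct {p : G →* GL (Fin n) ℝ} (hp : IsRealReductive m p) (g : G)
    (v : ρ.smoothVectors m) :
    ρ.envAction m (casimir m p) (ρ.smoothAct g v) =
      ρ.smoothAct g (ρ.envAction m (casimir m p) v) := by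
  obtain ⟨r, s, a, c, -, hac⟩ := exists_cartan_dualPair hp
  -- G need not be connected, so centrality in the enveloping algebra is not enough. Instead C is
  -- written in a dual pair and in its image under Ad(g), which preserves the trace form.
  rw [ρ.envAction_casimir (hac.adjoint hp g), ρ.envAction_casimir hac]
  apply Subtype.ext
  simp only [Function.comp_apply, ← toHom_deriv]
  simp only [smoothAct, Submodule.coe_sum, map_sum]

theorem contMDiff_inv_orbit (u : ρ.smoothVectors m) :
    ContMDiff (𝓡 m) 𝓘(ℝ, H) ∞ fun g => ρ.toHom g⁻¹ (u : H) :=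
  ContMDiff.comp (g := fun g => ρ.toHom g (u : H)) u.2 (contMDiff_inv (𝓡 m) ∞)

/-- With w = ρ(g⁻¹)u, the function to differentiate in a and b is ρ(b⁻¹)ρ(a⁻¹)w. Inversion
contributes two signs and reverses the order of X and Y. -/
theorem leftDeriv_leftDeriv_inv_orbit (X Y : GroupLieAlgebra (𝓡 m) G) (u : ρ.smoothVectors m)
    (g : G) : leftDeriv X (leftDeriv Y fun g => ρ.toHom g⁻¹ (u : H)) g =
      ρ.deriv Y (ρ.deriv X (ρ.smoothAct g⁻¹ u)) := by
  have hs := ρ.contMDiff_inv_orbit u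
  have hd : ∀ (Z : GroupLieAlgebra (𝓡 m) G) (w : ρ.smoothVectors m),
      derivOne Z (fun a => ρ.toHom a⁻¹ (w : H)) = -(ρ.deriv Z w : H) := fun Z w =>
    derivOne_comp_inv w.2 Z
  let w := ρ.smoothAct g⁻¹ u
  have e1 : (fun b => derivOne X fun a => ρ.toHom (a * b)⁻¹ (w : H)) =
      fun b => ρ.toHom b⁻¹ (-ρ.deriv X w : ρ.smoothVectors m) := by
    funext b
    have e : (fun a => ρ.toHom (a * b)⁻¹ (w : H)) = fun a => ρ.toHom b⁻¹ (ρ.toHom a⁻¹ (w : H)) := by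
      funext a
      rw [mul_inv_rev, map_mul]
      rfl
    rw [e]
    refine (mfderiv_clm_comp ((ρ.toHom b⁻¹).restrictScalars ℝ)
      ((ρ.contMDiff_inv_orbit w).mdifferentiableAt (by simp)) X).trans ?_
    exact congrArg (ρ.toHom b⁻¹) (hd X w)
  -- Differentiating in b first would leave the unbounded operator of Y in front of the
  -- a-derivative. Interchanging the derivatives leaves only the bounded operator ρ(b⁻¹) there.
  have hc := derivOne_comm (ρ.contMDiff_inv_orbit w) X Y (by
    rw [e1]; exact (ρ.contMDiff_inv_orbit _).mdifferentiableAt (by simp))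
  rw [e1, hd, map_neg, Submodule.coe_neg, neg_neg] at hc
  rw [← hc, leftDeriv_apply (contMDiff_leftDeriv hs Y)]
  congr 1
  funext a
  rw [leftDeriv_apply hs]
  congr 1
  funext b
  rw [mul_assoc, mul_inv_rev, map_mul]
  rfl

/-- The reversal of order is harmless because swapping the two families of a dual pair leaves C
unchanged; then C commutes with ρ(g⁻¹). -/
theorem sum_leftDeriv_inv_orbit {p : G →* GL (Fin n) ℝ} (hp : IsRealReductive m p)
    {κ : Type*} [Fintype κ] {b b' : κ → GroupLieAlgebra (𝓡 m) G}
    (hb : IsDualPair (traceBilin m p) ⊤ b b') (u : ρ.smoothVectors m) (g : G) :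
    ∑ i, leftDeriv (b i) (leftDeriv (b' i) fun g => ρ.toHom g⁻¹ (u : H)) g =
      ρ.toHom g⁻¹ (ρ.envAction m (casimir m p) u : H) := by
  simp only [leftDeriv_leftDeriv_inv_orbit]
  have h := ρ.envAction_casimir_smoothAct hp g⁻¹ u
  rw [ρ.envAction_casimir hb.symm] at h
  have h2 := congrArg Subtype.val h
  rw [Submodule.coe_sum] at h2
  exact h2

end HilbertRep

end RealReductive

open scoped Pointwise

namespace RealReductive

/-! ### Differentiation under the integral and integration by parts on G -/

section Integration

variable {m : ℕ} {G : Type*} [Group G] [TopologicalSpace G]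
  [ChartedSpace (EuclideanSpace ℝ (Fin m)) G]
  [IsTopologicalGroup G] [T2Space G] [MeasurableSpace G] [BorelSpace G]
  {μ : Measure G}

omit [Group G] [ChartedSpace (EuclideanSpace ℝ (Fin m)) G] [IsTopologicalGroup G] [T2Space G] in
theorem integrable_mul_of_hasCompactSupport {φ F : G → ℂ} (hφ : Continuous φ)
    (hc : HasCompactSupport φ) (hFm : AEStronglyMeasurable F μ) (hF : LocallyIntegrable F μ) :
    Integrable (fun g => φ g * F g) μ := by
  obtain ⟨M, hM⟩ := hc.exists_bound_of_continuous hφ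
  have h1 : Integrable (fun g => M * (tsupport φ).indicator (fun x => ‖F x‖) g) μ :=
    (IntegrableOn.integrable_indicator (f := fun x => ‖F x‖) (hF.integrableOn_isCompact hc).norm
      (isClosed_tsupport φ).measurableSet).const_mul M
  refine h1.mono' (hφ.aestronglyMeasurable.mul hFm) (Filter.Eventually.of_forall fun g => ?_)
  rw [norm_mul]
  by_cases hg : g ∈ tsupport φ
  · rw [Set.indicator_of_mem hg]
    exact mul_le_mul_of_nonneg_right (hM g) (norm_nonneg _)
  · rw [Set.indicator_of_notMem hg, image_eq_zero_of_notMem_tsupport hg]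
    simp

variable [LieGroup (𝓡 m) ∞ G] [IsFiniteMeasureOnCompacts μ]

omit [IsFiniteMeasureOnCompacts μ] in
/-- Differentiation under the integral sign along a flow curve. -/
theorem IsFlowCurve.hasDerivAt_integral {X : GroupLieAlgebra (𝓡 m) G} {γ : ℝ → G} {δ : ℝ}
    (h : IsFlowCurve X γ δ) {φ F : G → ℂ} (hφ : ContMDiff (𝓡 m) 𝓘(ℝ, ℂ) ∞ φ)
    (hc : HasCompactSupport φ) (hFm : AEStronglyMeasurable F μ) (hF : LocallyIntegrable F μ) :
    HasDerivAt (fun t => ∫ g, φ (g * γ t) * F g ∂μ) (∫ g, leftDeriv X φ g * F g ∂μ) 0 := by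
  have hcX := hasCompactSupport_leftDeriv hφ hc X
  have hX := (contMDiff_leftDeriv hφ X).continuous
  obtain ⟨M, hM⟩ := hcX.exists_bound_of_continuous hX
  have hδ2 : Metric.closedBall (0 : ℝ) (δ / 2) ⊆ Metric.ball 0 δ :=
    Metric.closedBall_subset_ball (by linarith [h.pos])
  have hγ : ContinuousOn γ (Metric.closedBall (0 : ℝ) (δ / 2)) := fun t ht =>
    (h.continuousAt (hδ2 ht)).continuousWithinAt
  -- One compact set containing the supports of all translates g ↦ φ(gγ(t)) with |t| ≤ δ/2, so that
  -- a single integrable function dominates the derivatives.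
  set K : Set G := tsupport φ * (γ '' Metric.closedBall (0 : ℝ) (δ / 2))⁻¹ with hK
  have hKc : IsCompact K :=
    hc.isCompact.mul ((isCompact_closedBall _ _).image_of_continuousOn hγ).inv
  have hmem : ∀ g, ∀ t ∈ Metric.closedBall (0 : ℝ) (δ / 2), g * γ t ∈ tsupport φ → g ∈ K := by
    intro g t ht hg
    refine ⟨g * γ t, hg, (γ t)⁻¹, Set.inv_mem_inv.2 ⟨t, ht, rfl⟩, by simp⟩
  have hs : Metric.closedBall (0 : ℝ) (δ / 2) ∈ 𝓝 (0 : ℝ) :=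
    Metric.closedBall_mem_nhds _ (by linarith [h.pos])
  have h0 : ∀ f : G → ℂ, (fun g => f (g * γ 0) * F g) = fun g => f g * F g := by
    intro f; simp [h.zero]
  have key := (hasDerivAt_integral_of_dominated_loc_of_deriv_le (𝕜 := ℝ) (μ := μ)
    (F := fun t g => φ (g * γ t) * F g) (F' := fun t g => leftDeriv X φ (g * γ t) * F g)
    (bound := fun g => M * K.indicator (fun x => ‖F x‖) g) (x₀ := 0) hs
    (Filter.Eventually.of_forall fun t =>
      ((hφ.continuous.comp (continuous_mul_const (γ t))).aestronglyMeasurable.mul hFm))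
    (by rw [h0]; exact integrable_mul_of_hasCompactSupport hφ.continuous hc hFm hF)
    (by rw [h0]; exact hX.aestronglyMeasurable.mul hFm)
    (Filter.Eventually.of_forall fun g t ht => by
      rw [norm_mul]
      by_cases hg : g ∈ K
      · rw [Set.indicator_of_mem hg]
        exact mul_le_mul_of_nonneg_right (hM _) (norm_nonneg _)
      · rw [Set.indicator_of_notMem hg, leftDeriv_eq_zero hφ X fun hh => hg (hmem g t ht hh)]
        simp)
    ((IntegrableOn.integrable_indicator (f := fun x => ‖F x‖) (hF.integrableOn_isCompact hKc).norm
      hKc.isClosed.measurableSet).const_mul M)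
    (Filter.Eventually.of_forall fun g t ht =>
      (h.hasDerivAt hφ g (hδ2 ht)).mul_const (F g))).2
  rwa [h0] at key

/-- By right invariance the integral of φ(gγ(t)) does not depend on t; its derivative at 0 is the
left side. -/
theorem integral_leftDeriv [μ.IsMulRightInvariant] (X : GroupLieAlgebra (𝓡 m) G) {φ : G → ℂ}
    (hφ : ContMDiff (𝓡 m) 𝓘(ℝ, ℂ) ∞ φ) (hc : HasCompactSupport φ) :
    ∫ g, leftDeriv X φ g ∂μ = 0 := by
  have : LocallyCompactSpace G := ChartedSpace.locallyCompactSpace (EuclideanSpace ℝ (Fin m)) G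
  obtain ⟨γ, δ, h⟩ := exists_isFlowCurve X
  have h1 := h.hasDerivAt_integral (μ := μ) (F := fun _ => 1) hφ hc aestronglyMeasurable_const
    (locallyIntegrable_const 1)
  simp only [mul_one, integral_mul_right_eq_self] at h1
  exact h1.unique (hasDerivAt_const _ _)

theorem integral_leftDeriv_mul [μ.IsMulRightInvariant] (X : GroupLieAlgebra (𝓡 m) G)
    {φ f : G → ℂ} (hφ : ContMDiff (𝓡 m) 𝓘(ℝ, ℂ) ∞ φ) (hc : HasCompactSupport φ)
    (hf : ContMDiff (𝓡 m) 𝓘(ℝ, ℂ) ∞ f) :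
    ∫ g, leftDeriv X φ g * f g ∂μ = -∫ g, φ g * leftDeriv X f g ∂μ := by
  have : LocallyCompactSpace G := ChartedSpace.locallyCompactSpace (EuclideanSpace ℝ (Fin m)) G
  have hs : ContMDiff (𝓡 m) 𝓘(ℝ, ℂ) ∞ fun x => φ x * f x := by
    have h1 : ContDiff ℝ ∞ fun x : ℂ × ℂ => x.1 * x.2 := contDiff_fst.mul contDiff_snd
    exact h1.contMDiff.comp (hφ.prodMk_space hf)
  have h1 := integral_leftDeriv (μ := μ) X hs hc.mul_right
  simp only [leftDeriv_mul hφ hf] at h1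
  have hint : ∀ {ψ k : G → ℂ}, Continuous ψ → HasCompactSupport ψ → Continuous k →
      Integrable (fun g => ψ g * k g) μ := fun hψ hψc hk =>
    (hψ.mul hk).integrable_of_hasCompactSupport hψc.mul_right
  rw [integral_add (hint (contMDiff_leftDeriv hφ X).continuous
    (hasCompactSupport_leftDeriv hφ hc X) hf.continuous)
    (hint hφ.continuous hc (contMDiff_leftDeriv hf X).continuous)] at h1
  exact eq_neg_of_add_eq_zero_left h1

end Integration

end RealReductive

/-! ### The energy estimate for first derivatives -/

namespace RealReductive

theorem exists_sq_le_of_sum_sq_le {κ : Type*} [Fintype κ] {c B : ℝ} (hc : 0 < c) (hB : 0 ≤ B)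
    (B' : κ → ℝ) : ∃ D, 0 ≤ D ∧ ∀ x y : ℝ, 0 ≤ x → 0 ≤ y → ∀ t : κ → ℝ,
      ∑ j, c * t j ^ 2 ≤ ∑ j, B' j * x * t j + B * x * y → ∀ i, t i ^ 2 ≤ D * (x * y + x ^ 2) := by
  refine ⟨(2 * B + ∑ i, B' i ^ 2 / c) / c, by positivity, fun x y hx hy t ht i => ?_⟩
  -- Young's inequality, weighted so that half of c t_j² absorbs the linear term.
  have h4 : ∀ j, B' j * x * t j ≤ c / 2 * t j ^ 2 + B' j ^ 2 / c / 2 * x ^ 2 := by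
    intro j
    have h5 : 0 ≤ (c * t j - B' j * x) ^ 2 / (2 * c) := by positivity
    have h6 : (c * t j - B' j * x) ^ 2 / (2 * c) =
      c / 2 * t j ^ 2 + B' j ^ 2 / c / 2 * x ^ 2 - B' j * x * t j := by field_simp; ring
    linarith
  have h7 := Finset.sum_le_sum fun j (_ : j ∈ Finset.univ) => h4 j
  rw [Finset.sum_add_distrib, ← Finset.mul_sum, ← Finset.sum_mul, ← Finset.sum_div] at h7
  rw [← Finset.mul_sum] at ht
  have h8 : t i ^ 2 ≤ ∑ j, t j ^ 2 :=
    Finset.single_le_sum (f := fun j => t j ^ 2) (fun j _ => sq_nonneg _) (Finset.mem_univ i)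
  have hT0 : 0 ≤ ∑ j, B' j ^ 2 / c := by positivity
  refine h8.trans ?_
  rw [div_mul_eq_mul_div, le_div_iff₀ hc]
  have e1 : 0 ≤ (∑ j, B' j ^ 2 / c) * (x * y) := by positivity
  have e2 : 0 ≤ B * x ^ 2 := by positivity
  linarith

namespace HilbertRep

section Bounds

variable {G : Type*} [Group G] [TopologicalSpace G]
  {H : Type*} [NormedAddCommGroup H] [InnerProductSpace ℂ H] (ρ : HilbertRep G H)

/-- The operators of a Hilbert representation are uniformly bounded on compact sets. -/
theorem exists_norm_toHom_le [CompleteSpace H] {K : Set G} (hK : IsCompact K) :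
    ∃ M, 0 < M ∧ ∀ g ∈ K, ‖ρ.toHom g‖ ≤ M := by
  obtain ⟨M, hM⟩ := banach_steinhaus (g := fun g : K => ρ.toHom g) (fun v => by
    obtain ⟨C, hC⟩ := hK.exists_bound_of_continuousOn (ρ.continuous_orbit v).continuousOn
    exact ⟨C, fun g => hC g g.2⟩)
  exact ⟨max M 1, by positivity, fun g hg => (hM ⟨g, hg⟩).trans (le_max_left _ _)⟩

theorem toHom_inv_toHom (g : G) (v : H) : ρ.toHom g⁻¹ (ρ.toHom g v) = v := by
  rw [← mul_apply_eq_comp, ← map_mul, inv_mul_cancel, map_one]; rfl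

/-- The average of the inner products of the translates of two vectors, with weight `ψ`. -/
noncomputable def weightedInner [MeasurableSpace G] (μ : Measure G) (ψ : G → ℂ) (v w : H) : ℂ :=
  ∫ g, ψ g * inner ℂ (ρ.toHom g v) (ρ.toHom g w) ∂μ

theorem exists_norm_weightedInner_le [CompleteSpace H] [MeasurableSpace G] [BorelSpace G]
    {μ : Measure G} [IsFiniteMeasureOnCompacts μ] {ψ : G → ℂ} (hψ : Continuous ψ)
    (hc : HasCompactSupport ψ) :
    ∃ B, 0 ≤ B ∧ ∀ v w, ‖ρ.weightedInner μ ψ v w‖ ≤ B * ‖v‖ * ‖w‖ := by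
  obtain ⟨M, hM0, hM⟩ := ρ.exists_norm_toHom_le hc.isCompact
  have hi : Integrable (fun g => ‖ψ g‖) μ :=
    hψ.norm.integrable_of_hasCompactSupport hc.norm
  refine ⟨(∫ g, ‖ψ g‖ ∂μ) * M ^ 2, by positivity, fun v w => ?_⟩
  calc ‖ρ.weightedInner μ ψ v w‖ ≤ ∫ g, ‖ψ g‖ * (M ^ 2 * ‖v‖ * ‖w‖) ∂μ := by
        refine norm_integral_le_of_norm_le (hi.mul_const _) (Filter.Eventually.of_forall fun g => ?_)
        rw [norm_mul]
        by_cases hg : g ∈ tsupport ψ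
        · refine mul_le_mul_of_nonneg_left ?_ (norm_nonneg _)
          calc ‖inner ℂ (ρ.toHom g v) (ρ.toHom g w)‖ ≤ ‖ρ.toHom g v‖ * ‖ρ.toHom g w‖ :=
                norm_inner_le_norm _ _
            _ ≤ (M * ‖v‖) * (M * ‖w‖) := by
                gcongr
                · exact (ρ.toHom g).le_of_opNorm_le (hM g hg) v
                · exact (ρ.toHom g).le_of_opNorm_le (hM g hg) w
            _ = M ^ 2 * ‖v‖ * ‖w‖ := by ring
        · simp [image_eq_zero_of_notMem_tsupport hg]
    _ = _ := by rw [integral_mul_const]; ring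

/-- For g in the support of f, the operators ρ(g⁻¹) are bounded by some M, so ‖ρ(g)v‖ ≥ ‖v‖/M there.
This coercivity replaces unitarity. -/
theorem exists_le_weightedInner_self [CompleteSpace H] [IsTopologicalGroup G] [MeasurableSpace G]
    [BorelSpace G] {μ : Measure G} [IsFiniteMeasureOnCompacts μ] [μ.IsOpenPosMeasure] {f : G → ℝ}
    (hf : Continuous f) (hc : HasCompactSupport f) (h0 : ∀ g, 0 ≤ f g) {g₀ : G} (hg₀ : f g₀ ≠ 0) :
    ∃ c, 0 < c ∧ ∀ v, c * ‖v‖ ^ 2 ≤ (ρ.weightedInner μ (fun g => (f g : ℂ)) v v).re := by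
  obtain ⟨M, hM0, hM⟩ := ρ.exists_norm_toHom_le hc.isCompact.inv
  have hi : Integrable f μ := hf.integrable_of_hasCompactSupport hc
  have hpos : 0 < ∫ g, f g ∂μ := hf.integral_pos_of_hasCompactSupport_nonneg_nonzero hc h0 hg₀
  refine ⟨(∫ g, f g ∂μ) / M ^ 2, by positivity, fun v => ?_⟩
  have e : ρ.weightedInner μ (fun g => (f g : ℂ)) v v =
      ((∫ g, f g * ‖ρ.toHom g v‖ ^ 2 ∂μ : ℝ) : ℂ) := by
    rw [weightedInner, ← integral_complex_ofReal]
    congr 1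
    funext g
    rw [inner_self_eq_norm_sq_to_K]
    simp
  rw [e, Complex.ofReal_re]
  have hi2 : Integrable (fun g => f g * ‖ρ.toHom g v‖ ^ 2) μ :=
    (hf.mul ((ρ.continuous_orbit v).norm.pow 2)).integrable_of_hasCompactSupport hc.mul_right
  calc (∫ g, f g ∂μ) / M ^ 2 * ‖v‖ ^ 2 = ∫ g, f g * (‖v‖ ^ 2 / M ^ 2) ∂μ := by
        rw [integral_mul_const]; ring
    _ ≤ ∫ g, f g * ‖ρ.toHom g v‖ ^ 2 ∂μ := by
        refine integral_mono (hi.mul_const _) hi2 fun g => ?_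
        by_cases hg : g ∈ tsupport f
        · refine mul_le_mul_of_nonneg_left ?_ (h0 g)
          rw [div_le_iff₀ (by positivity), ← mul_pow]
          refine pow_le_pow_left₀ (norm_nonneg _) ?_ 2
          have h1 := (ρ.toHom g⁻¹).le_of_opNorm_le (hM g⁻¹ (Set.inv_mem_inv.2 hg)) (ρ.toHom g v)
          rw [toHom_inv_toHom] at h1
          linarith
        · simp [image_eq_zero_of_notMem_tsupport hg]

end Bounds

variable {m : ℕ} {G : Type*} [Group G] [TopologicalSpace G]
  [ChartedSpace (EuclideanSpace ℝ (Fin m)) G] [LieGroup (𝓡 m) ∞ G]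
  [IsTopologicalGroup G] [T2Space G]
  {H : Type*} [NormedAddCommGroup H] [InnerProductSpace ℂ H] [CompleteSpace H]
  (ρ : HilbertRep G H)

omit [CompleteSpace H] in
theorem weightedInner_leftDeriv [MeasurableSpace G] [BorelSpace G]
    {μ : Measure G} [IsFiniteMeasureOnCompacts μ] [μ.IsMulRightInvariant] {φ : G → ℂ}
    (hφ : ContMDiff (𝓡 m) 𝓘(ℝ, ℂ) ∞ φ) (hc : HasCompactSupport φ)
    (X : GroupLieAlgebra (𝓡 m) G) (v w : ρ.smoothVectors m) :
    ρ.weightedInner μ (leftDeriv X φ) (v : H) (w : H) =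
      -(ρ.weightedInner μ φ (v : H) (ρ.deriv X w : H) +
        ρ.weightedInner μ φ (ρ.deriv X v : H) (w : H)) := by
  have hs : ContMDiff (𝓡 m) 𝓘(ℝ, ℂ) ∞
      fun g => inner ℂ (ρ.toHom g (v : H)) (ρ.toHom g (w : H)) := by
    have h1 : ContDiff ℝ ∞ fun x : H × H => inner ℂ x.1 x.2 := contDiff_inner
    exact h1.contMDiff.comp (ContMDiff.prodMk_space v.2 w.2)
  have hint : ∀ x y : H, Integrable (fun g => φ g * inner ℂ (ρ.toHom g x) (ρ.toHom g y)) μ :=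
    fun x y => (hφ.continuous.mul ((ρ.continuous_orbit x).inner
      (ρ.continuous_orbit y))).integrable_of_hasCompactSupport hc.mul_right
  rw [weightedInner, integral_leftDeriv_mul X hφ hc hs, weightedInner, weightedInner,
    ← integral_add (hint _ _) (hint _ _)]
  congr 2
  funext g
  rw [leftDeriv_inner (f := fun g => ρ.toHom g (v : H)) (k := fun g => ρ.toHom g (w : H)) v.2 w.2,
    leftDeriv_orbit, leftDeriv_orbit, mul_add]

-- The energy identity: integrate each b_j by parts in the averaged inner product and sum, which
-- leaves Δv and terms carrying derivatives of the weight but only one derivative of v.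
omit [CompleteSpace H] in
theorem sum_weightedInner_deriv [MeasurableSpace G] [BorelSpace G]
    {μ : Measure G} [IsFiniteMeasureOnCompacts μ] [μ.IsMulRightInvariant] {φ : G → ℂ}
    (hφ : ContMDiff (𝓡 m) 𝓘(ℝ, ℂ) ∞ φ) (hc : HasCompactSupport φ)
    {κ : Type*} [Fintype κ] (b : κ → GroupLieAlgebra (𝓡 m) G) (v Δv : ρ.smoothVectors m)
    (hΔ : ∑ j, ρ.deriv (b j) (ρ.deriv (b j) v) = Δv) :
    ∑ j, ρ.weightedInner μ φ (ρ.deriv (b j) v : H) (ρ.deriv (b j) v : H) =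
      ∑ j, -ρ.weightedInner μ (leftDeriv (b j) φ) (v : H) (ρ.deriv (b j) v : H) +
        -ρ.weightedInner μ φ (v : H) (Δv : H) := by
  have h2 : ∑ j, ρ.weightedInner μ φ (v : H) (ρ.deriv (b j) (ρ.deriv (b j) v) : H) =
        ρ.weightedInner μ φ (v : H) (Δv : H) := by
    simp only [weightedInner]
    rw [← integral_finsetSum]
    · congr 1
      funext g
      rw [← Finset.mul_sum, ← inner_sum, ← map_sum, ← hΔ, Submodule.coe_sum]
    · intro j _
      exact (hφ.continuous.mul ((ρ.continuous_orbit _).inner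
        (ρ.continuous_orbit _))).integrable_of_hasCompactSupport hc.mul_right
  rw [← h2, ← Finset.sum_neg_distrib, ← Finset.sum_add_distrib]
  refine Finset.sum_congr rfl fun j _ => ?_
  rw [ρ.weightedInner_leftDeriv hφ hc]
  ring

theorem exists_sq_norm_deriv_le_of_measure [MeasurableSpace G] [BorelSpace G]
    (μ : Measure G) [IsFiniteMeasureOnCompacts μ] [μ.IsMulRightInvariant] [μ.IsOpenPosMeasure]
    {f : G → ℝ} (hf : ContMDiff (𝓡 m) 𝓘(ℝ, ℝ) ∞ f) (hc : HasCompactSupport f)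
    (h0 : ∀ g, 0 ≤ f g) {g₀ : G} (hg₀ : f g₀ ≠ 0)
    {κ : Type*} [Fintype κ] (b : κ → GroupLieAlgebra (𝓡 m) G) :
    ∃ D, 0 ≤ D ∧ ∀ (v Δv : ρ.smoothVectors m), ∑ j, ρ.deriv (b j) (ρ.deriv (b j) v) = Δv →
      ∀ i : κ, ‖(ρ.deriv (b i) v : H)‖ ^ 2 ≤
        D * (‖(v : H)‖ * ‖(Δv : H)‖ + ‖(v : H)‖ ^ 2) := by
  have hfs : ContMDiff (𝓡 m) 𝓘(ℝ, ℂ) ∞ (fun g => (f g : ℂ)) :=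
    Complex.ofRealCLM.contMDiff.comp hf
  have hfc : HasCompactSupport (fun g => (f g : ℂ)) := hc.comp_left (g := fun x : ℝ => (x : ℂ)) (by simp)
  obtain ⟨c, hc0, hc⟩ := ρ.exists_le_weightedInner_self (μ := μ) hf.continuous hc h0 hg₀
  obtain ⟨B, hB0, hB⟩ := ρ.exists_norm_weightedInner_le (μ := μ) hfs.continuous hfc
  have hBi := fun i => ρ.exists_norm_weightedInner_le (μ := μ)
    (contMDiff_leftDeriv hfs (b i)).continuous (hasCompactSupport_leftDeriv hfs hfc (b i))
  choose B' hB'0 hB' using hBi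
  obtain ⟨D, hD0, hD⟩ := exists_sq_le_of_sum_sq_le hc0 hB0 B'
  refine ⟨D, hD0, fun v Δv hΔ i => ?_⟩
  refine hD _ _ (norm_nonneg _) (norm_nonneg _) (fun j => ‖(ρ.deriv (b j) v : H)‖) ?_ i
  refine (Finset.sum_le_sum fun j _ => hc (ρ.deriv (b j) v : H)).trans ?_
  rw [← Complex.re_sum, ρ.sum_weightedInner_deriv hfs hfc b v Δv hΔ, Complex.add_re, Complex.re_sum]
  refine add_le_add (Finset.sum_le_sum fun j _ => ?_) ?_
  · exact (Complex.re_le_norm _).trans ((norm_neg _).trans_le (hB' j _ _))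
  · exact (Complex.re_le_norm _).trans ((norm_neg _).trans_le (hB _ _))

theorem exists_sq_norm_deriv_le {κ : Type*} [Fintype κ] (b : κ → GroupLieAlgebra (𝓡 m) G) :
    ∃ D, 0 ≤ D ∧ ∀ (v Δv : ρ.smoothVectors m), ∑ j, ρ.deriv (b j) (ρ.deriv (b j) v) = Δv →
      ∀ i : κ, ‖(ρ.deriv (b i) v : H)‖ ^ 2 ≤
        D * (‖(v : H)‖ * ‖(Δv : H)‖ + ‖(v : H)‖ ^ 2) := by
  have : LocallyCompactSpace G := ChartedSpace.locallyCompactSpace (EuclideanSpace ℝ (Fin m)) G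
  have : IsManifold (𝓡 m) ∞ G := inferInstance
  let _ : MeasurableSpace G := borel G
  have : BorelSpace G := ⟨rfl⟩
  obtain ⟨f⟩ : Nonempty (SmoothBumpFunction (𝓡 m) (1 : G)) := inferInstance
  -- Haar measure is left invariant here, and integration by parts along left invariant fields needs
  -- right invariance, hence the inverse measure.
  exact ρ.exists_sq_norm_deriv_le_of_measure (Measure.haar : Measure G).inv f.contMDiff
    f.hasCompactSupport (fun g => f.nonneg) (g₀ := 1) (by rw [f.eq_one]; exact one_ne_zero) b

/-- An interpolation inequality: the first derivatives of a smooth vector are bounded by a small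
multiple of the Laplacian and a large multiple of the vector. -/
theorem exists_norm_deriv_le {κ : Type*} [Fintype κ] (b : κ → GroupLieAlgebra (𝓡 m) G) {ε : ℝ}
    (hε : 0 < ε) : ∃ C, 0 ≤ C ∧ ∀ (v Δv : ρ.smoothVectors m),
      ∑ j, ρ.deriv (b j) (ρ.deriv (b j) v) = Δv → ∀ i : κ,
        ‖(ρ.deriv (b i) v : H)‖ ≤ ε * ‖(Δv : H)‖ + C * ‖(v : H)‖ := by
  obtain ⟨D, hD0, hD⟩ := ρ.exists_sq_norm_deriv_le b
  -- In the square of εy + Cx, the summand D/(2ε) of C produces the cross term Dxy, and D + 1 covers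
  -- Dx².
  refine ⟨D / (2 * ε) + D + 1, by positivity, fun v Δv hΔ i => ?_⟩
  have hDi := hD v Δv hΔ i
  set x := ‖(v : H)‖
  set y := ‖(Δv : H)‖
  have hx : 0 ≤ x := norm_nonneg _
  have hy : 0 ≤ y := norm_nonneg _
  refine le_of_sq_le_sq (hDi.trans ?_) (by positivity)
  have hE : 0 ≤ D / (2 * ε) := by positivity
  have e1 : 2 * ε * (D / (2 * ε)) = D := by field_simp
  have e2 : (ε * y + (D / (2 * ε) + D + 1) * x) ^ 2 - D * (x * y + x ^ 2) =
      ε ^ 2 * y ^ 2 + (2 * ε * (D / (2 * ε)) - D) * (x * y) + 2 * ε * (D + 1) * (x * y) +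
        ((D / (2 * ε)) ^ 2 + 2 * (D / (2 * ε)) * (D + 1) + D ^ 2 + D + 1) * x ^ 2 := by ring
  rw [e1, sub_self, zero_mul, add_zero] at e2
  have e3 : 0 ≤ ε ^ 2 * y ^ 2 + 2 * ε * (D + 1) * (x * y) +
        ((D / (2 * ε)) ^ 2 + 2 * (D / (2 * ε)) * (D + 1) + D ^ 2 + D + 1) * x ^ 2 := by positivity
  linarith

end HilbertRep

end RealReductive

namespace RealReductive

/-! ### The order filtration of the enveloping algebra -/

section Filtration

attribute [local instance] LieRing.ofAssociativeRing

variable {L : Type*} [LieRing L] [LieAlgebra ℝ L] {κ : Type*} [Fintype κ]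

/-- The elements of order at most `k` of the enveloping algebra, where the family `b` spans `L`. -/
noncomputable def envOrder (b : κ → L) (k : ℕ) : Submodule ℝ (UniversalEnvelopingAlgebra ℝ L) :=
  Submodule.span ℝ (insert 1 (Set.range fun i => UniversalEnvelopingAlgebra.ι ℝ (b i))) ^ k

/-- The Laplacian attached to a family of elements of `L`. -/
noncomputable def envLaplacian (b : κ → L) : UniversalEnvelopingAlgebra ℝ L :=
  ∑ i, UniversalEnvelopingAlgebra.ι ℝ (b i) * UniversalEnvelopingAlgebra.ι ℝ (b i)

omit [Fintype κ] in
theorem envOrder_one (b : κ → L) : envOrder b 1 =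
    Submodule.span ℝ (insert 1 (Set.range fun i => UniversalEnvelopingAlgebra.ι ℝ (b i))) :=
  pow_one _

omit [Fintype κ] in
theorem envOrder_zero (b : κ → L) : envOrder b 0 = 1 := pow_zero _

omit [Fintype κ] in
theorem envOrder_add (b : κ → L) (k l : ℕ) :
    envOrder b (k + l) = envOrder b k * envOrder b l := pow_add _ _ _

omit [Fintype κ] in
theorem one_mem_envOrder_one (b : κ → L) : 1 ∈ envOrder b 1 := by
  rw [envOrder_one]; exact Submodule.subset_span (Set.mem_insert _ _)

omit [Fintype κ] in
theorem envOrder_mono (b : κ → L) : Monotone (envOrder b) := by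
  refine monotone_nat_of_le_succ fun k x hx => ?_
  rw [envOrder_add, ← mul_one x]
  exact Submodule.mul_mem_mul hx (one_mem_envOrder_one b)

theorem envOrder_fg (b : κ → L) (k : ℕ) : (envOrder b k).FG :=
  (Submodule.fg_span ((Set.finite_range _).insert 1)).pow k

omit [Fintype κ] in
theorem ι_mem_envOrder_one {b : κ → L} (hb : Submodule.span ℝ (Set.range b) = ⊤) (x : L) :
    UniversalEnvelopingAlgebra.ι ℝ x ∈ envOrder b 1 := by
  have hx : x ∈ Submodule.span ℝ (Set.range b) := by rw [hb]; trivial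
  rw [envOrder_one]
  induction hx using Submodule.span_induction with
  | mem x hx =>
    obtain ⟨i, rfl⟩ := hx
    exact Submodule.subset_span (Set.mem_insert_of_mem _ ⟨i, rfl⟩)
  | zero => rw [map_zero]; exact Submodule.zero_mem _
  | add x y _ _ hx hy => rw [map_add]; exact Submodule.add_mem _ hx hy
  | smul c x _ hx => rw [map_smul]; exact Submodule.smul_mem _ _ hx

omit [Fintype κ] in
theorem exists_mem_envOrder {b : κ → L} (hb : Submodule.span ℝ (Set.range b) = ⊤)
    (x : UniversalEnvelopingAlgebra ℝ L) : ∃ k, x ∈ envOrder b k := by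
  have hx : x ∈ Algebra.adjoin ℝ (Set.range (UniversalEnvelopingAlgebra.ι ℝ (L := L))) := by
    rw [env_adjoin_range]; trivial
  induction hx using Algebra.adjoin_induction with
  | mem x hx => obtain ⟨x, rfl⟩ := hx; exact ⟨1, ι_mem_envOrder_one hb x⟩
  | algebraMap r =>
    refine ⟨0, ?_⟩
    rw [envOrder_zero]
    exact Submodule.mem_one.2 ⟨r, rfl⟩
  | add x y _ _ hx hy =>
    obtain ⟨k, hk⟩ := hx
    obtain ⟨l, hl⟩ := hy
    exact ⟨max k l, Submodule.add_mem _ (envOrder_mono b (le_max_left k l) hk)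
      (envOrder_mono b (le_max_right k l) hl)⟩
  | mul x y _ _ hx hy =>
    obtain ⟨k, hk⟩ := hx
    obtain ⟨l, hl⟩ := hy
    exact ⟨k + l, by rw [envOrder_add]; exact Submodule.mul_mem_mul hk hl⟩

-- Commutation with an element of L is a derivation that preserves the span of 1 and L, hence every
-- power of that span.
omit [Fintype κ] in
theorem commutator_mem_envOrder {b : κ → L} (hb : Submodule.span ℝ (Set.range b) = ⊤) (x : L)
    (k : ℕ) : ∀ y ∈ envOrder b k,
      UniversalEnvelopingAlgebra.ι ℝ x * y - y * UniversalEnvelopingAlgebra.ι ℝ x ∈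
        envOrder b k := by
  have h1 : ∀ y ∈ envOrder b 1, UniversalEnvelopingAlgebra.ι ℝ x * y -
      y * UniversalEnvelopingAlgebra.ι ℝ x ∈ envOrder b 1 := by
    intro y hy
    rw [envOrder_one] at hy
    induction hy using Submodule.span_induction with
    | mem y hy =>
      obtain rfl | ⟨i, rfl⟩ := hy
      · rw [mul_one, one_mul, sub_self]; exact Submodule.zero_mem _
      · have h2 := ι_mem_envOrder_one hb ⁅x, b i⁆
        rwa [LieHom.map_lie, LieRing.of_associative_ring_bracket] at h2
    | zero => simp
    | add y z _ _ hy hz =>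
      convert! Submodule.add_mem _ hy hz using 1
      noncomm_ring
    | smul c y _ hy =>
      convert! Submodule.smul_mem _ c hy using 1
      rw [mul_smul_comm, smul_mul_assoc, smul_sub]
  induction k with
  | zero =>
    intro y hy
    rw [envOrder_zero] at hy
    obtain ⟨r, rfl⟩ := Submodule.mem_one.1 hy
    rw [Algebra.commutes, sub_self]
    exact Submodule.zero_mem _
  | succ k ih =>
    intro y hy
    rw [envOrder_add] at hy
    refine Submodule.mul_induction_on hy (fun a ha c hc => ?_) fun y z hy hz => ?_
    · have e : UniversalEnvelopingAlgebra.ι ℝ x * (a * c) - a * c * UniversalEnvelopingAlgebra.ι ℝ x =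
          (UniversalEnvelopingAlgebra.ι ℝ x * a - a * UniversalEnvelopingAlgebra.ι ℝ x) * c +
          a * (UniversalEnvelopingAlgebra.ι ℝ x * c - c * UniversalEnvelopingAlgebra.ι ℝ x) := by
        noncomm_ring
      rw [e, envOrder_add]
      exact Submodule.add_mem _ (Submodule.mul_mem_mul (ih a ha) hc)
        (Submodule.mul_mem_mul ha (h1 c hc))
    · convert! Submodule.add_mem _ hy hz using 1
      noncomm_ring

/-- Since [x², y] = x[x, y] + [x, y]x, the order rises by one rather than two. This gain lets the
commutator be absorbed in the regularity estimate. -/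
theorem laplacian_commutator_mem_envOrder {b : κ → L}
    (hb : Submodule.span ℝ (Set.range b) = ⊤) {k : ℕ} {y : UniversalEnvelopingAlgebra ℝ L}
    (hy : y ∈ envOrder b k) :
    envLaplacian b * y - y * envLaplacian b ∈ envOrder b (k + 1) := by
  rw [envLaplacian, Finset.sum_mul, Finset.mul_sum, ← Finset.sum_sub_distrib]
  refine Submodule.sum_mem _ fun i _ => ?_
  set x := UniversalEnvelopingAlgebra.ι ℝ (b i)
  have h1 : x * y - y * x ∈ envOrder b k := commutator_mem_envOrder hb (b i) k y hy
  have h2 : x ∈ envOrder b 1 := ι_mem_envOrder_one hb (b i)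
  have e : x * x * y - y * (x * x) = x * (x * y - y * x) + (x * y - y * x) * x := by noncomm_ring
  rw [e]
  refine Submodule.add_mem _ ?_ ?_
  · rw [add_comm, envOrder_add]; exact Submodule.mul_mem_mul h2 h1
  · rw [envOrder_add]; exact Submodule.mul_mem_mul h1 h2

end Filtration

/-! ### From first derivatives to all orders; here s v x plays the role of ‖xv‖ -/

section Estimates

variable {L : Type*} [LieRing L] [LieAlgebra ℝ L] {κ : Type*} [Fintype κ] {V : Type*}
  (s : V → Seminorm ℝ (UniversalEnvelopingAlgebra ℝ L))

theorem exists_le_sum_of_mem_span {A : Type*} [AddCommGroup A] [Module ℝ A] (s : V → Seminorm ℝ A)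
    (T : Finset A) {x : A} (hx : x ∈ Submodule.span ℝ (T : Set A)) :
    ∃ C, 0 ≤ C ∧ ∀ v, s v x ≤ C * ∑ t ∈ T, s v t := by
  induction hx using Submodule.span_induction with
  | mem x hx =>
    refine ⟨1, zero_le_one, fun v => ?_⟩
    rw [one_mul]
    exact Finset.single_le_sum (f := fun t => s v t) (fun t _ => apply_nonneg _ _) hx
  | zero => exact ⟨0, le_rfl, fun v => by simp⟩
  | add x y _ _ hx hy =>
    obtain ⟨C, hC, h⟩ := hx
    obtain ⟨C', hC', h'⟩ := hy
    refine ⟨C + C', add_nonneg hC hC', fun v => ?_⟩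
    rw [add_mul]
    exact (map_add_le_add _ _ _).trans (add_le_add (h v) (h' v))
  | smul c x _ hx =>
    obtain ⟨C, hC, h⟩ := hx
    refine ⟨|c| * C, by positivity, fun v => ?_⟩
    rw [map_smul_eq_mul, Real.norm_eq_abs, mul_assoc]
    exact mul_le_mul_of_nonneg_left (h v) (abs_nonneg c)

variable {s} {b : κ → L}

/-- One step of the regularity estimate: elements of order `k + 1` are controlled by elements of
order `k` and their products with the Laplacian. -/
theorem exists_order_succ_le (hb : Submodule.span ℝ (Set.range b) = ⊤)
    (hint : ∀ ε : ℝ, 0 < ε → ∃ C, 0 ≤ C ∧ ∀ v i y, s v (UniversalEnvelopingAlgebra.ι ℝ (b i) * y) ≤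
      ε * s v (envLaplacian b * y) + C * s v y)
    {k : ℕ} {T T' : Finset (UniversalEnvelopingAlgebra ℝ L)}
    (hT : Submodule.span ℝ (T : Set (UniversalEnvelopingAlgebra ℝ L)) = envOrder b k)
    (hT' : Submodule.span ℝ (T' : Set (UniversalEnvelopingAlgebra ℝ L)) = envOrder b (k + 1))
    (hmul : ∀ v y, ∃ v', ∀ x, s v' x = s v (x * y))
    {x : UniversalEnvelopingAlgebra ℝ L} (hx : x ∈ envOrder b (k + 1)) :
    ∀ ε : ℝ, 0 < ε → ∃ C, 0 ≤ C ∧ ∀ v, s v x ≤ ε * ∑ t ∈ T', s v t +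
      C * (∑ t ∈ T, s v t + ∑ t ∈ T, s v (t * envLaplacian b)) := by
  have hN : ∀ v, 0 ≤ ∑ t ∈ T, s v t := fun v => Finset.sum_nonneg fun _ _ => apply_nonneg _ _
  have hNΔ : ∀ v, 0 ≤ ∑ t ∈ T, s v (t * envLaplacian b) :=
    fun v => Finset.sum_nonneg fun _ _ => apply_nonneg _ _
  have hN' : ∀ v, 0 ≤ ∑ t ∈ T', s v t := fun v => Finset.sum_nonneg fun _ _ => apply_nonneg _ _
  -- Written as 1 + k, so that the factor of order one stands on the left, where `hint` applies.
  rw [add_comm, envOrder_add] at hx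
  refine Submodule.mul_induction_on hx (fun c hc y hy => ?_) fun x z hx hz => ?_
  · obtain ⟨C₁, hC₁, h₁⟩ := exists_le_sum_of_mem_span s T (hT.symm ▸ hy)
    rw [envOrder_one] at hc
    induction hc using Submodule.span_induction with
    | mem c hc =>
      intro ε hε
      obtain rfl | ⟨i, rfl⟩ := hc
      · refine ⟨C₁, hC₁, fun v => ?_⟩
        rw [one_mul]
        refine (h₁ v).trans ?_
        nlinarith [mul_nonneg hε.le (hN' v), mul_nonneg hC₁ (hNΔ v)]
      · obtain ⟨C₂, hC₂, h₂⟩ := exists_le_sum_of_mem_span s T'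
          (hT'.symm ▸ laplacian_commutator_mem_envOrder hb hy)
        -- C₂ bounds the commutator by the seminorms of order k + 1; dividing by C₂ + 1 brings the
        -- total coefficient of those below ε.
        obtain ⟨C₃, hC₃, h₃⟩ := hint (ε / (C₂ + 1)) (by positivity)
        refine ⟨C₃ * C₁ + ε / (C₂ + 1) * C₁, by positivity, fun v => ?_⟩
        have h4 : s v (envLaplacian b * y) ≤
            C₂ * ∑ t ∈ T', s v t + C₁ * ∑ t ∈ T, s v (t * envLaplacian b) := by
          have e : envLaplacian b * y =
            (envLaplacian b * y - y * envLaplacian b) + y * envLaplacian b := by abel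
          -- The term yΔ is the estimate for y applied to the vector Δv.
          obtain ⟨v', hv'⟩ := hmul v (envLaplacian b)
          have h5 := h₁ v'
          simp only [hv'] at h5
          rw [e]
          exact (map_add_le_add _ _ _).trans (add_le_add (h₂ v) h5)
        have h6 : 0 ≤ ε / (C₂ + 1) := by positivity
        have h7 : ε / (C₂ + 1) * C₂ ≤ ε := by
          rw [div_mul_eq_mul_div, div_le_iff₀ (by positivity)]
          nlinarith
        calc s v (UniversalEnvelopingAlgebra.ι ℝ (b i) * y)
            ≤ ε / (C₂ + 1) * s v (envLaplacian b * y) + C₃ * s v y := h₃ v i y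
          _ ≤ ε / (C₂ + 1) * (C₂ * ∑ t ∈ T', s v t + C₁ * ∑ t ∈ T, s v (t * envLaplacian b)) +
              C₃ * (C₁ * ∑ t ∈ T, s v t) := by
              gcongr
              exact h₁ v
          _ = (ε / (C₂ + 1) * C₂) * ∑ t ∈ T', s v t +
              ε / (C₂ + 1) * C₁ * ∑ t ∈ T, s v (t * envLaplacian b) +
                C₃ * C₁ * ∑ t ∈ T, s v t := by ring
          _ ≤ _ := by
              have e1 := mul_le_mul_of_nonneg_right h7 (hN' v)
              have e2 : 0 ≤ ε / (C₂ + 1) * C₁ * ∑ t ∈ T, s v t :=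
                mul_nonneg (by positivity) (hN v)
              have e3 : 0 ≤ C₃ * C₁ * ∑ t ∈ T, s v (t * envLaplacian b) :=
                mul_nonneg (by positivity) (hNΔ v)
              linarith
    | zero =>
      intro ε hε
      refine ⟨0, le_rfl, fun v => ?_⟩
      rw [zero_mul, map_zero, zero_mul, add_zero]
      exact mul_nonneg hε.le (hN' v)
    | add c d _ _ hc hd =>
      intro ε hε
      obtain ⟨C, hC, h⟩ := hc _ (half_pos hε)
      obtain ⟨C', hC', h'⟩ := hd _ (half_pos hε)
      refine ⟨C + C', add_nonneg hC hC', fun v => ?_⟩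
      rw [add_mul]
      have := (map_add_le_add (s v) (c * y) (d * y)).trans (add_le_add (h v) (h' v))
      linarith
    | smul r c _ hc =>
      intro ε hε
      obtain ⟨C, hC, h⟩ := hc (ε / (|r| + 1)) (by positivity)
      refine ⟨|r| * C, by positivity, fun v => ?_⟩
      rw [smul_mul_assoc, map_smul_eq_mul, Real.norm_eq_abs]
      have h7 : |r| * (ε / (|r| + 1)) ≤ ε := by
        rw [mul_div_assoc', div_le_iff₀ (by positivity)]
        nlinarith
      have h8 := mul_le_mul_of_nonneg_left (h v) (abs_nonneg r)
      have h9 := mul_le_mul_of_nonneg_right h7 (hN' v)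
      linarith
  · intro ε hε
    obtain ⟨C, hC, h⟩ := hx _ (half_pos hε)
    obtain ⟨C', hC', h'⟩ := hz _ (half_pos hε)
    refine ⟨C + C', add_nonneg hC hC', fun v => ?_⟩
    have := (map_add_le_add (s v) x z).trans (add_le_add (h v) (h' v))
    linarith

/-- The regularity estimate: all elements of the enveloping algebra are controlled by powers of the
Laplacian. -/
theorem exists_le_sum_laplacian_pow (hb : Submodule.span ℝ (Set.range b) = ⊤)
    (hint : ∀ ε : ℝ, 0 < ε → ∃ C, 0 ≤ C ∧ ∀ v i y, s v (UniversalEnvelopingAlgebra.ι ℝ (b i) * y) ≤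
      ε * s v (envLaplacian b * y) + C * s v y)
    (hmul : ∀ v y, ∃ v', ∀ x, s v' x = s v (x * y)) (x : UniversalEnvelopingAlgebra ℝ L) :
    ∃ C k, 0 ≤ C ∧ ∀ v, s v x ≤ C * ∑ l ∈ Finset.range k, s v (envLaplacian b ^ l) := by
  choose T hT using fun k => envOrder_fg b k
  have main : ∀ k, ∃ C, 0 ≤ C ∧ ∀ v, ∑ t ∈ T k, s v t ≤
      C * ∑ l ∈ Finset.range (k + 1), s v (envLaplacian b ^ l) := by
    intro k
    induction k with
    | zero =>
      have h1 : ∀ t ∈ T 0, ∃ r : ℝ, t = r • (1 : UniversalEnvelopingAlgebra ℝ L) := by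
        intro t ht
        have h2 : t ∈ envOrder b 0 := by rw [← hT]; exact Submodule.subset_span ht
        rw [envOrder_zero] at h2
        obtain ⟨r, hr⟩ := Submodule.mem_one.1 h2
        exact ⟨r, by rw [← hr, Algebra.algebraMap_eq_smul_one]⟩
      choose! r hr using h1
      refine ⟨∑ t ∈ T 0, |r t|, Finset.sum_nonneg fun _ _ => abs_nonneg _, fun v => ?_⟩
      rw [Finset.sum_mul]
      refine Finset.sum_le_sum fun t ht => ?_
      conv_lhs => rw [hr t ht]
      rw [map_smul_eq_mul, Real.norm_eq_abs]
      simp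
    | succ k ih =>
      obtain ⟨C, hC, h⟩ := ih
      -- Summed over all of T (k + 1), this ε contributes at most half of the left side, which can
      -- then be absorbed.
      have hε : (0 : ℝ) < 1 / (2 * ((T (k + 1)).card + 1)) := by positivity
      have h1 : ∀ t ∈ T (k + 1), ∃ C', 0 ≤ C' ∧ ∀ v, s v t ≤
          1 / (2 * ((T (k + 1)).card + 1)) * ∑ t ∈ T (k + 1), s v t +
            C' * (∑ t ∈ T k, s v t + ∑ t ∈ T k, s v (t * envLaplacian b)) := fun t ht =>
        exists_order_succ_le hb hint (hT k) (hT (k + 1)) hmul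
          (by rw [← hT]; exact Submodule.subset_span ht) _ hε
      choose! C' hC' h2 using h1
      refine ⟨2 * (∑ t ∈ T (k + 1), C' t) * (2 * C), by
        have := Finset.sum_nonneg hC'
        positivity, fun v => ?_⟩
      set N := ∑ t ∈ T (k + 1), s v t with hN
      have hN0 : 0 ≤ N := Finset.sum_nonneg fun _ _ => apply_nonneg _ _
      set S := ∑ l ∈ Finset.range (k + 1 + 1), s v (envLaplacian b ^ l) with hS
      have h3 : ∑ t ∈ T k, s v t ≤ C * S := by
        refine (h v).trans (mul_le_mul_of_nonneg_left ?_ hC)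
        exact Finset.sum_le_sum_of_subset_of_nonneg
          (Finset.range_mono (Nat.le_succ _)) fun _ _ _ => apply_nonneg _ _
      have h4 : ∑ t ∈ T k, s v (t * envLaplacian b) ≤ C * S := by
        -- The induction hypothesis at Δv shifts every power of Δ up by one.
        obtain ⟨v', hv'⟩ := hmul v (envLaplacian b)
        have h5 := h v'
        simp only [hv', ← pow_succ] at h5
        refine h5.trans (mul_le_mul_of_nonneg_left ?_ hC)
        rw [hS, Finset.sum_range_succ' _ (k + 1)]
        exact le_add_of_nonneg_right (apply_nonneg _ _)
      have h6 : N ≤ (T (k + 1)).card * (1 / (2 * ((T (k + 1)).card + 1)) * N) +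
          (∑ t ∈ T (k + 1), C' t) * (C * S + C * S) := by
        calc N ≤ ∑ t ∈ T (k + 1), (1 / (2 * ((T (k + 1)).card + 1)) * N +
              C' t * (∑ t ∈ T k, s v t + ∑ t ∈ T k, s v (t * envLaplacian b))) :=
              Finset.sum_le_sum fun t ht => h2 t ht v
          _ ≤ ∑ t ∈ T (k + 1), (1 / (2 * ((T (k + 1)).card + 1)) * N + C' t * (C * S + C * S)) :=
              Finset.sum_le_sum fun t ht => add_le_add le_rfl
                (mul_le_mul_of_nonneg_left (add_le_add h3 h4) (hC' t ht))
          _ = _ := by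
              rw [Finset.sum_add_distrib, Finset.sum_const, nsmul_eq_mul, ← Finset.sum_mul]
      have h7 : (T (k + 1)).card * (1 / (2 * ((T (k + 1)).card + 1)) * N) ≤ N / 2 := by
        have e : (T (k + 1)).card * (1 / (2 * ((T (k + 1)).card + 1)) * N) =
          (T (k + 1)).card / ((T (k + 1)).card + 1) * (N / 2) := by field_simp
        rw [e]
        refine mul_le_of_le_one_left (by positivity) ?_
        rw [div_le_one (by positivity)]
        linarith
      linarith
  obtain ⟨k, hk⟩ := exists_mem_envOrder hb x
  obtain ⟨C₁, hC₁, h₁⟩ := exists_le_sum_of_mem_span s (T k) ((hT k).symm ▸ hk)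
  obtain ⟨C₂, hC₂, h₂⟩ := main k
  refine ⟨C₁ * C₂, k + 1, by positivity, fun v => (h₁ v).trans ?_⟩
  rw [mul_assoc]
  exact mul_le_mul_of_nonneg_left (h₂ v) hC₁

/-- If `Δ = z - 2 y` where the central element `z` acts boundedly, then powers of `Δ` are
controlled by powers of `1 + y`. -/
theorem exists_pow_le_sum_pow {A : Type*} [Ring A] [Algebra ℝ A] {s : V → Seminorm ℝ A}
    {z y Δ : A} (hΔ : z - 2 • y = Δ) (hz : Commute z (1 + y)) {M : ℝ} (hM : 0 ≤ M)
    (hb : ∀ v x, s v (z * x) ≤ M * s v x) (hmul : ∀ v y, ∃ v', ∀ x, s v' x = s v (x * y)) (l : ℕ) :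
    ∃ C, 0 ≤ C ∧ ∀ v, s v (Δ ^ l) ≤ C * ∑ k ∈ Finset.range (l + 1), s v ((1 + y) ^ k) := by
  have hΔ' : Δ = z + (2 : ℝ) • 1 - (2 : ℝ) • (1 + y) := by
    rw [← hΔ, smul_add, two_nsmul]
    module
  induction l with
  | zero => exact ⟨1, zero_le_one, fun v => by simp⟩
  | succ l ih =>
    obtain ⟨C, hC, h⟩ := ih
    refine ⟨C * (M + 4), by positivity, fun v => ?_⟩
    obtain ⟨v', hv'⟩ := hmul v Δ
    have h1 := h v'
    simp only [hv', ← pow_succ] at h1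
    refine h1.trans ?_
    rw [mul_assoc]
    refine mul_le_mul_of_nonneg_left ?_ hC
    have h2 : ∀ k, s v ((1 + y) ^ k * Δ) ≤
        (M + 2) * s v ((1 + y) ^ k) + 2 * s v ((1 + y) ^ (k + 1)) := by
      intro k
      -- Commuting z to the left of the power is what makes the bound `hb` for left multiplication
      -- by z usable.
      have e : (1 + y) ^ k * Δ =
          (z * (1 + y) ^ k + (2 : ℝ) • (1 + y) ^ k) + (-2 : ℝ) • (1 + y) ^ (k + 1) := by
        rw [hΔ', mul_sub, mul_add, mul_smul_comm, mul_smul_comm, mul_one, ← pow_succ,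
          (hz.pow_right k).eq, neg_smul, sub_eq_add_neg]
      rw [e]
      refine (map_add_le_add _ _ _).trans ?_
      refine (add_le_add_left (map_add_le_add _ _ _) _).trans ?_
      rw [map_smul_eq_mul, map_smul_eq_mul]
      have := hb v ((1 + y) ^ k)
      norm_num
      linarith
    refine (Finset.sum_le_sum fun k _ => h2 k).trans ?_
    rw [Finset.sum_add_distrib, ← Finset.mul_sum, ← Finset.mul_sum]
    have h3 : ∑ k ∈ Finset.range (l + 1), s v ((1 + y) ^ k) ≤
        ∑ k ∈ Finset.range (l + 1 + 1), s v ((1 + y) ^ k) :=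
      Finset.sum_le_sum_of_subset_of_nonneg
          (Finset.range_mono (Nat.le_succ _)) fun _ _ _ => apply_nonneg _ _
    have h4 : ∑ k ∈ Finset.range (l + 1), s v ((1 + y) ^ (k + 1)) ≤
        ∑ k ∈ Finset.range (l + 1 + 1), s v ((1 + y) ^ k) := by
      rw [Finset.sum_range_succ' _ (l + 1)]
      exact le_add_of_nonneg_right (apply_nonneg _ _)
    nlinarith

end Estimates

/-! ### The topology of smooth vectors when the Casimir element is bounded -/

namespace HilbertRep

variable {m n : ℕ} {G : Type*} [Group G] [TopologicalSpace G]
  [ChartedSpace (EuclideanSpace ℝ (Fin m)) G] [LieGroup (𝓡 m) ∞ G]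
  {H : Type*} [NormedAddCommGroup H] [InnerProductSpace ℂ H]
  (ρ : HilbertRep G H)

/-- For a smooth vector `v`, the seminorm `x ↦ ‖x v‖` on the enveloping algebra. -/
noncomputable def orbitSeminorm (v : ρ.smoothVectors m) : Seminorm ℝ (Env m G) :=
  (normSeminorm ℝ H).comp
    ({toFun := fun x => (ρ.envAction m x v : H)
      map_add' := fun x y => by rw [map_add]; rfl
      map_smul' := fun r x => by
        rw [map_smul, LinearMap.smul_apply]
        simp } : Env m G →ₗ[ℝ] H)

theorem orbitSeminorm_apply (v : ρ.smoothVectors m) (x : Env m G) :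
    ρ.orbitSeminorm v x = ‖(ρ.envAction m x v : H)‖ := rfl

theorem orbitSeminorm_envAction (v : ρ.smoothVectors m) (x y : Env m G) :
    ρ.orbitSeminorm (ρ.envAction m y v) x = ρ.orbitSeminorm v (x * y) := by
  rw [orbitSeminorm_apply, orbitSeminorm_apply, map_mul]
  rfl

/-- If the Casimir element acts by a bounded operator on the smooth vectors, then the topology of
the space of smooth vectors is given by the powers of `1 + C_K`. -/
theorem withSeminorms_casimirSeminorm [IsTopologicalGroup G] [T2Space G] [CompleteSpace H]
    {p : G →* GL (Fin n) ℝ} (hp : IsRealReductive m p) {M : ℝ}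
    (hM : ∀ v : ρ.smoothVectors m,
      ‖(ρ.envAction m (casimir m p) v : H)‖ ≤ M * ‖(v : H)‖) :
    WithSeminorms (ρ.casimirSeminorm m p) (topology := ρ.smoothTopology m) := by
  obtain ⟨r, b, hb, hΔ⟩ := exists_casimir_sub_eq_sum_sq hp
  have hmul : ∀ (v : ρ.smoothVectors m) (y : Env m G),
      ∃ v', ∀ x, ρ.orbitSeminorm v' x = ρ.orbitSeminorm v (x * y) :=
    fun v y => ⟨_, fun x => ρ.orbitSeminorm_envAction v x y⟩
  have hint : ∀ ε : ℝ, 0 < ε → ∃ C, 0 ≤ C ∧ ∀ (v : ρ.smoothVectors m) (i : Fin r) (y : Env m G),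
      ρ.orbitSeminorm v (UniversalEnvelopingAlgebra.ι ℝ (b i) * y) ≤
        ε * ρ.orbitSeminorm v (envLaplacian b * y) + C * ρ.orbitSeminorm v y := by
    intro ε hε
    obtain ⟨C, hC, h⟩ := ρ.exists_norm_deriv_le b hε
    refine ⟨C, hC, fun v i y => ?_⟩
    rw [← orbitSeminorm_envAction, ← orbitSeminorm_envAction, orbitSeminorm_apply,
      orbitSeminorm_apply, orbitSeminorm_apply, envAction_ι]
    refine h (ρ.envAction m y v) _ ?_ i
    rw [envLaplacian, map_sum, LinearMap.sum_apply]
    refine Finset.sum_congr rfl fun j _ => ?_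
    rw [map_mul, envAction_ι]
    rfl
  have hz : Commute (casimir m p) (1 + casimirK m p) :=
    ((Subalgebra.mem_center_iff.1 (casimir_mem_center hp) _)).symm
  have hb' : ∀ (v : ρ.smoothVectors m) (x : Env m G),
      ρ.orbitSeminorm v (casimir m p * x) ≤ |M| * ρ.orbitSeminorm v x := by
    intro v x
    rw [← orbitSeminorm_envAction, orbitSeminorm_apply, orbitSeminorm_apply]
    exact (hM _).trans (mul_le_mul_of_nonneg_right (le_abs_self M) (norm_nonneg _))
  have hbound : ∀ x : Env m G, ∃ C k, 0 ≤ C ∧ ∀ v : ρ.smoothVectors m,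
      ρ.orbitSeminorm v x ≤ C * ∑ l ∈ Finset.range k, ρ.orbitSeminorm v ((1 + casimirK m p) ^ l) := by
    intro x
    obtain ⟨C, k, hC, h⟩ := exists_le_sum_laplacian_pow hb hint hmul x
    choose D hD h' using fun l => exists_pow_le_sum_pow hΔ hz (abs_nonneg M) hb' hmul l
    refine ⟨C * ∑ l ∈ Finset.range k, D l, k,
      mul_nonneg hC (Finset.sum_nonneg fun l _ => hD l), fun v => (h v).trans ?_⟩
    rw [mul_assoc, Finset.sum_mul]
    refine mul_le_mul_of_nonneg_left (Finset.sum_le_sum fun l hl => (h' l v).trans ?_) hC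
    refine mul_le_mul_of_nonneg_left ?_ (hD l)
    exact Finset.sum_le_sum_of_subset_of_nonneg
      (Finset.range_mono (Finset.mem_range.1 hl)) fun _ _ _ => apply_nonneg _ _
  -- The topology is by definition the one of all enveloping seminorms, so it remains to compare two
  -- families of seminorms, each bounded by the other.
  have hall : @WithSeminorms ℂ (ρ.smoothVectors m) (Env m G) _ _ _
      (fun x : Env m G => ρ.envSeminorm m x) (ρ.smoothTopology m) :=
    @WithSeminorms.mk _ _ _ _ _ _ _ (ρ.smoothTopology m) rfl
  let _ := ρ.smoothTopology m
  refine hall.congr (q := ρ.casimirSeminorm m p) ?_ ?_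
  · intro l
    refine ⟨{(1 + casimirK m p) ^ l}, 1, ?_⟩
    rw [Finset.sup_singleton, one_smul]
    exact le_rfl
  · refine Seminorm.IsBounded.of_real fun x => ?_
    obtain ⟨C, k, hC, h⟩ := hbound x
    refine ⟨Finset.range k, C * k, fun v => (h v).trans ?_⟩
    rw [mul_assoc]
    refine mul_le_mul_of_nonneg_left ?_ hC
    calc ∑ l ∈ Finset.range k, ρ.orbitSeminorm v ((1 + casimirK m p) ^ l)
        ≤ ∑ l ∈ Finset.range k, (Finset.range k).sup (ρ.casimirSeminorm m p) v :=
          Finset.sum_le_sum fun l hl =>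
            Seminorm.le_finset_sup_apply (p := ρ.casimirSeminorm m p) hl
      _ = _ := by rw [Finset.sum_const, Finset.card_range, nsmul_eq_mul]

end HilbertRep

end RealReductive

namespace RealReductive

/-! ### Separation and countability inherited from the linear group -/

section Topology

/-- A covering space with countable fibers of a second countable space is second countable. -/
theorem secondCountableTopology_of_isCoveringMap {E X : Type*} [TopologicalSpace E]
    [TopologicalSpace X] [SecondCountableTopology X] {f : E → X} (hf : IsCoveringMap f)
    (hc : ∀ x, Countable (f ⁻¹' {x})) : SecondCountableTopology E := by
  choose hdisc U hxU hUo hfU H hH using hf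
  obtain ⟨S, hS, hcov⟩ := TopologicalSpace.countable_cover_nhds fun x => (hUo x).mem_nhds (hxU x)
  have := hS.to_subtype
  have h2 : ∀ x : S, SecondCountableTopology (f ⁻¹' U x) := fun x => by
    have := hdisc x
    have := hc x
    exact (H x).isEmbedding.secondCountableTopology
  refine TopologicalSpace.secondCountableTopology_of_countable_cover (ι := S)
    (U := fun x => f ⁻¹' U x) (fun x => hfU x) ?_
  rw [← Set.preimage_iUnion, ← Set.biUnion_eq_iUnion S fun x _ => U x, hcov, Set.preimage_univ]

variable {m n : ℕ} {G : Type*} [Group G] [TopologicalSpace G]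
  [ChartedSpace (EuclideanSpace ℝ (Fin m)) G] {p : G →* GL (Fin n) ℝ}

/-- Points in one fiber are separated because covering maps are separated maps; points in different
fibers are separated by open sets of the base. -/
theorem IsRealReductive.t2Space (hp : IsRealReductive m p) : T2Space G := by
  have hc : Continuous p.rangeRestrict := hp.isCoveringMap.continuous
  refine (t2Space_iff G).2 fun x y hxy => ?_
  by_cases h : p.rangeRestrict x = p.rangeRestrict y
  · exact hp.isCoveringMap.isSeparatedMap x y h hxy
  · obtain ⟨u, v, hu, hv, hxu, hyv, huv⟩ := t2_separation h
    exact ⟨_, _, hu.preimage hc, hv.preimage hc, hxu, hyv, huv.preimage _⟩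

theorem IsRealReductive.secondCountableTopology (hp : IsRealReductive m p) :
    SecondCountableTopology G := by
  have h1 : SecondCountableTopology (Matrix (Fin n) (Fin n) ℝ) :=
    inferInstanceAs (SecondCountableTopology (Fin n → Fin n → ℝ))
  have h2 : SecondCountableTopology (Matrix (Fin n) (Fin n) ℝ)ᵐᵒᵖ :=
    MulOpposite.opHomeomorph.symm.isEmbedding.secondCountableTopology
  have h3 : SecondCountableTopology (GL (Fin n) ℝ) :=
    Units.isEmbedding_embedProduct.secondCountableTopology
  have h4 : SecondCountableTopology p.range :=
    Topology.IsEmbedding.subtypeVal.secondCountableTopology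
  refine secondCountableTopology_of_isCoveringMap hp.isCoveringMap fun x => ?_
  have := hp.finite_ker
  obtain ⟨g, rfl⟩ := p.rangeRestrict_surjective x
  -- A fiber is a coset of the finite kernel.
  refine Function.Injective.countable (β := p.ker)
    (f := fun h => ⟨g⁻¹ * h, ?_⟩) fun h h' e => ?_
  · have h5 : p h = p g := congrArg Subtype.val h.2
    rw [MonoidHom.mem_ker, map_mul, map_inv, h5, inv_mul_cancel]
  · exact Subtype.ext (mul_left_cancel (congrArg Subtype.val e))

end Topology

/-! ### Growth of the group norm -/

section GroupNorm

variable {n : ℕ} {G : Type*} [Group G] (p : G →* GL (Fin n) ℝ)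

theorem groupNorm_eq (g : G) : groupNorm p g =
    Real.sqrt (∑ i, ∑ j, (p g : Matrix (Fin n) (Fin n) ℝ) i j ^ 2 +
      ∑ i, ∑ j, (p g⁻¹ : Matrix (Fin n) (Fin n) ℝ) i j ^ 2) := by
  rw [groupNorm, trace_mul_transpose]
  simp only [Fintype.sum_sum_type, Matrix.fromBlocks_apply₁₁, Matrix.fromBlocks_apply₁₂,
    Matrix.fromBlocks_apply₂₁, Matrix.fromBlocks_apply₂₂, Matrix.zero_apply, mul_zero,
    Finset.sum_const_zero, add_zero, zero_add, Matrix.transpose_apply, sq]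
  rw [Finset.sum_comm (f := fun i j => (p g⁻¹ : Matrix (Fin n) (Fin n) ℝ) j i *
    (p g⁻¹ : Matrix (Fin n) (Fin n) ℝ) j i)]

theorem groupNorm_inv (g : G) : groupNorm p g⁻¹ = groupNorm p g := by
  rw [groupNorm_eq, groupNorm_eq, inv_inv, add_comm]

theorem groupNorm_pos (hn : n ≠ 0) (g : G) : 0 < groupNorm p g := by
  rw [groupNorm_eq]
  refine Real.sqrt_pos.2 (add_pos_of_pos_of_nonneg ?_ (by positivity))
  by_contra hneg
  have h0 : ∑ i, ∑ j, (p g : Matrix (Fin n) (Fin n) ℝ) i j ^ 2 = 0 :=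
    le_antisymm (not_lt.1 hneg) (by positivity)
  have hz : (p g : Matrix (Fin n) (Fin n) ℝ) = 0 := by
    ext i j
    have h1 := (Finset.sum_eq_zero_iff_of_nonneg fun i _ => by positivity).1 h0 i (Finset.mem_univ i)
    have h2 := (Finset.sum_eq_zero_iff_of_nonneg fun j _ => by positivity).1 h1 j (Finset.mem_univ j)
    exact pow_eq_zero_iff (two_ne_zero) |>.1 h2
  have : Nonempty (Fin n) := ⟨⟨0, Nat.pos_of_ne_zero hn⟩⟩
  exact (p g).ne_zero hz

attribute [local instance] Matrix.frobeniusNormedAddCommGroup in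
theorem groupNorm_mul_le (g h : G) : groupNorm p (g * h) ≤ groupNorm p g * groupNorm p h := by
  let r : G → Matrix (Fin n ⊕ Fin n) (Fin n ⊕ Fin n) ℝ := fun g =>
    Matrix.fromBlocks (p g : Matrix (Fin n) (Fin n) ℝ) 0 0 (p g⁻¹ : Matrix (Fin n) (Fin n) ℝ)ᵀ
  have hr : ∀ g, groupNorm p g = ‖r g‖ := by
    intro g
    rw [Matrix.frobenius_norm_def, ← Real.sqrt_eq_rpow, groupNorm_eq]
    simp [r, Fintype.sum_sum_type]
    rw [Finset.sum_comm (f := fun i j => (p g : Matrix (Fin n) (Fin n) ℝ)⁻¹ i j ^ 2)]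
  have hm : r (g * h) = r g * r h := by
    simp only [r, Matrix.fromBlocks_multiply, map_mul, mul_inv_rev, Units.val_mul,
      Matrix.transpose_mul, Matrix.mul_zero, Matrix.zero_mul, add_zero, zero_add]
  rw [hr, hr, hr, hm]
  exact Matrix.frobenius_norm_mul _ _

/-- For a ≥ 0 this is submultiplicativity. For a ≤ 0 it follows from ‖g‖ ≤ ‖gh‖‖h⁻¹‖ and ‖h⁻¹‖ =
‖h‖. It gives the moderate variation of the weight for exponents of either sign. -/
theorem groupNorm_rpow_mul_le (hn : n ≠ 0) (a : ℝ) (g h : G) :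
    groupNorm p (g * h) ^ a ≤ groupNorm p h ^ |a| * groupNorm p g ^ a := by
  have hg := groupNorm_pos p hn g
  have hh := groupNorm_pos p hn h
  have hgh := groupNorm_pos p hn (g * h)
  rcases le_total 0 a with ha | ha
  · rw [abs_of_nonneg ha, ← Real.mul_rpow hh.le hg.le]
    refine Real.rpow_le_rpow hgh.le ?_ ha
    rw [mul_comm]
    exact groupNorm_mul_le p g h
  · rw [abs_of_nonpos ha, Real.rpow_neg hh.le, ← Real.inv_rpow hh.le,
      ← Real.mul_rpow (inv_nonneg.2 hh.le) hg.le]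
    refine Real.rpow_le_rpow_of_nonpos (by positivity) ?_ ha
    rw [inv_mul_le_iff₀ hh]
    have h1 := groupNorm_mul_le p (g * h) h⁻¹
    rw [mul_inv_cancel_right, groupNorm_inv] at h1
    linarith

variable {m : ℕ} [TopologicalSpace G] [ChartedSpace (EuclideanSpace ℝ (Fin m)) G]

variable {p} in
theorem continuous_groupNorm [ContinuousInv G] (hp : IsRealReductive m p) :
    Continuous (groupNorm p) := by
  have h1 : ∀ i j, Continuous fun g => (p g : Matrix (Fin n) (Fin n) ℝ) i j :=
    fun i j => (hp.contMDiff i j).continuous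
  have h2 : ∀ i j, Continuous fun g => (p g⁻¹ : Matrix (Fin n) (Fin n) ℝ) i j :=
    fun i j => (h1 i j).comp continuous_inv
  have e : groupNorm p = fun g => _ := funext (groupNorm_eq p)
  rw [e]
  fun_prop

end GroupNorm

end RealReductive

namespace RealReductive

namespace HilbertRep

/-! ### Weighted matrix coefficients of the conjugate dual -/

section CoefficientVector

variable {G : Type*} [Group G] [TopologicalSpace G]
  {H : Type*} [NormedAddCommGroup H] [InnerProductSpace ℂ H] [CompleteSpace H]
  (ρ : HilbertRep G H)

theorem inner_conjDual (g : G) (v x : H) :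
    inner ℂ v (ρ.conjDual g x) = inner ℂ (ρ.toHom g⁻¹ v) x :=
  ContinuousLinearMap.adjoint_inner_right _ _ _

theorem conjDual_one : ρ.conjDual 1 = ContinuousLinearMap.id ℂ H := by
  ext x
  refine ext_inner_left ℂ fun v => ?_
  rw [inner_conjDual, inv_one, map_one]
  rfl

theorem conjDual_mul (g h : G) (x : H) :
    ρ.conjDual (g * h) x = ρ.conjDual g (ρ.conjDual h x) := by
  refine ext_inner_left ℂ fun v => ?_
  rw [inner_conjDual, inner_conjDual, inner_conjDual, mul_inv_rev, map_mul]
  rfl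

theorem norm_conjDual (g : G) : ‖ρ.conjDual g‖ = ‖ρ.toHom g⁻¹‖ :=
  LinearIsometryEquiv.norm_map _ _

variable {N : ℕ} (w : Fin N → H) (s : G → ℝ)

/-- The vector of weighted matrix coefficients `s(g) (ρ(g⁻¹)^* x, w_i)`. -/
noncomputable def coefVec (x : H) (g : G) : EuclideanSpace ℂ (Fin N) :=
  WithLp.toLp 2 fun i => (s g : ℂ) * inner ℂ (ρ.toHom g⁻¹ (w i)) x

omit [CompleteSpace H] in
theorem coefVec_apply (x : H) (g : G) (i : Fin N) :
    ρ.coefVec w s x g i = (s g : ℂ) * inner ℂ (ρ.toHom g⁻¹ (w i)) x := rfl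

omit [CompleteSpace H] in
theorem coefVec_add (x y : H) (g : G) :
    ρ.coefVec w s (x + y) g = ρ.coefVec w s x g + ρ.coefVec w s y g := by
  ext i
  simp [coefVec_apply, mul_add]

omit [CompleteSpace H] in
theorem coefVec_smul (a : ℂ) (x : H) (g : G) :
    ρ.coefVec w s (a • x) g = a • ρ.coefVec w s x g := by
  ext i
  simp [coefVec_apply]
  ring

omit [CompleteSpace H] in
theorem continuous_coefVec [ContinuousInv G] (hs : Continuous s) (x : H) :
    Continuous (ρ.coefVec w s x) := by
  refine (PiLp.continuous_toLp 2 _).comp (continuous_pi fun i => ?_)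
  exact (Complex.continuous_ofReal.comp hs).mul
    (((ρ.continuous_orbit (w i)).comp continuous_inv).inner continuous_const)

theorem sq_norm_coefVec_le (x : H) (g : G) :
    ‖ρ.coefVec w s x g‖ ^ 2 ≤ (∑ i, ‖w i‖ ^ 2) * ‖x‖ ^ 2 * (‖ρ.conjDual g‖ * s g) ^ 2 := by
  rw [EuclideanSpace.norm_sq_eq, Finset.sum_mul, Finset.sum_mul]
  refine Finset.sum_le_sum fun i _ => ?_
  rw [coefVec_apply, ← inner_conjDual, norm_mul, Complex.norm_real, mul_pow, Real.norm_eq_abs,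
    sq_abs]
  have h1 : ‖inner ℂ (w i) (ρ.conjDual g x)‖ ≤ ‖w i‖ * (‖ρ.conjDual g‖ * ‖x‖) :=
    (norm_inner_le_norm _ _).trans
      (mul_le_mul_of_nonneg_left ((ρ.conjDual g).le_opNorm x) (norm_nonneg _))
  calc s g ^ 2 * ‖inner ℂ (w i) (ρ.conjDual g x)‖ ^ 2
      ≤ s g ^ 2 * (‖w i‖ * (‖ρ.conjDual g‖ * ‖x‖)) ^ 2 := by gcongr
    _ = _ := by ring

/-- On coefficients the conjugate dual acts by right translation; the ratio of weights corrects for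
s not being invariant. -/
theorem coefVec_conjDual {s : G → ℝ} (hs : ∀ g, s g ≠ 0) (x : H) (g h : G) :
    ρ.coefVec w s (ρ.conjDual h x) g =
      ((s g / s (g * h) : ℝ) : ℂ) • ρ.coefVec w s x (g * h) := by
  ext i
  have h1 : (s (g * h) : ℂ) ≠ 0 := Complex.ofReal_ne_zero.2 (hs _)
  rw [PiLp.smul_apply, coefVec_apply, coefVec_apply, inner_conjDual, mul_inv_rev, map_mul,
    smul_eq_mul, ← mul_assoc]
  congr 1
  push_cast
  rw [div_mul_cancel₀ _ h1]

/-- The continuous extension of `ρ(g⁻¹)^*` to the target of a dense map `j`. -/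
noncomputable def conjDualExtension {H₁ : Type*} [NormedAddCommGroup H₁] [InnerProductSpace ℂ H₁]
    [CompleteSpace H₁] (j : H →ₗ[ℂ] H₁) (g : G) : H₁ →L[ℂ] H₁ :=
  (j ∘ₗ (ρ.conjDual g).toLinearMap).extendOfNorm j

end CoefficientVector

/-- The data defining the completion of `H` for the form
`∑_i ∫ (w_i, ρ(g⁻¹)^* x) (ρ(g⁻¹)^* y, w_i) s(g)² dg`, for a weight `s` of moderate variation under
right translation, integrable against the norms of the operators `ρ(g⁻¹)^*`. -/
structure IsWeightedCompletion {G : Type*} [Group G] [TopologicalSpace G] [MeasurableSpace G]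
    {H : Type*} [NormedAddCommGroup H] [InnerProductSpace ℂ H] [CompleteSpace H]
    {H₁ : Type*} [NormedAddCommGroup H₁] [InnerProductSpace ℂ H₁]
    (ρ : HilbertRep G H) (μ : Measure G) {N : ℕ} (w : Fin N → H) (s : G → ℝ)
    (j : H →ₗ[ℂ] H₁) : Prop where
  continuous_weight : Continuous s
  weight_pos : ∀ g, 0 < s g
  exists_weight_mul_le : ∃ c : G → ℝ, Continuous c ∧ ∀ g h, s (g * h) ≤ c h * s g
  exists_integrable : ∃ q : G → ℝ, Integrable q μ ∧ ∀ g, (‖ρ.conjDual g‖ * s g) ^ 2 ≤ q g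
  dense : DenseRange j
  inner_eq : ∀ x y, inner ℂ (j x) (j y) =
    ∑ i, ∫ g, inner ℂ (ρ.conjDual g x) (w i) * inner ℂ (w i) (ρ.conjDual g y) *
      ((s g ^ 2 : ℝ) : ℂ) ∂μ

/-! ### The completion inside L² and the extended representation -/

namespace IsWeightedCompletion

variable {G : Type*} [Group G] [TopologicalSpace G] [IsTopologicalGroup G]
  [MeasurableSpace G] [BorelSpace G]
  {H : Type*} [NormedAddCommGroup H] [InnerProductSpace ℂ H] [CompleteSpace H]
  {H₁ : Type*} [NormedAddCommGroup H₁] [InnerProductSpace ℂ H₁] [CompleteSpace H₁]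
  {ρ : HilbertRep G H} {μ : Measure G} {N : ℕ} {w : Fin N → H} {s : G → ℝ}
  {j : H →ₗ[ℂ] H₁} (hj : IsWeightedCompletion ρ μ w s j)

include hj

omit [CompleteSpace H₁] in
theorem memLp_coefVec (x : H) : MemLp (ρ.coefVec w s x) 2 μ := by
  have hm : AEStronglyMeasurable (ρ.coefVec w s x) μ :=
    (ρ.continuous_coefVec w s hj.continuous_weight x).aestronglyMeasurable
  obtain ⟨q, hq, hle⟩ := hj.exists_integrable
  rw [memLp_two_iff_integrable_sq_norm hm]
  refine (hq.const_mul ((∑ i, ‖w i‖ ^ 2) * ‖x‖ ^ 2)).mono' (hm.norm.pow 2)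
    (Filter.Eventually.of_forall fun g => ?_)
  rw [Real.norm_of_nonneg (by positivity)]
  exact (ρ.sq_norm_coefVec_le w s x g).trans
    (mul_le_mul_of_nonneg_left (hle g) (by positivity))

/-- The map from `H` to square integrable functions given by matrix coefficients. -/
noncomputable def coefMap : H →ₗ[ℂ] Lp (EuclideanSpace ℂ (Fin N)) 2 μ where
  toFun x := (hj.memLp_coefVec x).toLp _
  map_add' x y := by
    rw [← MemLp.toLp_add]
    exact MemLp.toLp_congr _ _ (Filter.Eventually.of_forall fun g => ρ.coefVec_add w s x y g)
  map_smul' a x := by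
    rw [RingHom.id_apply, ← MemLp.toLp_const_smul]
    exact MemLp.toLp_congr _ _ (Filter.Eventually.of_forall fun g => ρ.coefVec_smul w s a x g)

omit [CompleteSpace H₁] in
theorem coeFn_coefMap (x : H) : hj.coefMap x =ᵐ[μ] ρ.coefVec w s x :=
  MemLp.coeFn_toLp (hj.memLp_coefVec x)

omit [CompleteSpace H₁] in
theorem inner_coefMap (x y : H) : inner ℂ (hj.coefMap x) (hj.coefMap y) = inner ℂ (j x) (j y) := by
  rw [L2.inner_def, hj.inner_eq]
  have h1 : ∫ g, inner ℂ (hj.coefMap x g) (hj.coefMap y g) ∂μ =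
      ∫ g, ∑ i, inner ℂ (ρ.coefVec w s x g i) (ρ.coefVec w s y g i) ∂μ := by
    refine integral_congr_ae ?_
    filter_upwards [hj.coeFn_coefMap x, hj.coeFn_coefMap y] with g hx hy
    rw [hx, hy, PiLp.inner_apply]
  have hm : ∀ x i, MemLp (fun g => ρ.coefVec w s x g i) 2 μ := fun x i =>
    (hj.memLp_coefVec x).continuousLinearMap_comp
      (EuclideanSpace.proj i : EuclideanSpace ℂ (Fin N) →L[ℂ] ℂ)
  rw [h1, integral_finsetSum _ fun i _ =>
    ((hm y i).integrable_mul (hm x i).star).congr (Filter.Eventually.of_forall fun g =>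
      (RCLike.inner_apply _ _).symm)]
  refine Finset.sum_congr rfl fun i _ => integral_congr_ae (Filter.Eventually.of_forall fun g => ?_)
  simp only [coefVec_apply, RCLike.inner_apply, map_mul, Complex.conj_ofReal, ← inner_conjDual,
    inner_conj_symm]
  push_cast
  ring

omit [CompleteSpace H₁] in
theorem norm_coefMap (x : H) : ‖hj.coefMap x‖ = ‖j x‖ := by
  rw [@norm_eq_sqrt_re_inner ℂ, @norm_eq_sqrt_re_inner ℂ, inner_coefMap]

omit [CompleteSpace H₁] in
theorem sq_norm (x : H) : ‖j x‖ ^ 2 = ∫ g, ‖ρ.coefVec w s x g‖ ^ 2 ∂μ := by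
  rw [← hj.norm_coefMap, ← inner_self_eq_norm_sq (𝕜 := ℂ), L2.inner_def]
  have h1 : ∫ g, inner ℂ (hj.coefMap x g) (hj.coefMap x g) ∂μ =
      ∫ g, ((‖ρ.coefVec w s x g‖ ^ 2 : ℝ) : ℂ) ∂μ := by
    refine integral_congr_ae ?_
    filter_upwards [hj.coeFn_coefMap x] with g hx
    rw [hx, inner_self_eq_norm_sq_to_K]
    push_cast
    rfl
  rw [h1, integral_complex_ofReal]
  exact Complex.ofReal_re _

/-- The isometric extension of `coefMap` to the completion. -/
noncomputable def coefIsometry : H₁ →ₗᵢ[ℂ] Lp (EuclideanSpace ℂ (Fin N)) 2 μ where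
  toLinearMap := (hj.coefMap.extendOfNorm j).toLinearMap
  norm_map' := by
    have h1 : ∀ x, hj.coefMap.extendOfNorm j (j x) = hj.coefMap x :=
      LinearMap.extendOfNorm_eq hj.dense ⟨1, fun x => by rw [one_mul, hj.norm_coefMap]⟩
    refine hj.dense.induction ?_
      (isClosed_eq (hj.coefMap.extendOfNorm j).continuous.norm continuous_norm)
    rintro _ ⟨x, rfl⟩
    exact (congrArg norm (h1 x)).trans (hj.norm_coefMap x)

omit [CompleteSpace H₁] in
theorem coefIsometry_apply (x : H) : hj.coefIsometry (j x) = hj.coefMap x :=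
  LinearMap.extendOfNorm_eq hj.dense ⟨1, fun x => by rw [one_mul, hj.norm_coefMap]⟩ x

variable [μ.IsMulRightInvariant]

-- Moderate variation bounds the ratio s(g)/s(gh) by c(h⁻¹), and right invariance of the measure
-- removes the translation.
omit [CompleteSpace H₁] in
theorem norm_conjDual_le {c : G → ℝ} (hc : ∀ g h, s (g * h) ≤ c h * s g) (h : G) (x : H) :
    ‖j (ρ.conjDual h x)‖ ≤ c h⁻¹ * ‖j x‖ := by
  have hc0 : 0 ≤ c h⁻¹ := by
    have h1 := (hj.weight_pos (1 * h⁻¹)).trans_le (hc 1 h⁻¹)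
    exact (pos_of_mul_pos_left h1 (hj.weight_pos 1).le).le
  have hi : Integrable (fun g => ‖ρ.coefVec w s x g‖ ^ 2) μ :=
    (memLp_two_iff_integrable_sq_norm (hj.memLp_coefVec x).1).1 (hj.memLp_coefVec x)
  have hle : ∀ g, ‖ρ.coefVec w s (ρ.conjDual h x) g‖ ^ 2 ≤
      c h⁻¹ ^ 2 * ‖ρ.coefVec w s x (g * h)‖ ^ 2 := fun g => by
    have h0 : 0 ≤ s g / s (g * h) := div_nonneg (hj.weight_pos _).le (hj.weight_pos _).le
    have h2 : s g / s (g * h) ≤ c h⁻¹ := by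
      rw [div_le_iff₀ (hj.weight_pos _)]
      simpa using hc (g * h) h⁻¹
    rw [ρ.coefVec_conjDual w (fun g => (hj.weight_pos g).ne'), norm_smul, mul_pow,
      Complex.norm_real, Real.norm_of_nonneg h0]
    exact mul_le_mul_of_nonneg_right (pow_le_pow_left₀ h0 h2 2) (sq_nonneg _)
  refine le_of_sq_le_sq ?_ (mul_nonneg hc0 (norm_nonneg _))
  rw [mul_pow, hj.sq_norm, hj.sq_norm]
  calc ∫ g, ‖ρ.coefVec w s (ρ.conjDual h x) g‖ ^ 2 ∂μ
      ≤ ∫ g, c h⁻¹ ^ 2 * ‖ρ.coefVec w s x (g * h)‖ ^ 2 ∂μ :=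
        integral_mono_of_nonneg (Filter.Eventually.of_forall fun g => sq_nonneg _)
          ((hi.comp_mul_right h).const_mul _) (Filter.Eventually.of_forall hle)
    _ = c h⁻¹ ^ 2 * ∫ g, ‖ρ.coefVec w s x g‖ ^ 2 ∂μ := by
        rw [integral_const_mul, integral_mul_right_eq_self (fun g => ‖ρ.coefVec w s x g‖ ^ 2) h]

theorem extension_apply (g : G) (x : H) : ρ.conjDualExtension j g (j x) = j (ρ.conjDual g x) := by
  obtain ⟨c, -, hc⟩ := hj.exists_weight_mul_le
  exact LinearMap.extendOfNorm_eq hj.dense ⟨_, hj.norm_conjDual_le hc g⟩ x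

theorem norm_extension_le {c : G → ℝ} (hc : ∀ g h, s (g * h) ≤ c h * s g) (g : G) (v : H₁) :
    ‖ρ.conjDualExtension j g v‖ ≤ c g⁻¹ * ‖v‖ :=
  LinearMap.norm_extendOfNorm_apply_le hj.dense _ (hj.norm_conjDual_le hc g) v

theorem extension_one : ρ.conjDualExtension j 1 = 1 := by
  refine ContinuousLinearMap.ext fun v => hj.dense.induction ?_
    (isClosed_eq (ρ.conjDualExtension j 1).continuous continuous_id) v
  rintro _ ⟨x, rfl⟩
  rw [hj.extension_apply, conjDual_one]
  rfl

theorem extension_mul (g h : G) : ρ.conjDualExtension j (g * h) = ρ.conjDualExtension j g * ρ.conjDualExtension j h := by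
  refine ContinuousLinearMap.ext fun v => hj.dense.induction ?_
    (isClosed_eq (ρ.conjDualExtension j _).continuous (ρ.conjDualExtension j g * ρ.conjDualExtension j h).continuous) v
  rintro _ ⟨x, rfl⟩
  change _ = ρ.conjDualExtension j g (ρ.conjDualExtension j h (j x))
  rw [hj.extension_apply, hj.extension_apply, hj.extension_apply, conjDual_mul]

-- The coefficients converge for each g because orbits of ρ are continuous. They are dominated by a
-- multiple of q because the adjoint operators are uniformly bounded near 1, so convergence holds in
-- L².
omit [CompleteSpace H₁] [μ.IsMulRightInvariant] in
theorem tendsto_conjDual [LocallyCompactSpace G] [FirstCountableTopology G] (x : H) :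
    Filter.Tendsto (fun h => j (ρ.conjDual h x)) (𝓝 1) (𝓝 (j x)) := by
  rw [tendsto_iff_norm_sub_tendsto_zero]
  obtain ⟨q, hq, hle⟩ := hj.exists_integrable
  obtain ⟨K, hK, hK1⟩ := exists_compact_mem_nhds (1 : G)
  obtain ⟨M, hM0, hM⟩ := ρ.exists_norm_toHom_le hK.inv
  have hb : ∀ h ∈ K, ‖ρ.conjDual h x - x‖ ≤ (M + 1) * ‖x‖ := fun h hh => by
    refine (norm_sub_le _ _).trans ?_
    rw [add_mul, one_mul]
    gcongr
    refine (ContinuousLinearMap.le_opNorm _ _).trans ?_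
    gcongr
    rw [norm_conjDual]
    exact hM _ (Set.inv_mem_inv.2 hh)
  have key : Filter.Tendsto (fun h => ∫ g, ‖ρ.coefVec w s (ρ.conjDual h x - x) g‖ ^ 2 ∂μ) (𝓝 1)
      (𝓝 (∫ _, 0 ∂μ)) := by
    refine tendsto_integral_filter_of_dominated_convergence
      (fun g => (∑ i, ‖w i‖ ^ 2) * ((M + 1) * ‖x‖) ^ 2 * q g)
      (Filter.Eventually.of_forall fun h => ((hj.memLp_coefVec _).1.norm.pow 2)) ?_
      (hq.const_mul _) (Filter.Eventually.of_forall fun g => ?_)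
    · filter_upwards [hK1] with h hh
      refine Filter.Eventually.of_forall fun g => ?_
      rw [Real.norm_of_nonneg (by positivity)]
      refine (ρ.sq_norm_coefVec_le w s _ g).trans ?_
      gcongr
      · exact hb h hh
      · exact hle g
    · have h1 : Continuous fun h => ρ.coefVec w s (ρ.conjDual h x - x) g := by
        refine (PiLp.continuous_toLp 2 _).comp (continuous_pi fun i => ?_)
        have h2 : ∀ h, inner ℂ (ρ.toHom g⁻¹ (w i)) (ρ.conjDual h x - x) =
            inner ℂ (ρ.toHom h⁻¹ (ρ.toHom g⁻¹ (w i))) x - inner ℂ (ρ.toHom g⁻¹ (w i)) x :=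
          fun h => by rw [inner_sub_right, inner_conjDual]
        simp only [h2]
        exact continuous_const.mul ((((ρ.continuous_orbit _).comp continuous_inv).inner
          continuous_const).sub continuous_const)
      have h3 := ((h1.norm.pow 2).tendsto 1)
      simp only [Pi.pow_apply] at h3
      rw [conjDual_one, ContinuousLinearMap.id_apply, sub_self] at h3
      have h4 : ρ.coefVec w s 0 g = 0 := by
        have := ρ.coefVec_smul w s 0 0 g
        rwa [zero_smul, zero_smul] at this
      rwa [h4, norm_zero, zero_pow two_ne_zero] at h3
  rw [integral_zero] at key
  have h5 := key.sqrt
  rw [Real.sqrt_zero] at h5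
  refine h5.congr fun h => ?_
  rw [← hj.sq_norm, Real.sqrt_sq (norm_nonneg _), map_sub]

theorem tendsto_extension [LocallyCompactSpace G] [FirstCountableTopology G] (v : H₁) :
    Filter.Tendsto (fun h => ρ.conjDualExtension j h v) (𝓝 1) (𝓝 v) := by
  obtain ⟨c, hcc, hc⟩ := hj.exists_weight_mul_le
  -- A uniform bound for the extended operators near the identity, which carries convergence from
  -- the dense image of j to all vectors.
  have hM : ∀ᶠ h in 𝓝 (1 : G), c h⁻¹ < |c 1| + 1 := by
    have h1 : Filter.Tendsto (fun h : G => c h⁻¹) (𝓝 1) (𝓝 (c 1)) := by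
      have h0 := (hcc.comp continuous_inv).tendsto (1 : G)
      rwa [Function.comp_apply, inv_one] at h0
    exact h1.eventually_lt_const (by linarith [le_abs_self (c 1)])
  set M := |c 1| + 1 with hMdef
  have hM0 : 0 ≤ M := by positivity
  rw [Metric.tendsto_nhds]
  intro ε hε
  obtain ⟨_, hx, x, rfl⟩ := Metric.dense_iff.1 hj.dense v (ε / (2 * (M + 1))) (by positivity)
  have h2 := Metric.tendsto_nhds.1 (hj.tendsto_conjDual x) (ε / 2) (by positivity)
  filter_upwards [hM, h2] with h hh hx2
  rw [Metric.mem_ball, dist_eq_norm] at hx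
  rw [dist_eq_norm] at hx2 ⊢
  have e : ρ.conjDualExtension j h v - v =
      (j (ρ.conjDual h x) - j x) + ((j x - v) - ρ.conjDualExtension j h (j x - v)) := by
    rw [map_sub, hj.extension_apply]
    abel
  have h3 : ‖ρ.conjDualExtension j h (j x - v)‖ ≤ M * ‖j x - v‖ :=
    (hj.norm_extension_le hc h _).trans (mul_le_mul_of_nonneg_right hh.le (norm_nonneg _))
  have h4 : (M + 1) * ‖j x - v‖ < ε / 2 := by
    rw [lt_div_iff₀ (by positivity)] at hx
    linarith
  calc ‖ρ.conjDualExtension j h v - v‖ ≤ ‖j (ρ.conjDual h x) - j x‖ + (‖j x - v‖ +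
        ‖ρ.conjDualExtension j h (j x - v)‖) := by
        rw [e]
        exact (norm_add_le _ _).trans (add_le_add_right (norm_sub_le _ _) _)
    _ < ε := by linarith

/-- The Hilbert representation of `G` on the completion. -/
noncomputable def rep [LocallyCompactSpace G] [FirstCountableTopology G] : HilbertRep G H₁ where
  toHom :=
    { toFun := ρ.conjDualExtension j
      map_one' := hj.extension_one
      map_mul' := hj.extension_mul }
  continuous_orbit v := by
    refine continuous_iff_continuousAt.2 fun g₀ => ?_
    have h1 : Filter.Tendsto (fun g : G => g₀⁻¹ * g) (𝓝 g₀) (𝓝 1) := by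
      simpa using (continuous_const_mul g₀⁻¹).tendsto g₀
    have h2 := ((ρ.conjDualExtension j g₀).continuous.tendsto v).comp ((hj.tendsto_extension v).comp h1)
    refine h2.congr fun g => ?_
    change ρ.conjDualExtension j g₀ (ρ.conjDualExtension j (g₀⁻¹ * g) v) = ρ.conjDualExtension j g v
    have h3 := hj.extension_mul g₀ (g₀⁻¹ * g)
    rw [mul_inv_cancel_left] at h3
    rw [h3]
    rfl

theorem rep_toHom_apply [LocallyCompactSpace G] [FirstCountableTopology G] (g : G) (x : H) :
    hj.rep.toHom g (j x) = j (ρ.conjDual g x) :=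
  hj.extension_apply g x

end IsWeightedCompletion

end HilbertRep

end RealReductive

namespace RealReductive

namespace HilbertRep

namespace IsWeightedCompletion

/-! ### Generalized coefficients tested against compactly supported functions -/

section Pairing

variable {G : Type*} [Group G] [TopologicalSpace G] [IsTopologicalGroup G]
  [MeasurableSpace G] [BorelSpace G]
  {H : Type*} [NormedAddCommGroup H] [InnerProductSpace ℂ H] [CompleteSpace H]
  {H₁ : Type*} [NormedAddCommGroup H₁] [InnerProductSpace ℂ H₁]
  {ρ : HilbertRep G H} {μ : Measure G} {N : ℕ} {w : Fin N → H} {s : G → ℝ}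
  {j : H →ₗ[ℂ] H₁} (hj : IsWeightedCompletion ρ μ w s j)

/-- The generalized matrix coefficient of a vector of the completion against `w_i`. -/
noncomputable def coefFun (v : H₁) (i : Fin N) (g : G) : ℂ :=
  hj.coefIsometry v g i * (((s g)⁻¹ : ℝ) : ℂ)

theorem memLp_coefIsometry_apply (v : H₁) (i : Fin N) :
    MemLp (fun g => hj.coefIsometry v g i) 2 μ :=
  (Lp.memLp (hj.coefIsometry v)).continuousLinearMap_comp
    (EuclideanSpace.proj i : EuclideanSpace ℂ (Fin N) →L[ℂ] ℂ)

omit [IsTopologicalGroup G] [BorelSpace G] in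
include hj in
theorem continuous_inv_weight : Continuous fun g => (((s g)⁻¹ : ℝ) : ℂ) :=
  Complex.continuous_ofReal.comp (hj.continuous_weight.inv₀ fun g => (hj.weight_pos g).ne')

theorem aestronglyMeasurable_coefFun (v : H₁) (i : Fin N) :
    AEStronglyMeasurable (hj.coefFun v i) μ :=
  (hj.memLp_coefIsometry_apply v i).1.mul hj.continuous_inv_weight.aestronglyMeasurable

theorem coefFun_ae_eq (x : H) (i : Fin N) :
    hj.coefFun (j x) i =ᵐ[μ] fun g => inner ℂ (ρ.toHom g⁻¹ (w i)) x := by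
  have h1 := hj.coeFn_coefMap x
  rw [← coefIsometry_apply] at h1
  filter_upwards [h1] with g hg
  have h2 : (s g : ℂ) ≠ 0 := Complex.ofReal_ne_zero.2 (hj.weight_pos g).ne'
  rw [coefFun, hg, coefVec_apply, Complex.ofReal_inv]
  field_simp

variable [IsFiniteMeasureOnCompacts μ]

theorem locallyIntegrable_coefFun [LocallyCompactSpace G] [T2Space G] (v : H₁) (i : Fin N) :
    LocallyIntegrable (hj.coefFun v i) μ :=
  ((hj.memLp_coefIsometry_apply v i).locallyIntegrable (by norm_num)).mul_continuous
    hj.continuous_inv_weight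

omit [IsTopologicalGroup G] in
include hj in
theorem memLp_single {φ : G → ℂ} (hφ : Continuous φ) (hc : HasCompactSupport φ) (i : Fin N) :
    MemLp (fun g => EuclideanSpace.single i (starRingEnd ℂ (φ g) * (((s g)⁻¹ : ℝ) : ℂ))) 2 μ := by
  refine Continuous.memLp_of_hasCompactSupport ?_ ?_
  · have h1 : Continuous fun a : ℂ => EuclideanSpace.single i a :=
      (PiLp.continuous_toLp 2 _).comp (continuous_single (A := fun _ : Fin N => ℂ) i)
    exact h1.comp ((Complex.continuous_conj.comp hφ).mul hj.continuous_inv_weight)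
  · refine hc.mono fun g hg h0 => hg ?_
    simp only [h0, map_zero, zero_mul]
    exact (PiLp.single_eq_zero_iff 2 i).2 rfl

/-- Integration of generalized matrix coefficients against a test function. -/
noncomputable def pairing {φ : G → ℂ} (hφ : Continuous φ) (hc : HasCompactSupport φ)
    (i : Fin N) : H₁ →L[ℂ] ℂ :=
  (innerSL ℂ ((hj.memLp_single hφ hc i).toLp _)).comp
    hj.coefIsometry.toContinuousLinearMap

theorem pairing_apply {φ : G → ℂ} (hφ : Continuous φ) (hc : HasCompactSupport φ)
    (i : Fin N) (v : H₁) : hj.pairing hφ hc i v = ∫ g, φ g * hj.coefFun v i g ∂μ := by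
  change inner ℂ ((hj.memLp_single hφ hc i).toLp _) (hj.coefIsometry v) = _
  rw [L2.inner_def]
  refine integral_congr_ae ?_
  filter_upwards [(hj.memLp_single hφ hc i).coeFn_toLp] with g hg
  rw [hg, EuclideanSpace.inner_single_left, map_mul, Complex.conj_conj, Complex.conj_ofReal,
    coefFun]
  ring

theorem pairing_apply_coe {φ : G → ℂ} (hφ : Continuous φ) (hc : HasCompactSupport φ)
    (i : Fin N) (x : H) :
    hj.pairing hφ hc i (j x) = ∫ g, φ g * inner ℂ (ρ.toHom g⁻¹ (w i)) x ∂μ := by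
  rw [pairing_apply]
  refine integral_congr_ae ?_
  filter_upwards [hj.coefFun_ae_eq x i] with g hg
  rw [hg]

theorem pairing_toHom [μ.IsMulRightInvariant] {ρ₁ : HilbertRep G H₁}
    (hρ₁ : ∀ g x, ρ₁.toHom g (j x) = j (ρ.conjDual g x)) {φ : G → ℂ} (hφ : Continuous φ)
    (hc : HasCompactSupport φ) (i : Fin N) (h : G) (v : H₁) :
    hj.pairing hφ hc i (ρ₁.toHom h⁻¹ v) = ∫ g, φ (g * h) * hj.coefFun v i g ∂μ := by
  have hφh : Continuous fun g => φ (g * h) := hφ.comp (continuous_mul_const h)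
  have hch : HasCompactSupport fun g => φ (g * h) :=
    hc.comp_homeomorph (Homeomorph.mulRight h)
  rw [← hj.pairing_apply hφh hch]
  refine hj.dense.induction ?_ (isClosed_eq
    ((hj.pairing hφ hc i).continuous.comp (ρ₁.toHom h⁻¹).continuous)
    (hj.pairing hφh hch i).continuous) v
  rintro _ ⟨x, rfl⟩
  rw [hρ₁, pairing_apply_coe, pairing_apply_coe,
    ← integral_mul_right_eq_self (fun g => φ g * _) h]
  refine integral_congr_ae (Filter.Eventually.of_forall fun g => ?_)
  simp only
  rw [inner_conjDual, mul_inv_rev, map_mul, inv_inv]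
  congr 2
  have h1 := ρ.toHom_inv_toHom h⁻¹ (ρ.toHom g⁻¹ (w i))
  rwa [inv_inv] at h1

end Pairing

/-! ### Boundedness of the Casimir element on the completion -/

section Casimir

variable {m n : ℕ} {G : Type*} [Group G] [TopologicalSpace G]
  [ChartedSpace (EuclideanSpace ℝ (Fin m)) G] [LieGroup (𝓡 m) ∞ G]
  [IsTopologicalGroup G] [T2Space G] [LocallyCompactSpace G]
  [MeasurableSpace G] [BorelSpace G]
  {H : Type*} [NormedAddCommGroup H] [InnerProductSpace ℂ H] [CompleteSpace H]
  {H₁ : Type*} [NormedAddCommGroup H₁] [InnerProductSpace ℂ H₁]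
  {ρ : HilbertRep G H} {μ : Measure G} [IsFiniteMeasureOnCompacts μ] [μ.IsMulRightInvariant]
  {N : ℕ} {s : G → ℝ} {j : H →ₗ[ℂ] H₁}
  {ρ₁ : HilbertRep G H₁} (hρ₁ : ∀ g x, ρ₁.toHom g (j x) = j (ρ.conjDual g x))

include hρ₁

/-- Coefficients of a vector of H₁ are only locally integrable, so the derivative is put on φ:
differentiate the pairing with ρ₁(γ(t)⁻¹)v at t = 0, once through the orbit of v and once under the
integral. -/
theorem pairing_deriv {w : Fin N → H} (hj : IsWeightedCompletion ρ μ w s j)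
    (X : GroupLieAlgebra (𝓡 m) G) {φ : G → ℂ} (hφ : ContMDiff (𝓡 m) 𝓘(ℝ, ℂ) ∞ φ)
    (hc : HasCompactSupport φ) (i : Fin N) (v : ρ₁.smoothVectors m) :
    hj.pairing hφ.continuous hc i (ρ₁.deriv X v : H₁) =
      -hj.pairing (contMDiff_leftDeriv hφ X).continuous (hasCompactSupport_leftDeriv hφ hc X) i
        (v : H₁) := by
  obtain ⟨γ, δ, h⟩ := exists_isFlowCurve X
  set T : H₁ →L[ℝ] ℂ := (hj.pairing hφ.continuous hc i).restrictScalars ℝ with hT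
  have hv : ContMDiff (𝓡 m) 𝓘(ℝ, H₁) ∞ fun g => ρ₁.toHom g (v : H₁) := v.2
  have hf : ContMDiff (𝓡 m) 𝓘(ℝ, ℂ) ∞ fun g => T (ρ₁.toHom g (v : H₁)) :=
    T.contMDiff.comp hv
  have hfi : ContMDiff (𝓡 m) 𝓘(ℝ, ℂ) ∞ fun g => T (ρ₁.toHom g⁻¹ (v : H₁)) :=
    T.contMDiff.comp (ρ₁.contMDiff_inv_orbit v)
  have h1 := h.hasDerivAt_integral (μ := μ) hφ hc (hj.aestronglyMeasurable_coefFun (v : H₁) i)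
    (hj.locallyIntegrable_coefFun (v : H₁) i)
  have h2 := h.hasDerivAt_zero hfi 1
  have e : (fun t => T (ρ₁.toHom (1 * γ t)⁻¹ (v : H₁))) =
      fun t => ∫ g, φ (g * γ t) * hj.coefFun (v : H₁) i g ∂μ := funext fun t => by
    rw [one_mul]
    exact hj.pairing_toHom hρ₁ hφ.continuous hc i (γ t) v
  rw [e] at h2
  have h3 := h1.unique h2
  rw [pairing_apply _ (contMDiff_leftDeriv hφ X).continuous, h3, leftDeriv_apply hfi]
  simp only [one_mul]
  rw [derivOne_comp_inv hf, neg_neg]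
  have h4 : derivOne X (fun g => T (ρ₁.toHom g (v : H₁))) =
      leftDeriv X (fun g => T (ρ₁.toHom g (v : H₁))) 1 := by
    rw [leftDeriv_apply hf]
    simp only [one_mul]
  rw [h4, leftDeriv_clm_comp T hv X, leftDeriv_orbit]
  simp only [map_one]
  rfl

variable {p : G →* GL (Fin n) ℝ} {w : Fin N → ρ.smoothVectors m}
  (hj : IsWeightedCompletion ρ μ (fun i => (w i : H)) s j)

theorem pairing_casimir (hp : IsRealReductive m p) {A : Fin N → Fin N → ℂ}
    (hA : ∀ i, ρ.envAction m (casimir m p) (w i) = ∑ k, A i k • w k)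
    {φ : G → ℂ} (hφ : ContMDiff (𝓡 m) 𝓘(ℝ, ℂ) ∞ φ) (hc : HasCompactSupport φ) (i : Fin N)
    (v : ρ₁.smoothVectors m) :
    hj.pairing hφ.continuous hc i (ρ₁.envAction m (casimir m p) v : H₁) =
      ∑ k, starRingEnd ℂ (A i k) * hj.pairing hφ.continuous hc k (v : H₁) := by
  obtain ⟨r, t, a, c, -, hb⟩ := exists_cartan_dualPair hp
  set b := Sum.elim a c
  set b' := Sum.elim (-a) c
  have h1 : ∀ l, ContMDiff (𝓡 m) 𝓘(ℝ, ℂ) ∞ (leftDeriv (b l) φ) := fun l =>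
    contMDiff_leftDeriv hφ _
  have c1 : ∀ l, HasCompactSupport (leftDeriv (b l) φ) := fun l =>
    hasCompactSupport_leftDeriv hφ hc _
  have h2 : ∀ l, ContMDiff (𝓡 m) 𝓘(ℝ, ℂ) ∞ (leftDeriv (b' l) (leftDeriv (b l) φ)) := fun l =>
    contMDiff_leftDeriv (h1 l) _
  have c2 : ∀ l, HasCompactSupport (leftDeriv (b' l) (leftDeriv (b l) φ)) := fun l =>
    hasCompactSupport_leftDeriv (h1 l) (c1 l) _
  -- With all derivatives on φ, the identity makes sense for every u, smooth or not. It can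
  -- therefore be checked on the dense image of j, whose elements are not known to be smooth.
  have key : ∀ u : H₁, ∑ l, hj.pairing (h2 l).continuous (c2 l) i u =
      ∑ k, starRingEnd ℂ (A i k) * hj.pairing hφ.continuous hc k u := by
    intro u
    refine hj.dense.induction ?_ (isClosed_eq (by fun_prop) (by fun_prop)) u
    rintro _ ⟨x, rfl⟩
    simp only [pairing_apply_coe]
    -- The functional u ↦ inner u x is conjugate linear, hence only real linear; this is also why
    -- the conjugates of the entries of A appear.
    set T : H →L[ℝ] ℂ := (Complex.conjCLE : ℂ →L[ℝ] ℂ).comp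
      ((innerSL ℂ x).restrictScalars ℝ) with hT
    have hTa : ∀ u, T u = inner ℂ u x := fun u => inner_conj_symm _ _
    have hf0 : ContMDiff (𝓡 m) 𝓘(ℝ, H) ∞ fun g => ρ.toHom g⁻¹ (w i : H) :=
      ρ.contMDiff_inv_orbit (w i)
    have hf : ContMDiff (𝓡 m) 𝓘(ℝ, ℂ) ∞ fun g => T (ρ.toHom g⁻¹ (w i : H)) :=
      T.contMDiff.comp hf0
    have hfl : ∀ l, ContMDiff (𝓡 m) 𝓘(ℝ, ℂ) ∞
        (leftDeriv (b' l) fun g => T (ρ.toHom g⁻¹ (w i : H))) := fun l =>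
      contMDiff_leftDeriv hf _
    simp only [← hTa]
    -- For u = j x the coefficient is smooth because w i is a smooth vector, so both derivatives can
    -- be moved off φ.
    have h3 : ∀ l, ∫ g, leftDeriv (b' l) (leftDeriv (b l) φ) g * T (ρ.toHom g⁻¹ (w i : H)) ∂μ =
        ∫ g, φ g * leftDeriv (b l) (leftDeriv (b' l) fun g => T (ρ.toHom g⁻¹ (w i : H))) g ∂μ :=
      fun l => by
        rw [integral_leftDeriv_mul _ (h1 l) (c1 l) hf, integral_leftDeriv_mul _ hφ hc (hfl l),
          neg_neg]
    have hint : ∀ {f : G → ℂ}, Continuous f → Integrable (fun g => φ g * f g) μ := fun hf =>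
      (hφ.continuous.mul hf).integrable_of_hasCompactSupport hc.mul_right
    simp only [h3]
    rw [← integral_finsetSum _ fun l _ => hint (contMDiff_leftDeriv (hfl l) _).continuous]
    have hTk : ∀ k, Continuous fun g => T (ρ.toHom g⁻¹ (w k : H)) := fun k =>
      T.continuous.comp (ρ.contMDiff_inv_orbit (w k)).continuous
    simp only [← integral_const_mul]
    rw [← integral_finsetSum _ fun k _ => (hint (hTk k)).const_mul _]
    refine integral_congr_ae (Filter.Eventually.of_forall fun g => ?_)
    simp only
    rw [← Finset.mul_sum]
    have h4 : ∑ l, leftDeriv (b l) (leftDeriv (b' l) fun g => T (ρ.toHom g⁻¹ (w i : H))) g =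
        ∑ k, starRingEnd ℂ (A i k) * T (ρ.toHom g⁻¹ (w k : H)) := by
      have h5 : ∀ l, leftDeriv (b l) (leftDeriv (b' l) fun g => T (ρ.toHom g⁻¹ (w i : H))) g =
          T (leftDeriv (b l) (leftDeriv (b' l) fun g => ρ.toHom g⁻¹ (w i : H)) g) := fun l => by
        rw [leftDeriv_clm_comp T hf0, leftDeriv_clm_comp T (contMDiff_leftDeriv hf0 _)]
      simp only [h5]
      rw [← map_sum, ρ.sum_leftDeriv_inv_orbit hp hb, hA]
      simp only [Submodule.coe_sum, Submodule.coe_smul, map_sum, map_smul, hTa]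
      rw [sum_inner]
      exact Finset.sum_congr rfl fun k _ => inner_smul_left _ _ _
    rw [h4, Finset.mul_sum]
    exact Finset.sum_congr rfl fun k _ => by ring
  rw [ρ₁.envAction_casimir hb, ← key, Submodule.coe_sum, map_sum]
  refine Finset.sum_congr rfl fun l _ => ?_
  rw [hj.pairing_deriv hρ₁ _ hφ hc, hj.pairing_deriv hρ₁ _ (h1 l) (c1 l), neg_neg]

/-- The weak equation of `pairing_casimir` becomes pointwise almost everywhere, since a locally
integrable function annihilated by all smooth compactly supported functions vanishes almost
everywhere. -/
theorem coefFun_casimir_ae_eq [SigmaCompactSpace G] (hp : IsRealReductive m p)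
    {A : Fin N → Fin N → ℂ}
    (hA : ∀ i, ρ.envAction m (casimir m p) (w i) = ∑ k, A i k • w k) (i : Fin N)
    (v : ρ₁.smoothVectors m) :
    hj.coefFun (ρ₁.envAction m (casimir m p) v : H₁) i =ᵐ[μ]
      fun g => ∑ k, starRingEnd ℂ (A i k) * hj.coefFun (v : H₁) k g := by
  have hloc := hj.locallyIntegrable_coefFun (ρ₁.envAction m (casimir m p) v : H₁) i
  have hloc' : ∀ k, LocallyIntegrable (fun g => starRingEnd ℂ (A i k) * hj.coefFun (v : H₁) k g) μ :=
    fun k => (hj.locallyIntegrable_coefFun (v : H₁) k).smul (starRingEnd ℂ (A i k))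
  have hsum : LocallyIntegrable
      (fun g => ∑ k, starRingEnd ℂ (A i k) * hj.coefFun (v : H₁) k g) μ :=
    locallyIntegrable_finsetSum _ fun k _ => hloc' k
  have h0 := ae_eq_zero_of_integral_contMDiff_smul_eq_zero (𝓡 m) (hloc.sub hsum) ?_
  · filter_upwards [h0] with g hg
    exact sub_eq_zero.1 hg
  intro ψ hψ hψc
  set φ : G → ℂ := fun g => (ψ g : ℂ) with hφd
  have hφ : ContMDiff (𝓡 m) 𝓘(ℝ, ℂ) ∞ φ := Complex.ofRealCLM.contMDiff.comp hψ
  have hc : HasCompactSupport φ := hψc.comp_left Complex.ofReal_zero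
  have hint : ∀ k, Integrable (fun g => φ g * hj.coefFun (v : H₁) k g) μ := fun k =>
    integrable_mul_of_hasCompactSupport hφ.continuous hc
      (hj.aestronglyMeasurable_coefFun (v : H₁) k) (hj.locallyIntegrable_coefFun (v : H₁) k)
  have hintC := integrable_mul_of_hasCompactSupport hφ.continuous hc
    (hj.aestronglyMeasurable_coefFun _ i) hloc
  have e := hj.pairing_casimir hρ₁ hp hA hφ hc i v
  simp only [pairing_apply, ← integral_const_mul] at e
  rw [← integral_finsetSum _ fun k _ => (hint k).const_mul _, ← sub_eq_zero,
    ← integral_sub hintC (integrable_finsetSum _ fun k _ => (hint k).const_mul _)] at e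
  rw [← e]
  refine integral_congr_ae (Filter.Eventually.of_forall fun g => ?_)
  simp only [Pi.sub_apply, Complex.real_smul, hφd, mul_sub, Finset.mul_sum]
  congr 1
  exact Finset.sum_congr rfl fun k _ => by ring

include hj in
/-- The Casimir element acts on the smooth vectors of the completion by an operator that is
bounded for the norm of the completion. -/
theorem exists_norm_casimir_le [SigmaCompactSpace G] (hp : IsRealReductive m p)
    (hw : ∀ i, ρ.envAction m (casimir m p) (w i) ∈ Submodule.span ℂ (Set.range w)) :
    ∃ M : ℝ, ∀ v : ρ₁.smoothVectors m,
      ‖(ρ₁.envAction m (casimir m p) v : H₁)‖ ≤ M * ‖(v : H₁)‖ := by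
  choose A hA using fun i => (Submodule.mem_span_range_iff_exists_fun ℂ).1 (hw i)
  -- The constant matrix by which C acts on the coefficient vector at almost every g; its operator
  -- norm bounds C in L², hence on H₁.
  let B : EuclideanSpace ℂ (Fin N) →L[ℂ] EuclideanSpace ℂ (Fin N) :=
    Matrix.toEuclideanCLM (𝕜 := ℂ) (Matrix.of fun i k => starRingEnd ℂ (A i k))
  refine ⟨‖B‖, fun v => ?_⟩
  rw [← hj.coefIsometry.norm_map, ← hj.coefIsometry.norm_map (v : H₁)]
  refine Lp.norm_le_mul_norm_of_ae_le_mul ?_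
  filter_upwards [ae_all_iff.2 fun i => hj.coefFun_casimir_ae_eq hρ₁ hp (fun i => (hA i).symm) i v]
    with g hg
  have h1 : hj.coefIsometry (ρ₁.envAction m (casimir m p) v : H₁) g =
      B (hj.coefIsometry (v : H₁) g) := by
    ext i
    have h2 : (((s g)⁻¹ : ℝ) : ℂ) ≠ 0 :=
      Complex.ofReal_ne_zero.2 (inv_ne_zero (hj.weight_pos g).ne')
    refine mul_right_cancel₀ h2 ((hg i).trans ?_)
    rw [Matrix.ofLp_toEuclideanCLM, Matrix.mulVec, dotProduct, Finset.sum_mul]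
    exact Finset.sum_congr rfl fun k _ => (mul_assoc _ _ _).symm
  rw [h1]
  exact B.le_opNorm _

end Casimir

end IsWeightedCompletion

end HilbertRep

end RealReductive

namespace RealReductive

/-! ### The weights used in the theorem, and conclusion -/

namespace HilbertRep

variable {m n : ℕ} {G : Type*} [Group G] [TopologicalSpace G]
  [ChartedSpace (EuclideanSpace ℝ (Fin m)) G]
  {p : G →* GL (Fin n) ℝ}
  {H : Type*} [NormedAddCommGroup H] [InnerProductSpace ℂ H] [CompleteSpace H]
  {H₁ : Type*} [NormedAddCommGroup H₁] [InnerProductSpace ℂ H₁]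
  {ρ : HilbertRep G H}
  [MeasurableSpace G] {μ : Measure G}
  {N : ℕ} {j : H →ₗ[ℂ] H₁}

theorem IsWeightedCompletion.exists_rep [LieGroup (𝓡 m) ∞ G] [CompleteSpace H₁] [BorelSpace G]
    [IsFiniteMeasureOnCompacts μ] [μ.IsMulRightInvariant] {s : G → ℝ}
    {w : Fin N → ρ.smoothVectors m}
    (hj : IsWeightedCompletion ρ μ (fun i => (w i : H)) s j) (hp : IsRealReductive m p)
    (hw : ∀ i, ρ.envAction m (casimir m p) (w i) ∈ Submodule.span ℂ (Set.range w)) :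
    ∃ ρ₁ : HilbertRep G H₁, (∀ g x, ρ₁.toHom g (j x) = j (ρ.conjDual g x)) ∧
      WithSeminorms (ρ₁.casimirSeminorm m p) (topology := ρ₁.smoothTopology m) := by
  have := topologicalGroup_of_lieGroup (𝓡 m) ∞ (G := G)
  have := hp.t2Space
  -- With local compactness this gives σ-compactness for the test function argument, and it gives
  -- first countability for dominated convergence along neighborhoods of 1.
  have := hp.secondCountableTopology
  have : LocallyCompactSpace G := ChartedSpace.locallyCompactSpace (EuclideanSpace ℝ (Fin m)) G
  obtain ⟨M, hM⟩ := hj.exists_norm_casimir_le hj.rep_toHom_apply hp hw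
  exact ⟨hj.rep, hj.rep_toHom_apply, hj.rep.withSeminorms_casimirSeminorm hp hM⟩

/-- The weight is the square root of ‖g‖^(-2d-d₀), and the growth bound on the dual leaves
A²‖g‖^(-d₀), which is integrable. -/
theorem isWeightedCompletion_groupNorm [ContinuousInv G] (hp : IsRealReductive m p) (hn : n ≠ 0)
    {w : Fin N → H} {A d d₀ : ℝ} (hA : ∀ g, ‖ρ.conjDual g‖ ≤ A * groupNorm p g ^ d)
    (hd₀ : Integrable (fun g => groupNorm p g ^ (-d₀)) μ) (hj : DenseRange j)
    (hform : ∀ x y, inner ℂ (j x) (j y) = ρ.matrixCoeffForm p μ w (2 * d + d₀) x y) :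
    IsWeightedCompletion ρ μ w (fun g => groupNorm p g ^ (-((2 * d + d₀) / 2))) j := by
  have hpos := groupNorm_pos p hn
  have hsq : ∀ g, (groupNorm p g ^ (-((2 * d + d₀) / 2))) ^ 2 = groupNorm p g ^ (-(2 * d + d₀)) :=
    fun g => by
      rw [← Real.rpow_natCast, ← Real.rpow_mul (hpos g).le]
      congr 1
      push_cast
      ring
  refine
    { continuous_weight := (continuous_groupNorm hp).rpow_const fun g => Or.inl (hpos g).ne'
      weight_pos := fun g => Real.rpow_pos_of_pos (hpos g) _
      exists_weight_mul_le := ⟨_, (continuous_groupNorm hp).rpow_const fun g => Or.inl (hpos g).ne',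
        groupNorm_rpow_mul_le p hn _⟩
      exists_integrable := ⟨_, hd₀.const_mul (A ^ 2), fun g => ?_⟩
      dense := hj
      inner_eq := fun x y => ?_ }
  · rw [mul_pow, hsq]
    calc ‖ρ.conjDual g‖ ^ 2 * groupNorm p g ^ (-(2 * d + d₀))
        ≤ (A * groupNorm p g ^ d) ^ 2 * groupNorm p g ^ (-(2 * d + d₀)) := by
          gcongr
          · exact Real.rpow_nonneg (hpos g).le _
          · exact hA g
      _ = A ^ 2 * groupNorm p g ^ (-d₀) := by
          rw [mul_pow, mul_assoc, ← Real.rpow_natCast (groupNorm p g ^ d),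
            ← Real.rpow_mul (hpos g).le, ← Real.rpow_add (hpos g)]
          congr 2
          push_cast
          ring
  · rw [hform, matrixCoeffForm]
    simp only [hsq]

/-- Serves the degenerate case n = 0, where the group norm vanishes and cannot be used as a positive
weight. -/
theorem isWeightedCompletion_one [CompactSpace G] [IsFiniteMeasureOnCompacts μ] {w : Fin N → H}
    {C : ℝ} (hC : ∀ g, ‖ρ.conjDual g‖ ≤ C) (hj : DenseRange j)
    (hform : ∀ x y, inner ℂ (j x) (j y) =
      ∑ i, ∫ g, inner ℂ (ρ.conjDual g x) (w i) * inner ℂ (w i) (ρ.conjDual g y) ∂μ) :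
    IsWeightedCompletion ρ μ w (fun _ => 1) j where
  continuous_weight := continuous_const
  weight_pos _ := one_pos
  exists_weight_mul_le := ⟨fun _ => 1, continuous_const, fun _ _ => by simp⟩
  exists_integrable := ⟨fun _ => C ^ 2, integrable_const _, fun g => by
    rw [mul_one]
    exact pow_le_pow_left₀ (norm_nonneg _) (hC g) 2⟩
  dense := hj
  inner_eq x y := by simpa using hform x y

end HilbertRep

end RealReductive

theorem proposition16 {n m : ℕ} {G : Type*} [Group G] [TopologicalSpace G]
    [ChartedSpace (EuclideanSpace ℝ (Fin m)) G] [LieGroup (𝓡 m) ∞ G]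
    (p : G →* GL (Fin n) ℝ) (hp : RealReductive.IsRealReductive m p)
    {H : Type*} [NormedAddCommGroup H] [InnerProductSpace ℂ H] [CompleteSpace H]
    (ρ : RealReductive.HilbertRep G H) :
    -- the Casimir element acts by a scalar on the smooth vectors
    (∀ c : ℂ, (∀ v : ρ.smoothVectors m, ρ.envAction m (RealReductive.casimir m p) v = c • v) →
      WithSeminorms (ρ.casimirSeminorm m p) (topology := ρ.smoothTopology m)) ∧
    -- the completion `H₁` of `H` for the inner product defined by matrix coefficients
    (∀ [MeasurableSpace G] [BorelSpace G] (μ : Measure G) [IsFiniteMeasureOnCompacts μ]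
      [μ.IsOpenPosMeasure] [μ.IsMulRightInvariant],
      (∀ k ∈ RealReductive.maximalCompact p, ∀ v w : H,
        inner ℂ (ρ.toHom k v) (ρ.toHom k w) = inner ℂ v w) →
      ∀ (N : ℕ) (w : Fin N → ρ.smoothVectors m),
      Orthonormal ℂ (fun i => (w i : H)) →
      (∀ k ∈ RealReductive.maximalCompact p, ∀ i,
        ρ.toHom k (w i) ∈ Submodule.span ℂ (Set.range fun j => (w j : H))) →
      (∀ z ∈ Subalgebra.center ℝ (RealReductive.Env m G), ∀ i,
        ρ.envAction m z (w i) ∈ Submodule.span ℂ (Set.range w)) →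
      (∀ v : ρ.smoothVectors m, ρ.IsKFinite p (v : H) ↔
        v ∈ Submodule.span ℂ
          (Set.range fun x : RealReductive.Env m G × Fin N => ρ.envAction m x.1 (w x.2))) →
      ∀ A d d₀ : ℝ, (∀ g, ‖ρ.conjDual g‖ ≤ A * RealReductive.groupNorm p g ^ d) →
      Integrable (fun g => RealReductive.groupNorm p g ^ (-d₀)) μ →
      ∀ {H₁ : Type*} [NormedAddCommGroup H₁] [InnerProductSpace ℂ H₁] [CompleteSpace H₁]
        (j : H →ₗ[ℂ] H₁), DenseRange j →
      (∀ x y : H, inner ℂ (j x) (j y) =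
        ρ.matrixCoeffForm p μ (fun i => (w i : H)) (2 * d + d₀) x y) →
      ∃ ρ₁ : RealReductive.HilbertRep G H₁,
        (∀ g x, ρ₁.toHom g (j x) = j (ρ.conjDual g x)) ∧
        WithSeminorms (ρ₁.casimirSeminorm m p) (topology := ρ₁.smoothTopology m)) := by
  refine ⟨fun c hc => ?_, ?_⟩
  · have := topologicalGroup_of_lieGroup (𝓡 m) ∞ (G := G)
    have := hp.t2Space
    refine ρ.withSeminorms_casimirSeminorm hp (M := ‖c‖) fun v => ?_
    rw [hc, Submodule.coe_smul, norm_smul]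
  intro _ _ μ _ _ _ _ N w _ _ hZ _ A d d₀ hA hd₀ H₁ _ _ _ j hj hform
  have hw := hZ _ (RealReductive.casimir_mem_center hp)
  by_cases hn : n = 0
  -- For n = 0 the target of p is trivial, so G equals the finite kernel and the group norm is
  -- identically 0. Real powers of 0 are 1 for exponent 0 and 0 otherwise, whence two cases.
  · subst hn
    have := hp.finite_ker
    have hker : ∀ g, g ∈ p.ker := fun g => Subsingleton.elim _ _
    have : Finite G := Finite.of_injective (fun g => (⟨g, hker g⟩ : p.ker)) fun g h e =>
      congrArg Subtype.val e
    have h0 : ∀ g, RealReductive.groupNorm p g = 0 := fun g => by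
      simp [RealReductive.groupNorm_eq]
    simp only [h0] at hA
    by_cases ha : 2 * d + d₀ = 0
    · have hform' : ∀ x y, inner ℂ (j x) (j y) = ∑ i, ∫ g, inner ℂ (ρ.conjDual g x) (w i : H) *
          inner ℂ (w i : H) (ρ.conjDual g y) ∂μ := fun x y => by
        rw [hform, RealReductive.HilbertRep.matrixCoeffForm]
        simp [ha]
      exact (RealReductive.HilbertRep.isWeightedCompletion_one hA hj hform').exists_rep hp hw
    -- Here the weight is 0 and the form vanishes; it is also the form of the constant weight 1 with
    -- all w_i replaced by 0.
    · have hform' : ∀ x y, inner ℂ (j x) (j y) = ∑ _i : Fin N, ∫ g, inner ℂ (ρ.conjDual g x)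
          ((0 : ρ.smoothVectors m) : H) *
            inner ℂ ((0 : ρ.smoothVectors m) : H) (ρ.conjDual g y) ∂μ := fun x y => by
        rw [hform, RealReductive.HilbertRep.matrixCoeffForm]
        simp only [h0, Real.zero_rpow (neg_ne_zero.2 ha)]
        simp
      exact (RealReductive.HilbertRep.isWeightedCompletion_one hA hj hform').exists_rep
        (w := fun _ => 0) hp fun i => by simp
  · have := topologicalGroup_of_lieGroup (𝓡 m) ∞ (G := G)
    exact (RealReductive.HilbertRep.isWeightedCompletion_groupNorm hp hn hA hd₀ hj
      hform).exists_rep hp hw
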